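/- **Definitions.** All graphs are finite and simple. A graph $G$ is *matching covered* if it is connected, has a perfect matching, and every edge lies in a perfect matching. For $S\subseteq V(G)$ let $\partial(S)$ be the set of edges with exactly one end in $S$, and let $\mathrm{mp}(\partial(S))$ be the maximum of $|M\cap\partial(S)|$ over all perfect matchings $M$ of $G$. The cut $\partial(S)$ is *tight* if $|M\cap \partial(S)|=1$ for every perfect matching $M$. A *brace* is a bipartite matching covered graph in which every tight cut $\partial(S)$ is trivial, i.e. $|S|=1$ or $|V(G)\setminus S|=1$. A *perfect matching decomposition* of $G$ is a pair $(T,\delta)$ of a cubic tree $T$ (every vertex has degree $1$ or $3$) and a bijection $\delta$ from the leaves of $T$ to $V(G)$. Removing an edge $t_1t_2$ of $T$ splits the leaves, and hence $V(G)$, into two classes, called the shores of $t_1t_2$, which define the cut $\partial(t_1t_2)$ of $G$. The *width* of $(T,\delta)$ is the maximum of $\mathrm{mp}(\partial(t_1t_2))$ over all edges $t_1t_2$ of $T$, and $\mathrm{pmw}(G)$ is the minimum width of a perfect matching decomposition of $G$. Let $G=(A\cup B,E)$ be a brace with colour classes $A$ and $B$. For a linear ordering $\lambda$ of $A$ and $a\in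 A$, let $\mathrm{Prec}_\lambda(a)=\{a'\in A:\lambda(a')\le\lambda(a)\}$ and let $\mathrm{Reach}_\lambda(a)=N(\mathrm{Prec}_\lambda(a))$. The *width* of $\lambda$ is $\max_{a\in A}\bigl(|\mathrm{Reach}_\lambda(a)|-|\mathrm{Prec}_\lambda(a)|\bigr)$. *Procedure* ORDER$(G,A)$, where loops run through $A$ in a fixed but arbitrary order: for each $a\in A$ with $|N(a)|=3$, put $P=\{a\}$; while $P\ne A$, append to the ordering the first $a'\in A\setminus P$ with $|N(a')\setminus N(P)|\le 1$ and add it to $P$; if there is no such $a'$, give up this $a$ and continue with the next one. Return the first complete ordering of $A$ obtained in this way; if there is none, answer that $G$ is not of perfect matching width $2$. **Theorem.** (i) Let $G=(A\cup B,E)$ be a brace on at least $6$ vertices. Then ORDER$(G,A)$ returns an ordering of $A$ of width $2$ if and only if $\mathrm{pmw}(G)=2$, and it answers that $G$ is not of perfect matching width $2$ if and only if $\mathrm{pmw}(G)\neq 2$. (ii) There is a polynomial-time algorithm (a single program on a random access machine whose number of steps is bounded by a polynomial in $|V(G)|$) which, given a brace $G=(A\cup B,E)$ together with $A$, outputs a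 perfect matching decomposition $(T,\delta)$ of $G$ of width $2$ if $\mathrm{pmw}(G)=2$, and reports that there is none if $\mathrm{pmw}(G)\ne2$. Moreover, if $\mathrm{pmw}(G)=2$ and $|V(G)|\ge6$, it also outputs the ordering $\lambda$ of width $2$ returned by ORDER$(G,A)$ (with loops in increasing order of the vertex numbers), and $(T,\delta)$ is obtained from $\lambda$ in the sense that for each $a\in A$ among the first $|A|-3$ elements of $\lambda$ the set $\mathrm{Prec}_\lambda(a)\cup\mathrm{Reach}_\lambda(a)$ is a shore of an edge of $T$. -/

import Mathlib

open Finset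

/-! ### Perfect matchings, tight cuts, braces -/

section Graphs

variable {V : Type*}

/-- The cut `∂(S)`: all edges of `G` with one end in `S` and the other outside `S`. -/
def edgeCut (G : SimpleGraph V) (S : Set V) : Set (Sym2 V) :=
  {e | e ∈ G.edgeSet ∧ ∃ u ∈ S, ∃ v ∉ S, e = s(u, v)}

/-- `G` is connected, it has a perfect matching, and every edge lies in a perfect matching. (The
middle clause only excludes the one-vertex graph.) -/
def IsMatchingCovered (G : SimpleGraph V) : Prop :=
  G.Connected ∧ (∃ M : G.Subgraph, M.IsPerfectMatching) ∧
    ∀ e ∈ G.edgeSet, ∃ M : G.Subgraph, M.IsPerfectMatching ∧ e ∈ M.edgeSet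

/-- `∂(Z)` contains exactly one edge of every perfect matching. -/
def IsTightCut (G : SimpleGraph V) (Z : Set V) : Prop :=
  ∀ M : G.Subgraph, M.IsPerfectMatching → (M.edgeSet ∩ edgeCut G Z).ncard = 1

/-- A brace: a bipartite matching covered graph all of whose tight cuts are trivial, that is, have
a shore consisting of a single vertex. -/
def IsBrace (G : SimpleGraph V) : Prop :=
  G.IsBipartite ∧ IsMatchingCovered G ∧
    ∀ Z : Set V, IsTightCut G Z → Z.ncard = 1 ∨ Zᶜ.ncard = 1

/-- `A` and `B` are the two colour classes of `G`, written `G = (A ∪ B, E)`. -/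
def HasColourClasses [Fintype V] [DecidableEq V] (G : SimpleGraph V) (A B : Finset V) : Prop :=
  G.IsBipartiteWith (A : Set V) (B : Set V) ∧ A ∪ B = univ

/-- The matching porosity of `∂(S)`: the maximum of `|M ∩ ∂(S)|` over all perfect matchings `M`. -/
noncomputable def matPor (G : SimpleGraph V) (S : Set V) : ℕ :=
  sSup {k | ∃ M : G.Subgraph, M.IsPerfectMatching ∧ (M.edgeSet ∩ edgeCut G S).ncard = k}

/-! ### Perfect matching decompositions and perfect matching width -/

/-- The vertex `w` is a leaf of `T`. -/
def IsLeaf {W : Type*} (T : SimpleGraph W) (w : W) : Prop :=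
  (T.neighborSet w).ncard = 1

/-- A perfect matching decomposition of a graph with vertex set `V`: a cubic tree (every vertex is
a leaf or has degree three) with vertex set `W`, and a bijection from its leaves to `V`. -/
structure PMDecomposition (V W : Type*) where
  tree : SimpleGraph W
  isTree : tree.IsTree
  cubic : ∀ w, IsLeaf tree w ∨ (tree.neighborSet w).ncard = 3
  δ : {w : W // IsLeaf tree w} ≃ V

namespace PMDecomposition

variable {W : Type*}

/-- The vertices of `G` mapped to leaves in the component of `T - t₁t₂` containing `t₁`. -/
def shore (D : PMDecomposition V W) (t₁ t₂ : W) : Set V :=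
  {x | (D.tree.deleteEdges {s(t₁, t₂)}).Reachable t₁ (D.δ.symm x : W)}

/-- The width: the maximum porosity of a cut induced by an edge of the tree. -/
noncomputable def width (G : SimpleGraph V) (D : PMDecomposition V W) : ℕ :=
  sSup {k | ∃ t₁ t₂, D.tree.Adj t₁ t₂ ∧ matPor G (D.shore t₁ t₂) = k}

end PMDecomposition

/-- The perfect matching width of `G`: the minimum width of a perfect matching decomposition. -/
noncomputable def pmw (G : SimpleGraph V) : ℕ :=
  sInf {k | ∃ (m : ℕ) (D : PMDecomposition V (Fin m)), D.width G = k}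

/-! ### Matching elimination orderings -/

variable [Fintype V] [DecidableEq V] (G : SimpleGraph V) [DecidableRel G.Adj]

/-- The neighbourhood `N(P)` of a set `P` of vertices. -/
def nbhd (P : Finset V) : Finset V :=
  P.biUnion fun v => G.neighborFinset v

/-- A linear ordering of `A`, as a bijection onto `{0, …, |A| - 1}`. -/
abbrev LinOrdering (A : Finset V) : Type _ := {a // a ∈ A} ≃ Fin #A

namespace LinOrdering

variable {A : Finset V}

/-- The elements of `A` in increasing order. -/
def toList (ord : LinOrdering A) : List V :=
  List.ofFn fun i => (ord.symm i : V)

/-- The elements of `A` that are smaller than or equal to `a`. -/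
def pred (ord : LinOrdering A) (a : {a // a ∈ A}) : Finset V :=
  (univ.filter fun a' => ord a' ≤ ord a).map (Function.Embedding.subtype _)

/-- The neighbours of the elements that are smaller than or equal to `a`. -/
def reach (ord : LinOrdering A) (a : {a // a ∈ A}) : Finset V :=
  nbhd G (ord.pred a)

/-- The width of the ordering: the maximum of `|reach a| - |pred a|` over all `a` in `A`. -/
noncomputable def width (ord : LinOrdering A) : ℤ :=
  ⨆ a : {a // a ∈ A}, ((#(ord.reach G a) : ℤ) - (#(ord.pred a) : ℤ))

end LinOrdering

/-! ### The greedy ordering procedure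

Sets over which the procedure loops are given as lists, which fix the order of the loops. -/

/-- Extend the list `P` of vertices chosen so far by `k` further vertices. Each of them is the first
vertex `a'` of the list `U` of unused vertices with `|N(a') \ N(P)| ≤ 1`. The outcome is `none` if
at some point there is no such vertex. -/
def greedyExtend : ℕ → List V → List V → Option (List V)
  | 0, P, _ => some P
  | k + 1, P, U =>
    match U.find? fun a' => #(G.neighborFinset a' \ nbhd G P.toFinset) ≤ 1 with
    | none => none
    | some a' => greedyExtend k (P ++ [a']) (U.erase a')

/-- Try all vertices `a` of the colour class listed by `l`; from each `a` of degree three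
extend greedily to an ordering of the whole class, and return the first complete ordering found.
The outcome `none` means that the procedure answers that the perfect matching width is not two. -/
def greedyOrder (l : List V) : Option (List V) :=
  l.findSome? fun a =>
    if #(G.neighborFinset a) = 3 then greedyExtend G (l.length - 1) [a] (l.erase a) else none

end Graphs

/-! ### A machine model with a step count

Programs in a deterministic structured language over a random access store of natural numbers:
finitely many scalar variables and arrays, which are addressed by numbers. Every evaluation of a
constant, variable, array entry, sum or difference, every assignment and every test costs one
step. There is no multiplication, so numbers have at most polynomially many bits after polynomially
many steps, and polynomial time is the same as on Turing machines. -/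

namespace RAM

structure Store where
  var : ℕ → ℕ
  arr : ℕ → ℕ → ℕ

def Store.setVar (s : Store) (x v : ℕ) : Store where
  var := Function.update s.var x v
  arr := s.arr

def Store.setArr (s : Store) (r k v : ℕ) : Store where
  var := s.var
  arr := Function.update s.arr r (Function.update (s.arr r) k v)

inductive Exp where
  | lit (c : ℕ)
  | var (x : ℕ)
  | get (r : ℕ) (i : Exp)
  | add (e f : Exp)
  | sub (e f : Exp)

/-- The value of an expression; subtraction is truncated at zero. -/
def Exp.val : Exp → Store → ℕ
  | lit c, _ => c
  | var x, s => s.var x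
  | get r i, s => s.arr r (i.val s)
  | add e f, s => e.val s + f.val s
  | sub e f, s => e.val s - f.val s

def Exp.cost : Exp → ℕ
  | lit _ => 1
  | var _ => 1
  | get _ i => i.cost + 1
  | add e f => e.cost + f.cost + 1
  | sub e f => e.cost + f.cost + 1

inductive Cmd where
  | skip
  | assign (x : ℕ) (e : Exp)
  | write (r : ℕ) (i e : Exp)
  | seq (c d : Cmd)
  | ite (e : Exp) (c d : Cmd)
  | loop (e : Exp) (c : Cmd)

/-- `c.Runs s s' t`: started in `s`, the program `c` halts in `s'` after exactly `t` steps. The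
test of `ite` and `loop` (which repeats its body while the test succeeds) is that the value of the
expression is not zero. -/
inductive Cmd.Runs : Cmd → Store → Store → ℕ → Prop
  | skip (s : Store) : Runs .skip s s 1
  | assign (x : ℕ) (e : Exp) (s : Store) :
      Runs (.assign x e) s (s.setVar x (e.val s)) (e.cost + 1)
  | write (r : ℕ) (i e : Exp) (s : Store) :
      Runs (.write r i e) s (s.setArr r (i.val s) (e.val s)) (i.cost + e.cost + 1)
  | seq {c d : Cmd} {s s' s'' : Store} {t t' : ℕ} :
      Runs c s s' t → Runs d s' s'' t' → Runs (.seq c d) s s'' (t + t')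
  | ite_pos {e : Exp} {c d : Cmd} {s s' : Store} {t : ℕ} :
      e.val s ≠ 0 → Runs c s s' t → Runs (.ite e c d) s s' (e.cost + 1 + t)
  | ite_neg {e : Exp} {c d : Cmd} {s s' : Store} {t : ℕ} :
      e.val s = 0 → Runs d s s' t → Runs (.ite e c d) s s' (e.cost + 1 + t)
  | loop_step {e : Exp} {c : Cmd} {s s' s'' : Store} {t t' : ℕ} :
      e.val s ≠ 0 → Runs c s s' t → Runs (.loop e c) s' s'' t' →
        Runs (.loop e c) s s'' (e.cost + 1 + t + t')
  | loop_exit {e : Exp} {c : Cmd} {s : Store} :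
      e.val s = 0 → Runs (.loop e c) s s (e.cost + 1)

/-- Programs are deterministic: final store and number of steps are determined by the input. -/
theorem Cmd.Runs.unique {c : Cmd} {s s₁ s₂ : Store} {t₁ t₂ : ℕ}
    (h₁ : c.Runs s s₁ t₁) (h₂ : c.Runs s s₂ t₂) : s₁ = s₂ ∧ t₁ = t₂ := by
  induction h₁ generalizing s₂ t₂ with
  | skip => cases h₂; exact ⟨rfl, rfl⟩
  | assign => cases h₂; exact ⟨rfl, rfl⟩
  | write => cases h₂; exact ⟨rfl, rfl⟩
  | seq _ _ ih ih' =>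
    cases h₂ with
    | seq a b => obtain ⟨rfl, rfl⟩ := ih a; obtain ⟨rfl, rfl⟩ := ih' b; exact ⟨rfl, rfl⟩
  | ite_pos h _ ih =>
    cases h₂ with
    | ite_pos _ a => obtain ⟨rfl, rfl⟩ := ih a; exact ⟨rfl, rfl⟩
    | ite_neg h' _ => exact absurd h' h
  | ite_neg h _ ih =>
    cases h₂ with
    | ite_pos h' _ => exact absurd h h'
    | ite_neg _ a => obtain ⟨rfl, rfl⟩ := ih a; exact ⟨rfl, rfl⟩
  | loop_step h _ _ ih ih' =>
    cases h₂ with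
    | loop_step _ a b => obtain ⟨rfl, rfl⟩ := ih a; obtain ⟨rfl, rfl⟩ := ih' b; exact ⟨rfl, rfl⟩
    | loop_exit h' => exact absurd h' h
  | loop_exit h =>
    cases h₂ with
    | loop_step h' _ _ => exact absurd h h'
    | loop_exit _ => exact ⟨rfl, rfl⟩

/-- The input `(G, A)` for a graph `G` with vertices `0, …, N - 1`: variable `0` holds `N`,
array `0` the adjacency matrix row by row, array `1` the indicator function of `A`. Everything
else is zero. -/
def inputStore {N : ℕ} (G : SimpleGraph (Fin N)) [DecidableRel G.Adj] (A : Finset (Fin N)) :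
    Store where
  var x := if x = 0 then N else 0
  arr r k :=
    if r = 0 then (if ∃ i j : Fin N, k = i * N + j ∧ G.Adj i j then 1 else 0)
    else if r = 1 then (if ∃ i ∈ A, k = (i : ℕ) then 1 else 0)
    else 0

/-- The store `s` holds the decomposition `D` as output: variable `1` holds the number of nodes of
the tree, variable `2` the length of a list of its edges, arrays `2` and `3` the two ends of each
edge in this list, and array `4` the map from the leaves to the vertices of the graph. -/
def Store.HoldsDecomposition {N m : ℕ} (s : Store) (D : PMDecomposition (Fin N) (Fin m)) : Prop :=
  s.var 1 = m ∧
  (∀ k < s.var 2, s.arr 2 k < m ∧ s.arr 3 k < m) ∧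
  (∀ u v : Fin m, D.tree.Adj u v ↔ ∃ k < s.var 2,
    (s.arr 2 k = u ∧ s.arr 3 k = v) ∨ (s.arr 2 k = v ∧ s.arr 3 k = u)) ∧
  ∀ w : {w : Fin m // IsLeaf D.tree w}, s.arr 4 w.1 = D.δ w

/-- The store `s` holds the ordering `ord` as output: array `5` lists its elements increasingly. -/
def Store.HoldsOrdering {N : ℕ} {A : Finset (Fin N)} (s : Store) (ord : LinOrdering A) : Prop :=
  ∀ i : Fin #A, s.arr 5 i = ((ord.symm i : Fin N) : ℕ)

end RAM

/-! Let n = |A| = |B|. For nonempty X ⊆ A with |X| ≤ n - 2, every perfect matching leaves the set X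
∪ N(X) through exactly |N(X)| - |X| edges. This number is not 0, by connectedness, and not 1, since
the cut would be tight with both shores nontrivial. Hence |N(X)| ≥ |X| + 2
(`IsBrace.card_add_two_le_card_nbhd`), and Hall's theorem puts any two disjoint edges into a common
perfect matching.

This classifies the cuts of porosity at most two. If a shore S is odd, the cut is tight, hence
trivial. If S is even, its two colours are balanced or differ by two. A balanced shore with 2 ≤ |S ∩
A| ≤ n - 2 is impossible: two disjoint edges leave S from A, and a perfect matching containing them
must also leave S twice from B. If B has a surplus of two, no edge leaves S from A.

Let a decomposition have width two. By the classification, a shore with a surplus of two in B is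
either a pair of vertices of B or splits into one vertex of each colour and a smaller shore with the
same surplus (`IsBrace.branch_cases`). Read from the small end, such a chain adds vertices of A one
at a time, each with at most one new neighbour, and the first has degree three
(`IsBrace.elim_of_isShore`). For n ≥ 4 some shore is a pair of vertices of A; its complement yields
an ordering of all but two vertices of A, and these two have no new neighbours
(`IsBrace.exists_elim`). For n = 3 the brace is complete bipartite.

Conversely, let an ordering start with degree three and then discover at most one new vertex of B at
each step. Lay out A and B in order along a caterpillar of cherries. The shores of its spine are
closed under neighbours of vertices of A and have at most two more vertices of B than of A, so their
porosity is at most two (`EnumClasses.width_le`).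

Greediness does no harm: if some good ordering starts with a, and P contains a but not all of A,
then the first vertex of that ordering outside P has all its predecessors in P and can be added
(`Elim.exists_next`).

For the machine, programs are written with loops bounded by N only. Their meaning is a function on
stores and their running time is polynomial by structural induction (`RAM.Prog.runs_compile`), so
that correctness reduces to loop invariants (`RAM.mainProg_spec`). -/

set_option linter.unusedSectionVars false

/-! ### Perfect matchings as involutions, porosity and tight cuts -/

section Mates

variable {V : Type*}

/-- A perfect matching, given as the involution that maps each vertex to its partner. -/
def IsMate (G : SimpleGraph V) (f : V → V) : Prop :=
  (∀ v, G.Adj v (f v)) ∧ ∀ v, f (f v) = v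

variable {G : SimpleGraph V}

theorem IsMate.injective {f : V → V} (hf : IsMate G f) : Function.Injective f :=
  Function.LeftInverse.injective hf.2

theorem exists_isMate_of_isPerfectMatching {M : G.Subgraph} (hM : M.IsPerfectMatching) :
    ∃ f, IsMate G f ∧ ∀ v w, M.Adj v w ↔ f v = w := by
  rw [SimpleGraph.Subgraph.isPerfectMatching_iff] at hM
  choose f hf hu using hM
  have hadj : ∀ v w, M.Adj v w ↔ f v = w :=
    fun v w => ⟨fun h => (hu v w h).symm, fun h => h ▸ hf v⟩
  exact ⟨f, ⟨fun v => (hf v).adj_sub, fun v => (hadj _ _).1 (hf v).symm⟩, hadj⟩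

theorem IsMate.exists_isPerfectMatching {f : V → V} (hf : IsMate G f) :
    ∃ M : G.Subgraph, M.IsPerfectMatching ∧ ∀ v w, M.Adj v w ↔ f v = w := by
  refine ⟨{ verts := Set.univ
            Adj := fun v w => f v = w
            adj_sub := fun {v w} h => h ▸ hf.1 v
            edge_vert := fun _ => trivial
            symm := ⟨fun v w (h : f v = w) => show f w = v by rw [← h, hf.2]⟩ }, ?_, fun _ _ => Iff.rfl⟩
  rw [SimpleGraph.Subgraph.isPerfectMatching_iff]
  exact fun v => ⟨f v, rfl, fun w (h : f v = w) => h.symm⟩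

variable [Fintype V] [DecidableEq V]

/-- The number of vertices of `S` whose partner lies outside `S`. -/
def crossing (f : V → V) (S : Finset V) : ℕ := #(S.filter (f · ∉ S))

/-- A matching edge in the cut has exactly one end in `S`, so these edges can be counted by that
end. From here on cuts are treated as counts of vertices. -/
theorem ncard_inter_edgeCut {M : G.Subgraph} {f : V → V} (hf : IsMate G f)
    (hM : ∀ v w, M.Adj v w ↔ f v = w) (S : Finset V) :
    (M.edgeSet ∩ edgeCut G (S : Set V)).ncard = crossing f S := by
  have himg : M.edgeSet ∩ edgeCut G (S : Set V)
      = (fun v => s(v, f v)) '' (S.filter (f · ∉ S) : Set V) := by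
    ext e
    induction e with
    | h x y =>
    simp only [edgeCut, Set.mem_inter_iff, SimpleGraph.Subgraph.mem_edgeSet, hM, Set.mem_image,
      SimpleGraph.mem_edgeSet, Set.mem_ofPred_eq, coe_filter, mem_coe]
    constructor
    · rintro ⟨h, -, u, hu, v, hv, he⟩
      rw [Sym2.eq_iff] at he
      rcases he with ⟨rfl, rfl⟩ | ⟨rfl, rfl⟩
      · exact ⟨x, ⟨hu, by rwa [h]⟩, by rw [h]⟩
      · have : f y = x := by rw [← h, hf.2]
        exact ⟨y, ⟨hu, by rwa [this]⟩, by rw [this, Sym2.eq_swap]⟩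
    · rintro ⟨v, ⟨hv, hfv⟩, he⟩
      have hadj := hf.1 v
      rw [Sym2.eq_iff] at he
      rcases he with ⟨rfl, rfl⟩ | ⟨rfl, rfl⟩
      · exact ⟨rfl, hadj, v, hv, _, hfv, rfl⟩
      · exact ⟨hf.2 _, hadj.symm, v, hv, _, hfv, Sym2.eq_swap⟩
  rw [himg, Set.InjOn.ncard_image, Set.ncard_coe_finset, crossing]
  intro v hv w hw h
  simp only [coe_filter, Set.mem_ofPred_eq] at hv hw
  rcases Sym2.eq_iff.1 h with ⟨h, -⟩ | ⟨h, h'⟩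
  · exact h
  · exact absurd hw.1 (by rw [← h']; exact hv.2)

theorem crossing_le_card (f : V → V) (S : Finset V) : crossing f S ≤ #S :=
  card_filter_le _ _

theorem crossing_compl {f : V → V} (hf : IsMate G f) (S : Finset V) :
    crossing f Sᶜ = crossing f S := by
  refine card_bij (fun v _ => f v) ?_ (fun _ _ _ _ h => hf.injective h) ?_
  · intro v hv
    simp only [mem_filter, mem_compl, not_not] at hv ⊢
    exact ⟨hv.2, by rw [hf.2]; exact hv.1⟩
  · intro v hv
    simp only [mem_filter, mem_compl, not_not] at hv ⊢
    exact ⟨f v, ⟨hv.2, by rw [hf.2]; exact hv.1⟩, hf.2 v⟩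

theorem setOf_porosity_eq (G : SimpleGraph V) (S : Finset V) :
    {k | ∃ M : G.Subgraph, M.IsPerfectMatching ∧ (M.edgeSet ∩ edgeCut G (S : Set V)).ncard = k}
      = {k | ∃ f, IsMate G f ∧ crossing f S = k} := by
  ext k
  constructor
  · rintro ⟨M, hM, rfl⟩
    obtain ⟨f, hf, h⟩ := exists_isMate_of_isPerfectMatching hM
    exact ⟨f, hf, (ncard_inter_edgeCut hf h S).symm⟩
  · rintro ⟨f, hf, rfl⟩
    obtain ⟨M, hM, h⟩ := hf.exists_isPerfectMatching
    exact ⟨M, hM, ncard_inter_edgeCut hf h S⟩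

theorem crossing_le_matPor (S : Finset V) {f : V → V} (hf : IsMate G f) :
    crossing f S ≤ matPor G S := by
  rw [matPor, setOf_porosity_eq]
  exact le_csSup ⟨#S, by rintro _ ⟨f, -, rfl⟩; exact crossing_le_card f S⟩ ⟨f, hf, rfl⟩

theorem matPor_le {S : Finset V} {k : ℕ} (h : ∀ f, IsMate G f → crossing f S ≤ k) :
    matPor G S ≤ k := by
  rw [matPor, setOf_porosity_eq]
  exact csSup_le' (by rintro _ ⟨f, hf, rfl⟩; exact h f hf)

theorem isTightCut_iff (S : Finset V) :
    IsTightCut G S ↔ ∀ f, IsMate G f → crossing f S = 1 := by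
  constructor
  · intro h f hf
    obtain ⟨M, hM, hMf⟩ := hf.exists_isPerfectMatching
    rw [← ncard_inter_edgeCut hf hMf S]
    exact h M hM
  · intro h M hM
    obtain ⟨f, hf, hMf⟩ := exists_isMate_of_isPerfectMatching hM
    rw [ncard_inter_edgeCut hf hMf S]
    exact h f hf

end Mates

/-! ### Expansion in braces and cuts of porosity at most two -/

section Braces

variable {V : Type*} [Fintype V] [DecidableEq V] {G : SimpleGraph V} {A B : Finset V}

namespace HasColourClasses

theorem symm (h : HasColourClasses G A B) : HasColourClasses G B A :=
  ⟨h.1.symm, by rw [union_comm]; exact h.2⟩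

theorem disjoint (h : HasColourClasses G A B) : Disjoint A B := by
  exact_mod_cast h.1.disjoint

theorem mem_or_mem (h : HasColourClasses G A B) (v : V) : v ∈ A ∨ v ∈ B := by
  rw [← mem_union, h.2]; exact mem_univ v

theorem mem_right_iff (h : HasColourClasses G A B) {v : V} : v ∈ B ↔ v ∉ A :=
  ⟨fun hb ha => disjoint_left.1 h.disjoint ha hb, fun ha => (h.mem_or_mem v).resolve_left ha⟩

theorem mem_right_of_adj (h : HasColourClasses G A B) {v w : V} (hvw : G.Adj v w) (hv : v ∈ A) :
    w ∈ B := by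
  rcases h.1.mem_of_adj hvw with ⟨-, hw⟩ | ⟨hv', -⟩
  · exact_mod_cast hw
  · exact absurd hv (h.mem_right_iff.1 (by exact_mod_cast hv'))

theorem compl_left (h : HasColourClasses G A B) : Aᶜ = B := by
  ext v; rw [mem_compl, h.mem_right_iff]

theorem card_inter_add (h : HasColourClasses G A B) (S : Finset V) :
    #(S ∩ A) + #(S ∩ B) = #S := by
  rw [← h.compl_left, ← card_union_of_disjoint, ← inter_union_distrib_left, union_compl,
    inter_univ]
  exact (disjoint_compl_right).mono inter_subset_right inter_subset_right

theorem card_add (h : HasColourClasses G A B) : #A + #B = Fintype.card V := by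
  have := h.card_inter_add univ
  simpa using this

theorem image_left (h : HasColourClasses G A B) {f : V → V} (hf : IsMate G f) : A.image f = B := by
  ext v
  rw [mem_image]
  constructor
  · rintro ⟨a, ha, rfl⟩
    exact h.mem_right_of_adj (hf.1 a) ha
  · intro hv
    exact ⟨f v, h.symm.mem_right_of_adj (hf.1 v) hv, hf.2 v⟩

theorem card_eq (h : HasColourClasses G A B) {f : V → V} (hf : IsMate G f) : #A = #B := by
  rw [← h.image_left hf, card_image_of_injective _ hf.injective]

theorem crossing_eq (h : HasColourClasses G A B) (f : V → V) (S : Finset V) :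
    crossing f S = #((S ∩ A).filter (f · ∉ S)) + #((S ∩ B).filter (f · ∉ S)) := by
  rw [crossing, ← h.card_inter_add, filter_inter, filter_inter]

/-- Vertices of `S` matched inside `S` pair off the two colours, so the imbalance of `S` equals the
difference of the numbers of partners leaving from either colour. -/
theorem card_inter_add_crossing (h : HasColourClasses G A B) {f : V → V} (hf : IsMate G f)
    (S : Finset V) :
    #(S ∩ A) + #((S ∩ B).filter (f · ∉ S)) = #(S ∩ B) + #((S ∩ A).filter (f · ∉ S)) := by
  have h1 := card_filter_add_card_filter_not (s := S ∩ A) (f · ∈ S)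
  have h2 := card_filter_add_card_filter_not (s := S ∩ B) (f · ∈ S)
  have h3 : #((S ∩ A).filter (f · ∈ S)) = #((S ∩ B).filter (f · ∈ S)) := by
    refine card_bij (fun v _ => f v) ?_ (fun _ _ _ _ e => hf.injective e) ?_
    · intro v hv
      simp only [mem_filter, mem_inter] at hv ⊢
      exact ⟨⟨hv.2, h.mem_right_of_adj (hf.1 v) hv.1.2⟩, by rw [hf.2]; exact hv.1.1⟩
    · intro v hv
      simp only [mem_filter, mem_inter] at hv ⊢
      exact ⟨f v, ⟨⟨hv.2, h.symm.mem_right_of_adj (hf.1 v) hv.1.2⟩, by rw [hf.2]; exact hv.1.1⟩,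
        hf.2 v⟩
  omega

/-- A set that contains all neighbours of its vertices in `A` is left only from its surplus of
vertices in `B`. -/
theorem crossing_add_of_closed (h : HasColourClasses G A B) {f : V → V} (hf : IsMate G f)
    {S : Finset V} (hS : ∀ v ∈ S, v ∈ A → ∀ w, G.Adj v w → w ∈ S) :
    crossing f S + #(S ∩ A) = #(S ∩ B) := by
  have h1 : (S ∩ A).filter (f · ∉ S) = ∅ := by
    refine filter_eq_empty_iff.2 fun v hv => ?_
    rw [mem_inter] at hv
    exact not_not.2 (hS v hv.1 hv.2 _ (hf.1 v))
  have h2 := h.card_inter_add_crossing hf S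
  have h3 := h.crossing_eq f S
  rw [h1, card_empty] at h2 h3
  omega

end HasColourClasses

section

variable [DecidableRel G.Adj]

theorem mem_nbhd {P : Finset V} {w : V} : w ∈ nbhd G P ↔ ∃ v ∈ P, G.Adj v w := by
  simp [nbhd]

theorem nbhd_mono {P Q : Finset V} (h : P ⊆ Q) : nbhd G P ⊆ nbhd G Q :=
  biUnion_subset_biUnion_of_subset_left _ h

theorem nbhd_insert (a : V) (P : Finset V) :
    nbhd G (insert a P) = G.neighborFinset a ∪ nbhd G P := by
  rw [nbhd, biUnion_insert, nbhd]

theorem nbhd_singleton (a : V) : nbhd G {a} = G.neighborFinset a := by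
  rw [nbhd, singleton_biUnion]

theorem HasColourClasses.nbhd_subset (h : HasColourClasses G A B) {P : Finset V} (hP : P ⊆ A) :
    nbhd G P ⊆ B := by
  intro w hw
  obtain ⟨v, hv, hvw⟩ := mem_nbhd.1 hw
  exact h.mem_right_of_adj hvw (hP hv)

end

theorem IsBrace.exists_isMate (hG : IsBrace G) : ∃ f, IsMate G f := by
  obtain ⟨M, hM⟩ := hG.2.1.2.1
  obtain ⟨f, hf, -⟩ := exists_isMate_of_isPerfectMatching hM
  exact ⟨f, hf⟩

theorem IsBrace.exists_isMate_of_adj (hG : IsBrace G) {v w : V} (h : G.Adj v w) :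
    ∃ f, IsMate G f ∧ f v = w := by
  obtain ⟨M, hM, he⟩ := hG.2.1.2.2 s(v, w) h
  obtain ⟨f, hf, h'⟩ := exists_isMate_of_isPerfectMatching hM
  exact ⟨f, hf, (h' v w).1 he⟩

theorem IsBrace.exists_adj (hG : IsBrace G) {S : Finset V} (h1 : S.Nonempty) (h2 : S ≠ univ) :
    ∃ v ∈ S, ∃ w ∉ S, G.Adj v w := by
  obtain ⟨x, hx⟩ := h1
  obtain ⟨y, hy⟩ : ∃ y, y ∉ S := by
    by_contra! h; exact h2 (eq_univ_iff_forall.2 h)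
  obtain ⟨p⟩ := hG.2.1.1.preconnected x y
  obtain ⟨d, -, h1, h2⟩ := p.exists_boundary_dart (S : Set V) (by simpa) (by simpa)
  exact ⟨d.fst, by simpa using h1, d.snd, by simpa using h2, d.adj⟩

theorem IsBrace.exists_crossing_pos (hG : IsBrace G) {S : Finset V} (h1 : S.Nonempty)
    (h2 : S ≠ univ) : ∃ f, IsMate G f ∧ 0 < crossing f S := by
  obtain ⟨v, hv, w, hw, hvw⟩ := hG.exists_adj h1 h2
  obtain ⟨f, hf, rfl⟩ := hG.exists_isMate_of_adj hvw
  exact ⟨f, hf, card_pos.2 ⟨v, by simp [hv, hw]⟩⟩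

theorem IsBrace.card_eq (hG : IsBrace G) (hAB : HasColourClasses G A B) : #A = #B := by
  obtain ⟨f, hf⟩ := hG.exists_isMate
  exact hAB.card_eq hf

theorem IsBrace.trivial_of_tight (hG : IsBrace G) {S : Finset V}
    (hS : ∀ f, IsMate G f → crossing f S = 1) : #S = 1 ∨ #Sᶜ = 1 := by
  have := hG.2.2 S ((isTightCut_iff S).2 hS)
  rwa [← coe_compl, Set.ncard_coe_finset, Set.ncard_coe_finset] at this

variable [DecidableRel G.Adj]

/-- The set `X ∪ N(X)` is left only from its surplus of `B`, so its crossing number is the same for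
all perfect matchings. Crossing number 0 contradicts connectedness. Crossing number 1 gives a tight
cut; the size of `X` rules out a single vertex on either shore. -/
theorem IsBrace.card_add_two_le_card_nbhd (hG : IsBrace G) (hAB : HasColourClasses G A B)
    {X : Finset V} (hX : X ⊆ A) (h0 : X.Nonempty) (h2 : #X + 2 ≤ #A) : #X + 2 ≤ #(nbhd G X) := by
  obtain ⟨S, hS⟩ : ∃ S, S = X ∪ nbhd G X := ⟨_, rfl⟩
  have hN := hAB.nbhd_subset hX
  have hSA : S ∩ A = X := by
    ext v
    have := @hN v
    have := hAB.mem_right_iff (v := v)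
    have := @hX v
    grind
  have hSB : S ∩ B = nbhd G X := by
    ext v
    have := @hN v
    have := hAB.mem_right_iff (v := v)
    have := @hX v
    grind
  have hcl : ∀ f, IsMate G f → crossing f S + #X = #(nbhd G X) := by
    intro f hf
    have := hAB.crossing_add_of_closed hf (S := S) fun v hv hvA w hvw =>
      hS ▸ mem_union_right _ (mem_nbhd.2 ⟨v, by rw [← hSA]; exact mem_inter.2 ⟨hv, hvA⟩, hvw⟩)
    rwa [hSA, hSB] at this
  have hS1 := hAB.card_inter_add S
  rw [hSA, hSB] at hS1
  have hne : S ≠ univ := by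
    intro h
    have := hSA
    rw [h, univ_inter] at this
    rw [this] at h2
    omega
  obtain ⟨f, hf, hpos⟩ := hG.exists_crossing_pos (h0.mono (hS ▸ subset_union_left)) hne
  have h1 := hcl f hf
  by_contra hlt
  have hXpos := h0.card_pos
  rcases hG.trivial_of_tight (S := S) (fun g hg => by have := hcl g hg; omega) with h | h
  · omega
  · rw [card_compl, ← hAB.card_add, ← hG.card_eq hAB] at h
    omega

/-- Two disjoint edges of a brace lie in a common perfect matching. -/
theorem IsBrace.exists_isMate_of_adj_adj (hG : IsBrace G) (hAB : HasColourClasses G A B)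
    {a a' b b' : V} (ha : a ∈ A) (ha' : a' ∈ A) (haa : a ≠ a') (hbb : b ≠ b') (hab : G.Adj a b)
    (hab' : G.Adj a' b') : ∃ f, IsMate G f ∧ f a = b ∧ f a' = b' := by
  -- Hall's theorem is applied to a family in which `a` and `a'` are forced to `b` and `b'` and all
  -- other vertices avoid these two. The surplus of two in the neighbourhood of the other vertices
  -- pays for the removal.
  let t : {x // x ∈ A} → Finset V := fun x =>
    if x.1 = a then {b} else if x.1 = a' then {b'} else G.neighborFinset x.1 \ {b, b'}
  have ht : ∀ s : Finset {x // x ∈ A}, #s ≤ #(s.biUnion t) := by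
    intro s
    obtain ⟨X, hX⟩ : ∃ X : Finset V, X = (s.image Subtype.val) \ {a, a'} := ⟨_, rfl⟩
    have hXA : X ⊆ A := by
      intro v hv
      simp only [hX, mem_sdiff, mem_image] at hv
      obtain ⟨⟨x, -, rfl⟩, -⟩ := hv
      exact x.2
    have hXA2 : #X + 2 ≤ #A := by
      have h1 : X ⊆ A \ {a, a'} := by
        intro v hv
        exact mem_sdiff.2 ⟨hXA hv, (mem_sdiff.1 (hX ▸ hv)).2⟩
      have h2 := card_le_card h1
      have h3 : ({a, a'} : Finset V) ⊆ A := by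
        intro v hv; simp only [mem_insert, mem_singleton] at hv; rcases hv with rfl | rfl <;> assumption
      rw [card_sdiff_of_subset h3, card_pair haa] at h2
      have h4 := card_le_card h3
      rw [card_pair haa] at h4
      omega
    obtain ⟨Y, hY⟩ : ∃ Y : Finset V, Y = nbhd G X \ {b, b'} := ⟨_, rfl⟩
    have hXY : #X ≤ #Y := by
      rcases X.eq_empty_or_nonempty with h0 | h0
      · simp [h0]
      · have h1 := hG.card_add_two_le_card_nbhd hAB hXA h0 hXA2
        have h2 := le_card_sdiff {b, b'} (nbhd G X)
        rw [card_pair hbb, ← hY] at h2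
        omega
    obtain ⟨I, hI⟩ : ∃ I : Finset V, I = (s.image Subtype.val) ∩ {a, a'} := ⟨_, rfl⟩
    have hIle : #s = #X + #I := by
      rw [hX, hI, card_sdiff_add_card_inter, card_image_of_injective _ Subtype.val_injective]
    let g : V → V := fun v => if v = a then b else b'
    have hIinj : #(I.image g) = #I := by
      refine card_image_of_injOn fun v hv w hw h => ?_
      simp only [hI, coe_inter, Set.mem_inter_iff, mem_coe, mem_insert, mem_singleton] at hv hw
      grind
    have hdis : Disjoint Y (I.image g) := by
      rw [disjoint_left]
      intro v hv hv'
      simp only [hY, mem_sdiff, mem_insert, mem_singleton] at hv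
      simp only [mem_image] at hv'
      grind
    have hsub : Y ∪ I.image g ⊆ s.biUnion t := by
      intro v hv
      rw [mem_biUnion]
      rcases mem_union.1 hv with hv | hv
      · rw [hY, mem_sdiff] at hv
        obtain ⟨x, hx, hxv⟩ := mem_nbhd.1 hv.1
        rw [hX, mem_sdiff, mem_image] at hx
        obtain ⟨⟨z, hz, rfl⟩, hx⟩ := hx
        simp only [mem_insert, mem_singleton, not_or] at hx
        refine ⟨z, hz, ?_⟩
        simp only [t, if_neg hx.1, if_neg hx.2]
        exact mem_sdiff.2 ⟨by simpa using hxv, hv.2⟩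
      · rw [mem_image] at hv
        obtain ⟨x, hx, rfl⟩ := hv
        rw [hI, mem_inter, mem_image] at hx
        obtain ⟨⟨z, hz, rfl⟩, hx⟩ := hx
        simp only [mem_insert, mem_singleton] at hx
        refine ⟨z, hz, ?_⟩
        simp only [t, g]
        split_ifs <;> simp_all
    calc #s = #Y + #I - (#Y - #X) := by omega
      _ ≤ #(Y ∪ I.image g) := by rw [card_union_of_disjoint hdis, hIinj]; omega
      _ ≤ _ := card_le_card hsub
  obtain ⟨g, hginj, hg⟩ := (all_card_le_biUnion_card_iff_exists_injective t).1 ht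
  have hadj : ∀ x, G.Adj x.1 (g x) := by
    intro x
    have := hg x
    simp only [t] at this
    split_ifs at this with h1 h2
    · rw [mem_singleton] at this; rw [this, h1]; exact hab
    · rw [mem_singleton] at this; rw [this, h2]; exact hab'
    · simpa using (mem_sdiff.1 this).1
  -- An injection from `A` into `B` is onto, since the classes have equal size. Its inverse
  -- completes the involution on `B`.
  have hsurj : ∀ w ∈ B, ∃ x, g x = w := by
    have : univ.image g = B := by
      refine eq_of_subset_of_card_le ?_ ?_
      · intro w hw
        obtain ⟨x, -, rfl⟩ := mem_image.1 hw
        exact hAB.mem_right_of_adj (hadj x) x.2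
      · rw [card_image_of_injective _ hginj, card_univ, Fintype.card_coe, hG.card_eq hAB]
    intro w hw
    rw [← this] at hw
    obtain ⟨x, -, h⟩ := mem_image.1 hw
    exact ⟨x, h⟩
  have : Nonempty {x // x ∈ A} := ⟨⟨a, ha⟩⟩
  choose! k hk using hsurj
  let f : V → V := fun v => if h : v ∈ A then g ⟨v, h⟩ else k v
  have hfA : ∀ x : {x // x ∈ A}, f x = g x := fun x => dif_pos x.2
  have hfB : ∀ w ∈ B, f w = k w := fun w hw => dif_neg (hAB.mem_right_iff.1 hw)
  have hkg : ∀ x, k (g x) = x := fun x =>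
    (hginj (hk _ (hAB.mem_right_of_adj (hadj x) x.2)))
  refine ⟨f, ⟨fun v => ?_, fun v => ?_⟩, ?_, ?_⟩
  · rcases hAB.mem_or_mem v with hv | hv
    · rw [hfA ⟨v, hv⟩]; exact hadj ⟨v, hv⟩
    · rw [hfB v hv]
      have := hadj (k v)
      rw [hk v hv] at this
      exact this.symm
  · rcases hAB.mem_or_mem v with hv | hv
    · rw [hfA ⟨v, hv⟩, hfB _ (hAB.mem_right_of_adj (hadj _) hv), hkg]
    · rw [hfB v hv, hfA, hk v hv]
  · rw [hfA ⟨a, ha⟩]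
    simpa [t] using hg ⟨a, ha⟩
  · rw [hfA ⟨a', ha'⟩]
    simpa [t, haa.symm] using hg ⟨a', ha'⟩

/-- In a cut of porosity at most two with balanced shores, one shore is a pair. -/
theorem IsBrace.card_of_balanced (hG : IsBrace G) (hAB : HasColourClasses G A B) {S : Finset V}
    (hS : ∀ f, IsMate G f → crossing f S ≤ 2) (hbal : #(S ∩ A) = #(S ∩ B)) (h2 : 2 ≤ #(S ∩ A)) :
    #A ≤ #(S ∩ A) + 1 := by
  by_contra! hlt
  -- Inside `S` there is room for only |S ∩ B| = |S ∩ A| neighbours of `X`; expansion pushes the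
  -- rest out. So all of `S ∩ A` has two outer neighbours, and after deletion of one vertex at least
  -- one is left.
  have hout : ∀ X ⊆ S ∩ A, X.Nonempty → #X + 1 ≥ #(S ∩ A) →
      #X + 2 - #(S ∩ A) ≤ #(nbhd G X \ S) := by
    intro X hX h0 h1
    have hXA := hX.trans inter_subset_right
    have h3 := hG.card_add_two_le_card_nbhd hAB hXA h0 (by have := card_le_card hX; omega)
    have h4 := card_sdiff_add_card_inter (nbhd G X) S
    have h5 : nbhd G X ∩ S ⊆ S ∩ B := by
      rw [inter_comm]; exact inter_subset_inter_left (hAB.nbhd_subset hXA)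
    have := card_le_card h5
    omega
  obtain ⟨b, b', hb, hb', hbb⟩ : ∃ b b', b ∈ nbhd G (S ∩ A) \ S ∧ b' ∈ nbhd G (S ∩ A) \ S ∧
      b ≠ b' := by
    have := hout (S ∩ A) subset_rfl (card_pos.1 (by omega)) (by omega)
    obtain ⟨b, hb, b', hb', h⟩ := one_lt_card.1 (show 1 < #(nbhd G (S ∩ A) \ S) by omega)
    exact ⟨b, b', hb, hb', h⟩
  simp only [mem_sdiff, mem_nbhd] at hb hb'
  obtain ⟨⟨a, ha, hab⟩, hbS⟩ := hb
  obtain ⟨⟨a', ha', hab'⟩, hbS'⟩ := hb'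
  -- Two disjoint edges leaving `S` from `A` extend to a perfect matching, which by balance leaves
  -- `S` twice from `B` as well: four crossings.
  have key : ∀ {x x' y y' : V}, x ∈ S ∩ A → x' ∈ S ∩ A → x ≠ x' → y ≠ y' → y ∉ S → y' ∉ S →
      G.Adj x y → G.Adj x' y' → False := by
    intro x x' y y' hx hx' hxx hyy hy hy' h h'
    obtain ⟨f, hf, rfl, rfl⟩ := hG.exists_isMate_of_adj_adj hAB (mem_inter.1 hx).2
      (mem_inter.1 hx').2 hxx hyy h h'
    have h1 : 2 ≤ #((S ∩ A).filter (f · ∉ S)) := by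
      rw [← card_pair hxx]
      refine card_le_card fun v hv => ?_
      simp only [mem_insert, mem_singleton] at hv
      rcases hv with rfl | rfl <;> rw [mem_filter] <;> exact ⟨by assumption, by assumption⟩
    have h2 := hAB.card_inter_add_crossing hf S
    have h3 := hAB.crossing_eq f S
    have h4 := hS f hf
    omega
  -- If both outer neighbours hang on the same vertex `a`, another vertex `x` of `S ∩ A` has an
  -- outer neighbour `y`, and one of `b`, `b'` differs from `y`.
  by_cases haa : a = a'
  · subst haa
    have h1 := hout ((S ∩ A).erase a) (erase_subset _ _)
      (by rw [← card_pos, card_erase_of_mem ha]; omega) (by rw [card_erase_of_mem ha]; omega)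
    rw [card_erase_of_mem ha] at h1
    obtain ⟨y, hy⟩ := card_pos.1 (show 0 < #(nbhd G ((S ∩ A).erase a) \ S) by omega)
    rw [mem_sdiff, mem_nbhd] at hy
    obtain ⟨⟨x, hx, hxy⟩, hyS⟩ := hy
    rw [mem_erase] at hx
    by_cases hyb : y = b
    · exact key hx.2 ha hx.1 (by rwa [hyb]) hyS hbS' hxy hab'
    · exact key hx.2 ha hx.1 hyb hyS hbS hxy hab
  · exact key ha ha' haa hbb hbS hbS' hab hab'

/-- A cut of porosity at most two with a surplus of `B` on one shore. -/
theorem IsBrace.closed_of_card_lt (hG : IsBrace G) (hAB : HasColourClasses G A B) {S : Finset V}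
    (hS : ∀ f, IsMate G f → crossing f S ≤ 2) (hc : #(S ∩ A) + 2 ≤ #(S ∩ B)) :
    #(S ∩ B) = #(S ∩ A) + 2 ∧ nbhd G (S ∩ A) ⊆ S ∩ B := by
  -- The partners leaving from `B` exceed those leaving from `A` by the surplus, at least two, and
  -- there are at most two crossings altogether. So none leaves from `A`; as each edge lies in a
  -- perfect matching, no edge at all does.
  have key : ∀ f, IsMate G f → #((S ∩ A).filter (f · ∉ S)) = 0 ∧ #(S ∩ B) = #(S ∩ A) + 2 := by
    intro f hf
    have h2 := hAB.card_inter_add_crossing hf S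
    have h3 := hAB.crossing_eq f S
    have h4 := hS f hf
    omega
  constructor
  · obtain ⟨f, hf⟩ := hG.exists_isMate
    exact (key f hf).2
  · intro w hw
    obtain ⟨v, hv, hvw⟩ := mem_nbhd.1 hw
    obtain ⟨f, hf, rfl⟩ := hG.exists_isMate_of_adj hvw
    have := (key f hf).1
    rw [card_eq_zero, filter_eq_empty_iff] at this
    exact mem_inter.2 ⟨not_not.1 (this hv), hAB.mem_right_of_adj hvw (mem_inter.1 hv).2⟩

/-- Crossing numbers have the parity of |S|, so here they are 0 or 2, and the imbalance is the
difference of two numbers with that sum. -/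
theorem IsBrace.balance_of_even (hG : IsBrace G) (hAB : HasColourClasses G A B) {S : Finset V}
    (hS : ∀ f, IsMate G f → crossing f S ≤ 2) (he : Even #S) :
    #(S ∩ A) = #(S ∩ B) ∨ #(S ∩ A) = #(S ∩ B) + 2 ∨ #(S ∩ B) = #(S ∩ A) + 2 := by
  obtain ⟨f, hf⟩ := hG.exists_isMate
  have h1 := hAB.card_inter_add S
  have h2 := hAB.card_inter_add_crossing hf S
  have h3 := hAB.crossing_eq f S
  have h4 := hS f hf
  obtain ⟨k, hk⟩ := he
  omega

/-- An odd crossing number that is at most two equals one, so the cut is tight. -/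
theorem IsBrace.trivial_of_odd (hG : IsBrace G) (hAB : HasColourClasses G A B) {S : Finset V}
    (hS : ∀ f, IsMate G f → crossing f S ≤ 2) (he : Odd #S) : #S = 1 ∨ #Sᶜ = 1 := by
  refine hG.trivial_of_tight fun f hf => ?_
  have h1 := hAB.card_inter_add S
  have h2 := hAB.card_inter_add_crossing hf S
  have h3 := hAB.crossing_eq f S
  have h4 := hS f hf
  obtain ⟨k, hk⟩ := he
  omega

end Braces

/-! ### The two sides of an edge of a tree -/

section TreeSides

variable {W : Type*} {T : SimpleGraph W}

/-- The vertices of the component of `T - tt'` that contains `t`. -/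
def treeSide (T : SimpleGraph W) (t t' : W) : Set W :=
  {x | (T.deleteEdges {s(t, t')}).Reachable t x}

theorem self_mem_treeSide (t t' : W) : t ∈ treeSide T t t' := SimpleGraph.Reachable.refl _

theorem mem_treeSide_of_adj {t t' y z : W} (hy : y ∈ treeSide T t t') (h : T.Adj y z)
    (hne : s(y, z) ≠ s(t, t')) : z ∈ treeSide T t t' :=
  SimpleGraph.Reachable.trans (u := t) (v := y) hy
    (SimpleGraph.Adj.reachable (by simpa [SimpleGraph.deleteEdges_adj] using ⟨h, by simpa using hne⟩))

theorem treeSide_induction {t t' : W} {P : W → Prop} (h0 : P t)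
    (hs : ∀ y z, y ∈ treeSide T t t' → P y → T.Adj y z → s(y, z) ≠ s(t, t') → P z) {x : W}
    (hx : x ∈ treeSide T t t') : P x := by
  have hx' := (SimpleGraph.reachable_iff_reflTransGen t x).1 hx
  have : x ∈ treeSide T t t' ∧ P x := by
    clear hx
    induction hx' with
    | refl => exact ⟨self_mem_treeSide _ _, h0⟩
    | tail _ hyz ih =>
      rw [SimpleGraph.deleteEdges_adj] at hyz
      have hne := hyz.2
      rw [Set.mem_singleton_iff] at hne
      exact ⟨mem_treeSide_of_adj ih.1 hyz.1 hne, hs _ _ ih.1 ih.2 hyz.1 hne⟩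
  exact this.2

theorem SimpleGraph.IsTree.not_mem_treeSide (hT : T.IsTree) {t t' : W} (h : T.Adj t t') :
    t' ∉ treeSide T t t' := by
  have := SimpleGraph.isAcyclic_iff_forall_adj_isBridge.1 hT.isAcyclic h
  rw [SimpleGraph.isBridge_iff] at this
  intro hmem
  exact this hmem

theorem SimpleGraph.IsTree.treeSide_swap (hT : T.IsTree) {t t' : W} (h : T.Adj t t') :
    treeSide T t' t = (treeSide T t t')ᶜ := by
  ext x
  constructor
  · intro hx
    refine treeSide_induction (P := (· ∈ (treeSide T t t')ᶜ)) ?_ ?_ hx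
    · exact hT.not_mem_treeSide h
    · intro y z _ ih hyz hne
      exact fun hz => ih (mem_treeSide_of_adj hz hyz.symm (by rwa [Sym2.eq_swap, Sym2.eq_swap (a := t)]))
  · have hall : ∀ x, x ∈ treeSide T t t' ∨ x ∈ treeSide T t' t := by
      intro x
      have := (SimpleGraph.reachable_iff_reflTransGen t x).1 (hT.connected.preconnected t x)
      induction this with
      | refl => exact Or.inl (self_mem_treeSide _ _)
      | @tail y z _ hyz ih =>
        by_cases he : s(y, z) = s(t, t')
        · rcases Sym2.eq_iff.1 he with ⟨-, rfl⟩ | ⟨-, rfl⟩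
          · exact Or.inr (self_mem_treeSide _ _)
          · exact Or.inl (self_mem_treeSide _ _)
        · rcases ih with ih | ih
          · exact Or.inl (mem_treeSide_of_adj ih hyz he)
          · exact Or.inr (mem_treeSide_of_adj ih hyz (by rwa [Sym2.eq_swap (a := t')]))
    exact fun hx => (hall x).resolve_left hx

/-- Inside the branch of `u` no edge is `tt'`, because this edge contains `t`, which is not in the
branch. -/
theorem SimpleGraph.IsTree.treeSide_subset (hT : T.IsTree) {t t' u : W} (hu : T.Adj t u)
    (hne : u ≠ t') : treeSide T u t ⊆ treeSide T t t' := by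
  intro x hx
  refine treeSide_induction (P := (· ∈ treeSide T t t')) ?_ ?_ hx
  · refine mem_treeSide_of_adj (self_mem_treeSide _ _) hu fun h => ?_
    rcases Sym2.eq_iff.1 h with ⟨-, h⟩ | ⟨-, h⟩
    · exact hne h
    · exact hu.ne h.symm
  · intro y z hy ih hyz he
    refine mem_treeSide_of_adj ih hyz fun h => ?_
    have hz := mem_treeSide_of_adj hy hyz he
    have ht := hT.not_mem_treeSide hu.symm
    rcases Sym2.eq_iff.1 h with ⟨rfl, -⟩ | ⟨-, rfl⟩ <;> contradiction

theorem SimpleGraph.IsTree.treeSide_eq (hT : T.IsTree) {t t' : W} :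
    treeSide T t t' = {t} ∪ ⋃ u ∈ T.neighborSet t \ {t'}, treeSide T u t := by
  apply subset_antisymm
  · intro x hx
    simp only [Set.singleton_union, Set.mem_insert_iff, Set.mem_iUnion, exists_prop]
    refine treeSide_induction (P := fun x =>
      x = t ∨ ∃ u, u ∈ T.neighborSet t \ {t'} ∧ x ∈ treeSide T u t) (Or.inl rfl) ?_ hx
    · intro y z _ ih hyz he
      by_cases hz : z = t
      · exact Or.inl hz
      rcases ih with rfl | ⟨u, hu, hy⟩
      · exact Or.inr ⟨z, ⟨hyz, fun h => he (by rw [Set.mem_singleton_iff.1 h])⟩,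
          self_mem_treeSide _ _⟩
      · have hyt : y ≠ t := by
          rintro rfl; exact hT.not_mem_treeSide (SimpleGraph.Adj.symm hu.1) hy
        refine Or.inr ⟨u, hu, mem_treeSide_of_adj hy hyz fun h => ?_⟩
        rcases Sym2.eq_iff.1 h with ⟨-, h⟩ | ⟨h, -⟩ <;> contradiction
  · refine Set.union_subset (Set.singleton_subset_iff.2 (self_mem_treeSide _ _)) ?_
    refine Set.iUnion₂_subset fun u hu => hT.treeSide_subset hu.1 hu.2

theorem SimpleGraph.IsTree.disjoint_treeSide (hT : T.IsTree) {t u u' : W} (hu : T.Adj t u)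
    (hu' : T.Adj t u') (hne : u ≠ u') : Disjoint (treeSide T u t) (treeSide T u' t) := by
  have h := hT.treeSide_subset hu hne
  rw [Set.disjoint_left]
  intro x hx
  have := h hx
  rw [hT.treeSide_swap hu'.symm] at this
  exact this

end TreeSides

/-! ### Shores of a decomposition and induction along the tree -/

namespace PMDecomposition

variable {V W : Type*}

theorem shore_eq_preimage (D : PMDecomposition V W) (t₁ t₂ : W) :
    D.shore t₁ t₂ = {x | (D.δ.symm x : W) ∈ treeSide D.tree t₁ t₂} := rfl

theorem shore_swap (D : PMDecomposition V W) {t₁ t₂ : W} (h : D.tree.Adj t₁ t₂) :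
    D.shore t₂ t₁ = (D.shore t₁ t₂)ᶜ := by
  rw [shore_eq_preimage, shore_eq_preimage, D.isTree.treeSide_swap h]
  rfl

theorem shore_of_isLeaf (D : PMDecomposition V W) {t₁ t₂ : W} (h : D.tree.Adj t₁ t₂)
    (hl : IsLeaf D.tree t₁) : D.shore t₁ t₂ = {D.δ ⟨t₁, hl⟩} := by
  obtain ⟨u, hu⟩ := Set.ncard_eq_one.1 hl
  have h2 : t₂ ∈ D.tree.neighborSet t₁ := h
  rw [hu, Set.mem_singleton_iff] at h2
  have : treeSide D.tree t₁ t₂ = {t₁} := by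
    rw [D.isTree.treeSide_eq, hu, h2]
    simp
  rw [shore_eq_preimage, this]
  ext x
  rw [Set.mem_ofPred_eq, Set.mem_singleton_iff, Set.mem_singleton_iff, ← Equiv.symm_apply_eq]
  exact ⟨fun h => Subtype.ext h, fun h => congrArg Subtype.val h⟩

theorem exists_branches (D : PMDecomposition V W) {t₁ t₂ : W} (h : D.tree.Adj t₁ t₂)
    (hl : ¬ IsLeaf D.tree t₁) : ∃ u w, D.tree.Adj u t₁ ∧ D.tree.Adj w t₁ ∧ u ≠ w ∧
      treeSide D.tree t₁ t₂ = {t₁} ∪ (treeSide D.tree u t₁ ∪ treeSide D.tree w t₁) := by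
  have h3 := (D.cubic t₁).resolve_left hl
  have hfin : (D.tree.neighborSet t₁).Finite := Set.finite_of_ncard_ne_zero (by omega)
  have h2 : (D.tree.neighborSet t₁ \ {t₂}).ncard = 2 := by
    rw [Set.ncard_sdiff_singleton_of_mem (show t₂ ∈ D.tree.neighborSet t₁ from h), h3]
  obtain ⟨u, w, huw, he⟩ := Set.ncard_eq_two.1 h2
  have hu : u ∈ D.tree.neighborSet t₁ \ {t₂} := by rw [he]; simp
  have hw : w ∈ D.tree.neighborSet t₁ \ {t₂} := by rw [he]; simp
  refine ⟨u, w, SimpleGraph.Adj.symm hu.1, SimpleGraph.Adj.symm hw.1, huw, ?_⟩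
  rw [D.isTree.treeSide_eq, he]
  simp

/-- The branches at an inner node. -/
theorem shore_split (D : PMDecomposition V W) {t₁ t₂ u w : W} (hu : D.tree.Adj u t₁)
    (hw : D.tree.Adj w t₁) (huw : u ≠ w) (hl : ¬ IsLeaf D.tree t₁)
    (he : treeSide D.tree t₁ t₂ = {t₁} ∪ (treeSide D.tree u t₁ ∪ treeSide D.tree w t₁)) :
    D.shore t₁ t₂ = D.shore u t₁ ∪ D.shore w t₁ ∧ Disjoint (D.shore u t₁) (D.shore w t₁) := by
  simp only [shore_eq_preimage, he]
  constructor
  · ext x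
    have : (D.δ.symm x : W) ≠ t₁ := fun h => hl (h ▸ (D.δ.symm x).2)
    simp [this]
  · exact (D.isTree.disjoint_treeSide hu.symm hw.symm huw).preimage _

/-- The induction is on the size of the tree side: at an inner node the two further branches omit
the node itself, so both are smaller. -/
theorem shore_induction [Finite W] (D : PMDecomposition V W) {P : W → W → Prop}
    (leaf : ∀ t₁ t₂ (h : IsLeaf D.tree t₁), D.tree.Adj t₁ t₂ →
      D.shore t₁ t₂ = {D.δ ⟨t₁, h⟩} → P t₁ t₂)
    (split : ∀ t₁ t₂ u w, D.tree.Adj t₁ t₂ → D.tree.Adj u t₁ → D.tree.Adj w t₁ →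
      D.shore t₁ t₂ = D.shore u t₁ ∪ D.shore w t₁ → Disjoint (D.shore u t₁) (D.shore w t₁) →
      P u t₁ → P w t₁ → P t₁ t₂) {t₁ t₂ : W} (h : D.tree.Adj t₁ t₂) : P t₁ t₂ := by
  induction hn : (treeSide D.tree t₁ t₂).ncard using Nat.strong_induction_on generalizing t₁ t₂ with
  | _ n ih =>
  by_cases hl : IsLeaf D.tree t₁
  · exact leaf t₁ t₂ hl h (D.shore_of_isLeaf h hl)
  · obtain ⟨u, w, hu, hw, huw, he⟩ := D.exists_branches h hl
    obtain ⟨h1, h2⟩ := D.shore_split hu hw huw hl he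
    have hlt : ∀ x, D.tree.Adj x t₁ → treeSide D.tree x t₁ ⊆ treeSide D.tree t₁ t₂ →
        (treeSide D.tree x t₁).ncard < n := by
      intro x hx hsub
      rw [← hn]
      refine Set.ncard_lt_ncard (Set.ssubset_iff_subset_ne.2 ⟨hsub, fun hh => ?_⟩) (Set.toFinite _)
      exact D.isTree.not_mem_treeSide hx (hh ▸ self_mem_treeSide _ _)
    refine split t₁ t₂ u w h hu hw h1 h2 (ih _ (hlt u hu ?_) hu rfl) (ih _ (hlt w hw ?_) hw rfl)
    · rw [he]; intro x hx; exact Or.inr (Or.inl hx)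
    · rw [he]; intro x hx; exact Or.inr (Or.inr hx)

variable [Fintype V] [DecidableEq V]

/-- `S` is a shore of the tree edge `t₁t₂`, as a finite set. -/
def IsShore (D : PMDecomposition V W) (t₁ t₂ : W) (S : Finset V) : Prop :=
  D.tree.Adj t₁ t₂ ∧ D.shore t₁ t₂ = (S : Set V)

theorem exists_isShore (D : PMDecomposition V W) {t₁ t₂ : W} (h : D.tree.Adj t₁ t₂) :
    ∃ S, D.IsShore t₁ t₂ S :=
  ⟨(Set.toFinite (D.shore t₁ t₂)).toFinset, h, by simp⟩

theorem IsShore.compl {D : PMDecomposition V W} {t₁ t₂ : W} {S : Finset V}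
    (h : D.IsShore t₁ t₂ S) : D.IsShore t₂ t₁ Sᶜ :=
  ⟨h.1.symm, by rw [D.shore_swap h.1, h.2, coe_compl]⟩

theorem isShore_induction [Finite W] {D : PMDecomposition V W} {P : Finset V → Prop}
    (leaf : ∀ x, P {x})
    (split : ∀ t₁ t₂ t t' S X Y, D.IsShore t₁ t₂ S → D.IsShore t t₁ X → D.IsShore t' t₁ Y →
      S = X ∪ Y → Disjoint X Y → P X → P Y → P S) {t₁ t₂ : W} {S : Finset V}
    (h : D.IsShore t₁ t₂ S) : P S := by
  have : ∀ S, D.IsShore t₁ t₂ S → P S := by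
    refine D.shore_induction (P := fun t₁ t₂ => ∀ S, D.IsShore t₁ t₂ S → P S) ?_ ?_ h.1
    · intro t₁ t₂ hl _ he S hS
      have : S = {D.δ ⟨t₁, hl⟩} := by
        rw [← coe_inj, ← hS.2, he, coe_singleton]
      rw [this]
      exact leaf _
    · intro t₁ t₂ u w _ hu hw he hd ihu ihw S hS
      obtain ⟨X, hX⟩ := D.exists_isShore hu
      obtain ⟨Y, hY⟩ := D.exists_isShore hw
      rw [hX.2, hY.2] at he hd
      rw [hS.2, ← coe_union, coe_inj] at he
      exact split _ _ _ _ _ X Y hS hX hY he (by exact_mod_cast hd) (ihu X hX) (ihw Y hY)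
  exact this S h

theorem IsShore.nonempty [Finite W] {D : PMDecomposition V W} {t₁ t₂ : W} {S : Finset V}
    (h : D.IsShore t₁ t₂ S) : S.Nonempty := by
  refine isShore_induction (P := Finset.Nonempty) (fun x => ⟨x, by simp⟩) ?_ h
  rintro _ _ _ _ S X Y - - - rfl - hX -
  exact hX.mono subset_union_left

theorem IsShore.split [Finite W] {D : PMDecomposition V W} {t₁ t₂ : W} {S : Finset V}
    (h : D.IsShore t₁ t₂ S) (h1 : #S ≠ 1) : ∃ t t' X Y, D.IsShore t t₁ X ∧ D.IsShore t' t₁ Y ∧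
      S = X ∪ Y ∧ Disjoint X Y := by
  have hl : ¬ IsLeaf D.tree t₁ := by
    intro hl
    have := D.shore_of_isLeaf h.1 hl
    rw [h.2] at this
    have : S = {D.δ ⟨t₁, hl⟩} := by exact_mod_cast this
    exact h1 (by rw [this, card_singleton])
  obtain ⟨u, w, hu, hw, huw, he⟩ := D.exists_branches h.1 hl
  obtain ⟨h2, h3⟩ := D.shore_split hu hw huw hl he
  obtain ⟨X, hX⟩ := D.exists_isShore hu
  obtain ⟨Y, hY⟩ := D.exists_isShore hw
  rw [hX.2, hY.2] at h2 h3
  rw [h.2] at h2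
  exact ⟨u, w, X, Y, hX, hY, by exact_mod_cast h2, by exact_mod_cast h3⟩

/-- The complement of a leaf is a shore. -/
theorem exists_isShore_compl_singleton (D : PMDecomposition V W) (x : V) :
    ∃ t₁ t₂, D.IsShore t₁ t₂ {x}ᶜ := by
  obtain ⟨u, hu⟩ := Set.ncard_eq_one.1 (D.δ.symm x).2
  have hadj : D.tree.Adj (D.δ.symm x) u := by
    rw [← SimpleGraph.mem_neighborSet, hu]; rfl
  refine ⟨u, D.δ.symm x, IsShore.compl ⟨hadj, ?_⟩⟩
  rw [D.shore_of_isLeaf hadj (D.δ.symm x).2, Subtype.coe_eta, Equiv.apply_symm_apply, coe_singleton]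

variable {G : SimpleGraph V}

theorem matPor_le_width [Finite W] (D : PMDecomposition V W) {t₁ t₂ : W}
    (h : D.tree.Adj t₁ t₂) : matPor G (D.shore t₁ t₂) ≤ D.width G := by
  refine le_csSup ?_ ⟨t₁, t₂, h, rfl⟩
  refine (Set.Finite.subset (Set.finite_range fun p : W × W => matPor G (D.shore p.1 p.2))
    ?_).bddAbove
  rintro _ ⟨t₁, t₂, -, rfl⟩
  exact ⟨(t₁, t₂), rfl⟩

theorem IsShore.crossing_le [Finite W] {D : PMDecomposition V W} {t₁ t₂ : W} {S : Finset V}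
    (h : D.IsShore t₁ t₂ S) {f : V → V} (hf : IsMate G f) : crossing f S ≤ D.width G := by
  have := D.matPor_le_width (G := G) h.1
  rw [h.2] at this
  exact (crossing_le_matPor S hf).trans this

theorem width_le (D : PMDecomposition V W) {k : ℕ}
    (h : ∀ t₁ t₂ S, D.IsShore t₁ t₂ S → ∀ f, IsMate G f → crossing f S ≤ k) :
    D.width G ≤ k := by
  refine csSup_le' ?_
  rintro _ ⟨t₁, t₂, ht, rfl⟩
  obtain ⟨S, hS⟩ := D.exists_isShore ht
  rw [hS.2]
  exact matPor_le (h _ _ S hS)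

end PMDecomposition

/-! ### From a decomposition of width two to an elimination ordering -/

section Width

variable {V W : Type*} [Fintype V] [DecidableEq V] {G : SimpleGraph V} {A B : Finset V}

open PMDecomposition

/-- With porosity at most one an even shore would never be crossed, against connectedness, so all
shores are odd. But the complement of a leaf has odd size and is the disjoint union of two shores.
-/
theorem IsBrace.two_le_width [Finite W] (hG : IsBrace G) (hAB : HasColourClasses G A B)
    (h4 : 4 ≤ Fintype.card V) (D : PMDecomposition V W) : 2 ≤ D.width G := by
  by_contra! hw
  have hcard := hAB.card_add
  rw [← hG.card_eq hAB] at hcard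
  obtain ⟨x⟩ : Nonempty V := Fintype.card_pos_iff.1 (by omega)
  obtain ⟨t₁, t₂, h⟩ := D.exists_isShore_compl_singleton x
  have h1 : #({x}ᶜ : Finset V) + 1 = Fintype.card V := by
    rw [card_compl, card_singleton]; omega
  obtain ⟨t, t', X, Y, hX, hY, he, hd⟩ := h.split (by omega)
  rw [he, card_union_of_disjoint hd] at h1
  have key : ∀ {u u' Z}, D.IsShore u u' Z → Odd #Z := by
    intro u u' Z hZ
    by_contra hev
    obtain ⟨k, hk⟩ := Nat.not_odd_iff_even.1 hev
    obtain ⟨f, hf, hpos⟩ := hG.exists_crossing_pos hZ.nonempty fun hh => by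
      have := hZ.compl.nonempty
      simp [hh] at this
    have h1 := hAB.card_inter_add Z
    have h2 := hAB.card_inter_add_crossing hf Z
    have h3 := hAB.crossing_eq f Z
    have h4 := hZ.crossing_le hf
    omega
  obtain ⟨k, hk⟩ := key hX
  obtain ⟨l, hl⟩ := key hY
  omega

theorem IsBrace.pmw_eq_two (hG : IsBrace G) (hAB : HasColourClasses G A B)
    (h4 : 4 ≤ Fintype.card V) {m : ℕ} (D : PMDecomposition V (Fin m)) (hD : D.width G ≤ 2) :
    pmw G = 2 := by
  have h2 : D.width G = 2 := le_antisymm hD (hG.two_le_width hAB h4 D)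
  refine le_antisymm (Nat.sInf_le ⟨m, D, h2⟩) (le_csInf ⟨2, m, D, h2⟩ ?_)
  rintro _ ⟨m, D, rfl⟩
  exact hG.two_le_width hAB h4 D

theorem pmw_ne_two_of_card_le_three (hV : Fintype.card V ≤ 3) : pmw G ≠ 2 := by
  intro h
  -- The infimum of the empty set of natural numbers is 0, so the value 2 is attained by some
  -- decomposition.
  have hne : {k | ∃ (m : ℕ) (D : PMDecomposition V (Fin m)), D.width G = k}.Nonempty := by
    by_contra hne
    rw [Set.not_nonempty_iff_eq_empty] at hne
    rw [pmw, hne, Nat.sInf_empty] at h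
    omega
  obtain ⟨m, D, hD⟩ := Nat.sInf_mem hne
  rw [← pmw, h] at hD
  have : D.width G ≤ 1 := by
    refine D.width_le fun t₁ t₂ S hS f hf => ?_
    have h1 := crossing_le_card f S
    have h2 := crossing_le_card f Sᶜ
    rw [crossing_compl hf] at h2
    have h3 := card_add_card_compl S
    omega
  omega

theorem exists_width_eq_two (h : pmw G = 2) :
    ∃ (m : ℕ) (D : PMDecomposition V (Fin m)), D.width G = 2 := by
  have hne : {k | ∃ (m : ℕ) (D : PMDecomposition V (Fin m)), D.width G = k}.Nonempty := by
    by_contra hne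
    rw [Set.not_nonempty_iff_eq_empty] at hne
    rw [pmw, hne, Nat.sInf_empty] at h
    omega
  obtain ⟨m, D, hD⟩ := Nat.sInf_mem hne
  exact ⟨m, D, by rw [hD, ← pmw, h]⟩

variable [DecidableRel G.Adj]

/-- `P` is obtained from the single vertex `a` of degree three by adding vertices of `A` one by one,
each of them with at most one new neighbour. -/
inductive Elim (G : SimpleGraph V) [DecidableRel G.Adj] (A : Finset V) (a : V) : Finset V → Prop
  | single : a ∈ A → #(G.neighborFinset a) = 3 → Elim G A a {a}
  | insert {P : Finset V} {a' : V} : Elim G A a P → a' ∈ A → a' ∉ P →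
      #(G.neighborFinset a' \ nbhd G P) ≤ 1 → Elim G A a (insert a' P)

theorem Elim.nonempty {a : V} {P : Finset V} (h : Elim G A a P) : P.Nonempty := by
  induction h with
  | single ha => exact singleton_nonempty _
  | insert _ ha _ _ ih => exact insert_nonempty _ _

/-- Once all neighbours of vertices of `A` are discovered, the remaining vertices of `A` have no new
neighbours and can be added in any order. -/
theorem Elim.union_of_full {a : V} {P Q : Finset V} (h : Elim G A a P)
    (hP : ∀ v ∈ A, G.neighborFinset v ⊆ nbhd G P) (hQ : Q ⊆ A) : Elim G A a (Q ∪ P) := by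
  induction Q using Finset.induction_on with
  | empty => simpa using h
  | insert x Q hx ih =>
    have ih' := ih ((subset_insert _ _).trans hQ)
    rw [insert_union]
    by_cases hmem : x ∈ Q ∪ P
    · rwa [insert_eq_self.2 hmem]
    · refine ih'.insert (hQ (mem_insert_self _ _)) hmem ?_
      rw [sdiff_eq_empty_iff_subset.2 ((hP x (hQ (mem_insert_self _ _))).trans
        (nbhd_mono subset_union_right))]
      simp

/-- Expansion gives each vertex of `A` at least three neighbours, hence all of `B`, so any first
vertex works. This case is separate because there is no room for a nontrivial shore with a surplus.
-/
theorem IsBrace.exists_elim_of_card_eq_three (hG : IsBrace G) (hAB : HasColourClasses G A B)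
    (h3 : #A = 3) : ∃ a, Elim G A a A := by
  have hN : ∀ a ∈ A, G.neighborFinset a = B := by
    intro a ha
    have h1 := hG.card_add_two_le_card_nbhd hAB (singleton_subset_iff.2 ha) (singleton_nonempty a)
      (by rw [card_singleton, h3])
    rw [card_singleton, nbhd_singleton] at h1
    refine eq_of_subset_of_card_le ?_ (by rw [← hG.card_eq hAB, h3]; exact h1)
    rw [← nbhd_singleton]
    exact hAB.nbhd_subset (singleton_subset_iff.2 ha)
  obtain ⟨a, ha⟩ := card_pos.1 (show 0 < #A by omega)
  refine ⟨a, ?_⟩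
  have hE : Elim G A a {a} := .single ha (by rw [hN a ha, ← hG.card_eq hAB, h3])
  have := hE.union_of_full (fun v hv => by rw [nbhd_singleton, hN v hv, hN a ha]) subset_rfl
  rwa [union_eq_left.2 (singleton_subset_iff.2 ha)] at this

/-- In a decomposition of width two, the two branches at an inner node whose union has a surplus of
two vertices of `B` are a pair of adjacent colours and a smaller such branch. -/
theorem IsBrace.branch_cases [Finite W] (hG : IsBrace G) (hAB : HasColourClasses G A B)
    {D : PMDecomposition V W} (hD : D.width G ≤ 2) {t₁ t₂ t t' : W} {X Y : Finset V}
    (hS : D.IsShore t₁ t₂ (X ∪ Y)) (hX : D.IsShore t t₁ X) (hY : D.IsShore t' t₁ Y)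
    (hd : Disjoint X Y) (hs : #((X ∪ Y) ∩ B) = #((X ∪ Y) ∩ A) + 2) (h2 : #(X ∪ Y) ≠ 2) :
    (#(X ∩ A) = 1 ∧ #(X ∩ B) = 1 ∧ #(Y ∩ B) = #(Y ∩ A) + 2) ∨
    (#(Y ∩ A) = 1 ∧ #(Y ∩ B) = 1 ∧ #(X ∩ B) = #(X ∩ A) + 2) := by
  have hcr : ∀ {u u' Z}, D.IsShore u u' Z → ∀ f, IsMate G f → crossing f Z ≤ 2 :=
    fun hZ f hf => (hZ.crossing_le hf).trans hD
  have hU : ∀ C : Finset V, #((X ∪ Y) ∩ C) = #(X ∩ C) + #(Y ∩ C) := by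
    intro C
    rw [union_inter_distrib_right, card_union_of_disjoint]
    exact hd.mono inter_subset_left inter_subset_left
  have hcard : #(X ∪ Y) = #X + #Y := card_union_of_disjoint hd
  have hX0 := hX.nonempty.card_pos
  have hY0 := hY.nonempty.card_pos
  have hS0 := hS.compl.nonempty.card_pos
  have hXA := hAB.card_inter_add X
  have hYA := hAB.card_inter_add Y
  have hA := hU A
  have hB := hU B
  have hle1 : #((X ∪ Y) ∩ B) ≤ #B := card_le_card inter_subset_right
  rw [← hG.card_eq hAB] at hle1
  have hpar : #X + #Y = 2 * (#((X ∪ Y) ∩ A) + 1) := by omega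
  by_cases hev : Even #X
  · have hevY : Even #Y := (Nat.even_add.1 (hpar ▸ even_two_mul _)).1 hev
    have h3 := hG.balance_of_even hAB (hcr hX) hev
    have h4 := hG.balance_of_even hAB (hcr hY) hevY
    -- Two imbalances from {-2, 0, 2} with sum 2 are 0 and 2 in some order. The balanced branch is
    -- then a pair: otherwise it would contain at least n - 1 vertices of each colour, too many
    -- beside the two or more vertices of `B` in the other branch.
    have key : ∀ x y x' y' : ℕ, x + x' + 2 = y + y' → (x = y ∨ x = y + 2 ∨ y = x + 2) →
        (x' = y' ∨ x' = y' + 2 ∨ y' = x' + 2) → x = y ∧ y' = x' + 2 ∨ x' = y' ∧ y = x + 2 := by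
      omega
    rcases key _ _ _ _ (by rw [← hA, ← hs, hB]) h3 h4 with ⟨h5, h6⟩ | ⟨h5, h6⟩
    · have := hG.card_of_balanced hAB (hcr hX) h5
      have h7 : #(X ∩ A) = 1 := by
        by_contra h7
        have := this (by omega)
        omega
      exact Or.inl ⟨h7, h5 ▸ h7, h6⟩
    · have := hG.card_of_balanced hAB (hcr hY) h5
      have h7 : #(Y ∩ A) = 1 := by
        by_contra h7
        have := this (by omega)
        omega
      exact Or.inr ⟨h7, h5 ▸ h7, h6⟩
  -- Two odd branches would have trivial cuts. Neither complement is a single vertex, as it contains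
  -- the other branch and the complement of the union; so both branches are single vertices, and the
  -- union has two elements.
  · have hoddY : Odd #Y := by
      rw [← Nat.not_even_iff_odd]
      exact fun h => hev ((Nat.even_add.1 (hpar ▸ even_two_mul _)).2 h)
    rw [Nat.not_even_iff_odd] at hev
    have h3 := hG.trivial_of_odd hAB (hcr hX) hev
    have h4 := hG.trivial_of_odd hAB (hcr hY) hoddY
    have hcX := card_add_card_compl X
    have hcY := card_add_card_compl Y
    have hcS := card_add_card_compl (X ∪ Y)
    clear hA hB hs hle1 hpar hXA hYA hU
    omega

/-- The induction follows the branches that carry the surplus. Each node contributes one vertex of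
`A` and one of `B`, and the neighbours of the new vertex of `A` stay inside the shore. The first
such vertex therefore sees at most three vertices of `B`, and expansion makes it exactly three. -/
theorem IsBrace.elim_of_isShore [Finite W] (hG : IsBrace G) (hAB : HasColourClasses G A B)
    {D : PMDecomposition V W} (hD : D.width G ≤ 2) {t₁ t₂ : W} {S : Finset V}
    (h : D.IsShore t₁ t₂ S) (hS : #(S ∩ B) = #(S ∩ A) + 2) (hA : #(S ∩ A) + 2 ≤ #A) :
    S ∩ A = ∅ ∨ ∃ a, Elim G A a (S ∩ A) := by
  revert hS hA
  refine PMDecomposition.isShore_induction (P := fun S => #(S ∩ B) = #(S ∩ A) + 2 →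
    #(S ∩ A) + 2 ≤ #A → S ∩ A = ∅ ∨ ∃ a, Elim G A a (S ∩ A)) ?_ ?_ h
  · intro x hx
    have := card_le_card (inter_subset_left (s₁ := {x}) (s₂ := B))
    rw [card_singleton] at this
    omega
  · rintro t₁ t₂ t t' S X Y hS hX hY rfl hd ihX ihY hs hA
    have hcl := hG.closed_of_card_lt hAB (fun f hf => (hS.crossing_le hf).trans hD) hs.ge
    by_cases h2 : #(X ∪ Y) = 2
    · left
      have := hAB.card_inter_add (X ∪ Y)
      exact card_eq_zero.1 (by omega)
    have step : ∀ X Y : Finset V, #(X ∩ A) = 1 → #(X ∩ B) = 1 → #(Y ∩ B) = #(Y ∩ A) + 2 →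
        Disjoint X Y → (∀ f, IsMate G f → crossing f Y ≤ 2) → #((X ∪ Y) ∩ A) + 2 ≤ #A →
        nbhd G ((X ∪ Y) ∩ A) ⊆ (X ∪ Y) ∩ B →
        (Y ∩ A = ∅ ∨ ∃ a, Elim G A a (Y ∩ A)) → ∃ a, Elim G A a ((X ∪ Y) ∩ A) := by
      intro X Y h1 h1' h3 hd hcr hA hcl ih
      obtain ⟨a, ha⟩ := card_eq_one.1 h1
      have hdA : Disjoint (X ∩ A) (Y ∩ A) := hd.mono inter_subset_left inter_subset_left
      have hU : (X ∪ Y) ∩ A = insert a (Y ∩ A) := by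
        rw [union_inter_distrib_right, ha, singleton_union]
      have haA : a ∈ A := (mem_inter.1 (ha ▸ mem_singleton_self a : a ∈ X ∩ A)).2
      have haY : a ∉ Y ∩ A := by
        rw [ha] at hdA
        exact disjoint_singleton_left.1 hdA
      have hNa : G.neighborFinset a ⊆ (X ∪ Y) ∩ B := by
        rw [hU, nbhd_insert] at hcl
        exact subset_union_left.trans hcl
      rw [hU, card_insert_of_notMem haY] at hA
      rcases ih with h0 | ⟨a₀, ih⟩
      · refine ⟨a, ?_⟩
        rw [hU, h0]
        refine .single haA (le_antisymm ?_ ?_)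
        · refine (card_le_card hNa).trans ?_
          rw [union_inter_distrib_right]
          refine (card_union_le _ _).trans ?_
          rw [h3, h0, h1', card_empty]
        · have := hG.card_add_two_le_card_nbhd hAB (singleton_subset_iff.2 haA)
            (singleton_nonempty a) (by rw [card_singleton]; omega)
          rwa [card_singleton, nbhd_singleton] at this
      · refine ⟨a₀, ?_⟩
        rw [hU]
        refine ih.insert haA haY ?_
        -- The expansion bound fills the smaller shore: every vertex of `Y ∩ B` is already
        -- discovered, so only the single vertex of `X ∩ B` can be new.
        have hNY : nbhd G (Y ∩ A) = Y ∩ B := by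
          have hc := hG.closed_of_card_lt hAB hcr h3.ge
          refine eq_of_subset_of_card_le hc.2 ?_
          rw [h3]
          exact hG.card_add_two_le_card_nbhd hAB inter_subset_right ih.nonempty (by omega)
        rw [hNY, ← h1']
        refine card_le_card fun v hv => ?_
        rw [mem_sdiff] at hv
        have := hNa hv.1
        simp only [mem_inter, mem_union] at this hv ⊢
        tauto
    have hU : ∀ C : Finset V, #((X ∪ Y) ∩ C) = #(X ∩ C) + #(Y ∩ C) := by
      intro C
      rw [union_inter_distrib_right, card_union_of_disjoint]
      exact hd.mono inter_subset_left inter_subset_left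
    have hUA := hU A
    right
    rcases hG.branch_cases hAB hD hS hX hY hd hs h2 with ⟨h3, h4, h5⟩ | ⟨h3, h4, h5⟩
    · exact step X Y h3 h4 h5 hd (fun f hf => (hY.crossing_le hf).trans hD) hA hcl.2
        (ihY h5 (by omega))
    · rw [union_comm X Y] at hA hcl ⊢
      exact step Y X h3 h4 h5 hd.symm (fun f hf => (hX.crossing_le hf).trans hD) hA hcl.2
        (ihX h5 (by rw [union_comm] at hA; omega))

/-- Descending into the branch that carries the surplus ends only at a shore consisting of two
vertices of `B`. -/
theorem IsBrace.exists_isShore_pair [Finite W] (hG : IsBrace G) (hAB : HasColourClasses G A B)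
    {D : PMDecomposition V W} (hD : D.width G ≤ 2) {t₁ t₂ : W} {S : Finset V}
    (h : D.IsShore t₁ t₂ S) (hS : #(S ∩ B) = #(S ∩ A) + 2) :
    ∃ t₁ t₂ S, D.IsShore t₁ t₂ S ∧ #(S ∩ A) = 0 ∧ #(S ∩ B) = 2 := by
  revert hS
  refine PMDecomposition.isShore_induction (P := fun S => #(S ∩ B) = #(S ∩ A) + 2 →
    ∃ t₁ t₂ S, D.IsShore t₁ t₂ S ∧ #(S ∩ A) = 0 ∧ #(S ∩ B) = 2) ?_ ?_ h
  · intro x hx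
    have := card_le_card (inter_subset_left (s₁ := {x}) (s₂ := B))
    rw [card_singleton] at this
    omega
  · rintro t₁ t₂ t t' S X Y hS hX hY rfl hd ihX ihY hs
    by_cases h2 : #(X ∪ Y) = 2
    · have := hAB.card_inter_add (X ∪ Y)
      exact ⟨_, _, _, hS, by omega, by omega⟩
    rcases hG.branch_cases hAB hD hS hX hY hd hs h2 with ⟨-, -, h5⟩ | ⟨-, -, h5⟩
    · exact ihY h5
    · exact ihX h5

/-- It suffices to find an even shore with at least four vertices on both sides: it cannot be
balanced, and if the surplus is in `A`, the complement has it in `B`. -/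
theorem IsBrace.exists_isShore_surplus [Finite W] (hG : IsBrace G) (hAB : HasColourClasses G A B)
    {D : PMDecomposition V W} (hD : D.width G ≤ 2) (h4 : 4 ≤ #A) :
    ∃ t₁ t₂ S, D.IsShore t₁ t₂ S ∧ #(S ∩ B) = #(S ∩ A) + 2 := by
  have hcr : ∀ {u u' Z}, D.IsShore u u' Z → ∀ f, IsMate G f → crossing f Z ≤ 2 :=
    fun hZ f hf => (hZ.crossing_le hf).trans hD
  have hcard := hAB.card_add
  rw [← hG.card_eq hAB] at hcard
  have hswap : ∀ {u u' Z}, D.IsShore u u' Z → #(Z ∩ A) = #(Z ∩ B) + 2 →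
      ∃ t₁ t₂ S, D.IsShore t₁ t₂ S ∧ #(S ∩ B) = #(S ∩ A) + 2 := by
    intro u u' Z hZ h
    refine ⟨_, _, _, hZ.compl, ?_⟩
    have h1 := card_inter_add_card_sdiff A Z
    have h2 := card_inter_add_card_sdiff B Z
    have h3 : ∀ C : Finset V, Zᶜ ∩ C = C \ Z := fun C => by
      rw [inter_comm, sdiff_eq_inter_compl]
    have := hG.card_eq hAB
    rw [h3, h3]
    rw [inter_comm] at h1 h2
    omega
  have hdone : ∀ {u u' Z}, D.IsShore u u' Z → Even #Z → 4 ≤ #Z → #Z + 4 ≤ Fintype.card V →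
      ∃ t₁ t₂ S, D.IsShore t₁ t₂ S ∧ #(S ∩ B) = #(S ∩ A) + 2 := by
    intro u u' Z hZ hev h1 h2
    have h3 := hAB.card_inter_add Z
    rcases hG.balance_of_even hAB (hcr hZ) hev with h | h | h
    · have := hG.card_of_balanced hAB (hcr hZ) h
      omega
    · exact hswap hZ h
    · exact ⟨_, _, _, hZ, h⟩
  obtain ⟨x⟩ : Nonempty V := Fintype.card_pos_iff.1 (by omega)
  obtain ⟨t₁, t₂, h⟩ := D.exists_isShore_compl_singleton x
  have h1 : #({x}ᶜ : Finset V) + 1 = Fintype.card V := by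
    rw [card_compl, card_singleton]; omega
  -- The complement of a leaf has odd size, so one of its two branches is odd and hence a single
  -- vertex; the other misses just two vertices. When that one is split again, both parts are even,
  -- and one of them has the required size.
  have hbig : ∃ u u' Z, D.IsShore u u' Z ∧ #Z + 2 = Fintype.card V := by
    obtain ⟨t, t', X, Y, hX, hY, he, hd⟩ := h.split (by omega)
    rw [he, card_union_of_disjoint hd] at h1
    have hX0 := hX.nonempty.card_pos
    have hY0 := hY.nonempty.card_pos
    have h5 := card_add_card_compl X
    have h6 := card_add_card_compl Y
    rcases Nat.even_or_odd #X with hev | hodd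
    · have : Odd #Y := by
        obtain ⟨k, hk⟩ := hev
        exact ⟨#A - k - 1, by omega⟩
      have := hG.trivial_of_odd hAB (hcr hY) this
      exact ⟨_, _, X, hX, by omega⟩
    · have := hG.trivial_of_odd hAB (hcr hX) hodd
      exact ⟨_, _, Y, hY, by omega⟩
  obtain ⟨u, u', Z, hZ, hZc⟩ := hbig
  obtain ⟨t, t', X, Y, hX, hY, rfl, hd⟩ := hZ.split (by omega)
  rw [card_union_of_disjoint hd] at hZc
  have hX0 := hX.nonempty.card_pos
  have hY0 := hY.nonempty.card_pos
  have h5 := card_add_card_compl X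
  have h6 := card_add_card_compl Y
  have hev : Even #X := by
    by_contra hodd
    rw [Nat.not_even_iff_odd] at hodd
    have hoddY : Odd #Y := by
      obtain ⟨k, hk⟩ := hodd
      exact ⟨#A - k - 2, by omega⟩
    have := hG.trivial_of_odd hAB (hcr hX) hodd
    have := hG.trivial_of_odd hAB (hcr hY) hoddY
    omega
  have hevY : Even #Y := by
    obtain ⟨k, hk⟩ := hev
    exact ⟨#A - k - 1, by omega⟩
  by_cases hX4 : 4 ≤ #X
  · exact hdone hX hev hX4 (by obtain ⟨k, hk⟩ := hevY; omega)
  · refine hdone hY hevY ?_ ?_ <;>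
    · obtain ⟨k, hk⟩ := hev
      omega

/-- With the colours exchanged, the previous lemmas give a shore of two vertices of `A`. Its
complement contains all of `B` and has a surplus of two, so n - 2 vertices of `A` are ordered. By
expansion they see all of `B`, and the last two vertices add no neighbours. -/
theorem IsBrace.exists_elim [Finite W] (hG : IsBrace G) (hAB : HasColourClasses G A B)
    (h6 : 6 ≤ Fintype.card V) {D : PMDecomposition V W} (hD : D.width G ≤ 2) :
    ∃ a, Elim G A a A := by
  have hcard := hAB.card_add
  have heq := hG.card_eq hAB
  by_cases h3 : #A = 3
  · exact hG.exists_elim_of_card_eq_three hAB h3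
  obtain ⟨_, _, S, hS, hSc⟩ := hG.exists_isShore_surplus hAB.symm hD (by omega)
  obtain ⟨_, _, S, hS, hSB, hSA⟩ := hG.exists_isShore_pair hAB.symm hD hS hSc
  have hc : ∀ C : Finset V, #(S ∩ C) + #(Sᶜ ∩ C) = #C := fun C => by
    rw [inter_comm, inter_comm Sᶜ, ← sdiff_eq_inter_compl, card_inter_add_card_sdiff]
  have hcA := hc A
  have hcB := hc B
  rcases hG.elim_of_isShore hAB hD hS.compl (by omega) (by omega) with h | ⟨a, h⟩
  · rw [h, card_empty] at hcA
    omega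
  · have h1 := hG.card_add_two_le_card_nbhd hAB inter_subset_right h.nonempty (by omega)
    have h2 : nbhd G (Sᶜ ∩ A) = B :=
      eq_of_subset_of_card_le (hAB.nbhd_subset inter_subset_right) (by omega)
    have h5 := h.union_of_full (Q := A) (fun v hv => by
      rw [h2, ← nbhd_singleton]
      exact hAB.nbhd_subset (singleton_subset_iff.2 hv)) subset_rfl
    rw [union_eq_left.2 inter_subset_right] at h5
    exact ⟨a, h5⟩

end Width

/-! ### Trees given by a parent function -/

section ParentTree

/-- The graph on `{0, …, m - 1}` in which each vertex except the last is joined to its parent. -/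
def parentTree (m : ℕ) (p : ℕ → ℕ) : SimpleGraph (Fin m) where
  Adj u v := u ≠ v ∧ ((u + 1 < m ∧ p u = v) ∨ (v + 1 < m ∧ p v = u))
  symm := ⟨fun _ _ h => ⟨h.1.symm, h.2.symm⟩⟩
  loopless := ⟨fun _ h => h.1 rfl⟩

variable {m : ℕ} {p : ℕ → ℕ}

theorem parentTree_adj_parent (hp : ∀ k, k + 1 < m → k < p k ∧ p k < m) {k : ℕ} (hk : k + 1 < m) :
    (parentTree m p).Adj ⟨k, by omega⟩ ⟨p k, (hp k hk).2⟩ :=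
  ⟨fun h => by have := (hp k hk).1; rw [Fin.mk.injEq] at h; omega, Or.inl ⟨hk, rfl⟩⟩

/-- Parents have larger numbers, so every vertex climbs to the root `m - 1` and the graph is
connected. Each edge joins a non-root vertex to its parent, so there are at most `m - 1` edges. -/
theorem parentTree_isTree (hm : 0 < m) (hp : ∀ k, k + 1 < m → k < p k ∧ p k < m) :
    (parentTree m p).IsTree := by
  have hroot : ∀ d, ∀ v : Fin m, m - 1 - v = d →
      (parentTree m p).Reachable ⟨m - 1, by omega⟩ v := by
    intro d
    induction d using Nat.strong_induction_on with
    | _ d ih =>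
    intro v hv
    by_cases h : (v : ℕ) + 1 < m
    · have h1 := parentTree_adj_parent hp h
      have h2 := (hp v h).1
      exact (ih (m - 1 - p v) (by omega) ⟨p v, (hp v h).2⟩ rfl).trans h1.symm.reachable
    · have : v = ⟨m - 1, by omega⟩ := Fin.ext (by simp only; omega)
      rw [this]
  have hconn : (parentTree m p).Connected :=
    (SimpleGraph.connected_iff_exists_forall_reachable _).2 ⟨_, fun v => hroot _ v rfl⟩
  rw [SimpleGraph.isTree_iff_connected_and_card]
  refine ⟨hconn, le_antisymm ?_ hconn.card_vert_le_card_edgeSet_add_one⟩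
  have hadj : ∀ k : Fin (m - 1), (parentTree m p).Adj ⟨k, by omega⟩ ⟨p k, (hp k (by omega)).2⟩ :=
    fun k => parentTree_adj_parent hp (by omega)
  have hsurj : Function.Surjective
      (fun k : Fin (m - 1) => (⟨s(_, _), hadj k⟩ : (parentTree m p).edgeSet)) := by
    rintro ⟨e, he⟩
    induction e with
    | h x y =>
    have he' : (parentTree m p).Adj x y := he
    rcases he'.2 with ⟨h1, h2⟩ | ⟨h1, h2⟩
    · refine ⟨⟨x, by omega⟩, Subtype.ext ?_⟩
      rw [Sym2.eq_iff]
      exact Or.inl ⟨rfl, Fin.ext h2⟩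
    · refine ⟨⟨y, by omega⟩, Subtype.ext ?_⟩
      rw [Sym2.eq_iff]
      exact Or.inr ⟨rfl, Fin.ext h2⟩
  have : Nat.card (parentTree m p).edgeSet ≤ m - 1 := by
    simpa using Nat.card_le_card_of_surjective _ hsurj
  rw [Nat.card_fin]
  omega

/-- The descendants of `k` are recognised by being closed under taking parents and children. -/
theorem treeSide_parentTree (hp : ∀ k, k + 1 < m → k < p k ∧ p k < m) {k : ℕ} (hk : k + 1 < m)
    {S : ℕ → Prop} (h0 : S k) (h1 : ¬ S (p k)) (hr : ¬ S (m - 1))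
    (hS : ∀ x, x + 1 < m → x ≠ k → (S x ↔ S (p x))) :
    treeSide (parentTree m p) ⟨k, by omega⟩ ⟨p k, (hp k hk).2⟩ = {x : Fin m | S x} := by
  ext x
  constructor
  · intro hx
    refine treeSide_induction (P := fun x : Fin m => S x) h0 ?_ hx
    rintro y z - hy hyz hne
    rcases hyz.2 with ⟨h2, h3⟩ | ⟨h2, h3⟩
    · rw [← h3]
      refine (hS y h2 fun h => hne ?_).1 hy
      rw [Sym2.eq_iff]
      exact Or.inl ⟨Fin.ext h, Fin.ext (by rw [← h3, h])⟩
    · rw [← h3] at hy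
      refine (hS z h2 fun h => hne ?_).2 hy
      rw [Sym2.eq_iff]
      exact Or.inr ⟨Fin.ext (by rw [← h3, h]), Fin.ext h⟩
  · intro hx
    induction hd : m - x using Nat.strong_induction_on generalizing x with
    | _ d ih =>
    by_cases hxk : (x : ℕ) = k
    · have : x = ⟨k, by omega⟩ := Fin.ext hxk
      rw [this]
      exact self_mem_treeSide _ _
    · have hxm : (x : ℕ) + 1 < m := by
        by_contra h
        have : (x : ℕ) = m - 1 := by omega
        exact hr (this ▸ hx)
      have h2 := hp x hxm
      have h3 := ih (m - p x) (by omega) ⟨p x, h2.2⟩ ((hS x hxm hxk).1 hx) rfl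
      refine mem_treeSide_of_adj h3 (parentTree_adj_parent hp hxm).symm fun h => ?_
      rcases Sym2.eq_iff.1 h with ⟨-, h⟩ | ⟨h, h'⟩
      · exact h1 (by have := hx; rw [h] at this; exact this)
      · exact hxk (congrArg Fin.val h')

end ParentTree

/-! ### The caterpillar of cherries and its shores -/

section Caterpillar

/-- The parent function of a caterpillar of cherries: the leaves are `0, …, N - 1`, where `2j` and
`2j + 1` form a cherry. -/
def caterParent (N k : ℕ) : ℕ :=
  min (2 * N - 3) (if k < N then N + (2 * (k / 2) - 1) else N + 2 * ((k - N) / 2) + 2)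

/-- Numbering of the inner nodes: N carries the leaves 0 and 1; N + 2j + 1 carries the leaves 2j + 2
and 2j + 3; N + 2j + 2 is the spine node joining N + 2j and N + 2j + 1. The root 2N - 3 carries the
last cherry, and the minimum in the definition attaches the last spine node 2N - 4 directly to it.
Truncated subtraction sends leaves 0 and 1 to N. -/
theorem caterParent_bounds {N : ℕ} (h4 : 4 ≤ N) (hN : Even N) (k : ℕ) (hk : k + 1 < 2 * N - 2) :
    k < caterParent N k ∧ caterParent N k < 2 * N - 2 := by
  obtain ⟨n, rfl⟩ := hN
  unfold caterParent
  split_ifs <;> omega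

/-- Replaces halves and minima by case distinctions with a linear parameter `c`, so that the
adjacencies below become linear arithmetic. -/
theorem caterParent_cases {n : ℕ} (h4 : 4 ≤ n + n) (v : ℕ) :
    (∃ c, c < n ∧ (v = 2 * c ∨ v = 2 * c + 1) ∧ caterParent (n + n) v = n + n + (2 * c - 1)) ∨
    ∃ c, (v = n + n + 2 * c ∨ v = n + n + 2 * c + 1) ∧
      (2 * c + 2 ≤ n + n - 3 ∧ caterParent (n + n) v = n + n + 2 * c + 2 ∨
        n + n - 3 < 2 * c + 2 ∧ caterParent (n + n) v = 2 * (n + n) - 3) := by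
  unfold caterParent
  split_ifs
  · exact Or.inl ⟨v / 2, by omega⟩
  · exact Or.inr ⟨(v - (n + n)) / 2, by omega⟩

abbrev caterTree (N : ℕ) : SimpleGraph (Fin (2 * N - 2)) := parentTree (2 * N - 2) (caterParent N)

theorem caterTree_neighborSet_leaf {N : ℕ} (h4 : 4 ≤ N) (hN : Even N) {w : Fin (2 * N - 2)}
    (hw : (w : ℕ) < N) : ((caterTree N).neighborSet w).ncard = 1 := by
  have hb := caterParent_bounds h4 hN w (by omega)
  rw [Set.ncard_eq_one]
  refine ⟨⟨caterParent N w, hb.2⟩, ?_⟩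
  ext v
  simp only [SimpleGraph.mem_neighborSet, parentTree, Set.mem_singleton_iff, Fin.ext_iff, ne_eq]
  have h2 : N ≤ caterParent N v := by unfold caterParent; split_ifs <;> omega
  omega

theorem caterTree_neighborSet_inner {N : ℕ} (h4 : 4 ≤ N) (hN : Even N) {w : Fin (2 * N - 2)}
    (hw : N ≤ (w : ℕ)) : ((caterTree N).neighborSet w).ncard = 3 := by
  have hwm := w.2
  have key : ∀ x y z : ℕ, x < 2 * N - 2 → y < 2 * N - 2 → z < 2 * N - 2 → x ≠ y → x ≠ z → y ≠ z →
      (∀ v : Fin (2 * N - 2), (caterTree N).Adj w v ↔ ((v : ℕ) = x ∨ (v : ℕ) = y ∨ (v : ℕ) = z)) →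
      ((caterTree N).neighborSet w).ncard = 3 := by
    intro x y z hx hy hz hxy hxz hyz h
    rw [Set.ncard_eq_three]
    refine ⟨⟨x, hx⟩, ⟨y, hy⟩, ⟨z, hz⟩, by simpa, by simpa, by simpa, ?_⟩
    ext v
    rw [SimpleGraph.mem_neighborSet, h]
    simp [Fin.ext_iff]
  obtain ⟨n, rfl⟩ := hN
  have hpar := caterParent_cases (n := n) (by omega)
  have fin : ∀ x y z : ℕ, (∀ v : ℕ, v < 2 * (n + n) - 2 →
      ((w : ℕ) ≠ v ∧ ((w : ℕ) + 1 < 2 * (n + n) - 2 ∧ caterParent (n + n) w = v ∨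
        v + 1 < 2 * (n + n) - 2 ∧ caterParent (n + n) v = w) ↔ (v = x ∨ v = y ∨ v = z))) →
      ∀ v : Fin (2 * (n + n) - 2), (caterTree (n + n)).Adj w v ↔
        ((v : ℕ) = x ∨ (v : ℕ) = y ∨ (v : ℕ) = z) := by
    intro x y z h v
    rw [← h v v.2]
    simp only [parentTree, Fin.ext_iff, ne_eq]
  by_cases hr : (w : ℕ) = 2 * (n + n) - 3
  -- The root is adjacent to the last spine node and to the last two leaves.
  · refine key (2 * (n + n) - 4) (n + n - 2) (n + n - 1) ?_ ?_ ?_ ?_ ?_ ?_ (fin _ _ _ fun v hv => ?_)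
    on_goal 7 =>
      rcases hpar v with ⟨c, hc, hv1, hv2⟩ | ⟨c, hv1, hv2⟩
      · omega
      · omega
    all_goals omega
  by_cases h0 : (w : ℕ) = n + n
  · have hpw' : caterParent (n + n) w = n + n + 2 ∧ 3 ≤ n ∨
        caterParent (n + n) w = n + n + 1 ∧ n = 2 := by
      rcases hpar w with ⟨c, hc, hv1, hv2⟩ | ⟨c, hv1, hv2⟩ <;> omega
    -- The first inner node carries the leaves 0 and 1. Its parent is the next spine node, or the
    -- root if there are only four leaves.
    refine key (caterParent (n + n) w) 0 1 ?_ ?_ ?_ ?_ ?_ ?_ (fin _ _ _ fun v hv => ?_)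
    on_goal 7 =>
      rcases hpar v with ⟨c, hc, hv1, hv2⟩ | ⟨c, hv1, hv2⟩
      · omega
      · omega
    all_goals omega
  obtain ⟨j, hj⟩ : ∃ j, (w : ℕ) = n + n + 2 * j + 1 ∨ (w : ℕ) = n + n + 2 * j + 2 :=
    ⟨(w - (n + n) - 1) / 2, by omega⟩
  rcases hj with hj | hj
  · have hpw' : caterParent (n + n) w = n + n + 2 * j + 2 := by
      rcases hpar w with ⟨c, hc, hv1, hv2⟩ | ⟨c, hv1, hv2⟩ <;> omega
    refine key (caterParent (n + n) w) (2 * j + 2) (2 * j + 3) ?_ ?_ ?_ ?_ ?_ ?_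
      (fin _ _ _ fun v hv => ?_)
    on_goal 7 =>
      rcases hpar v with ⟨c, hc, hv1, hv2⟩ | ⟨c, hv1, hv2⟩
      · omega
      · omega
    all_goals omega
  · have hpw' : caterParent (n + n) w = n + n + 2 * j + 4 ∧ j + 3 < n ∨
        caterParent (n + n) w = n + n + 2 * j + 3 ∧ n = j + 3 := by
      rcases hpar w with ⟨c, hc, hv1, hv2⟩ | ⟨c, hv1, hv2⟩ <;> omega
    -- The children of a later spine node are the top of a cherry and the preceding spine node.
    refine key (caterParent (n + n) w) (w - 1) (w - 2) ?_ ?_ ?_ ?_ ?_ ?_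
      (fin _ _ _ fun v hv => ?_)
    on_goal 7 =>
      rcases hpar v with ⟨c, hc, hv1, hv2⟩ | ⟨c, hv1, hv2⟩
      · omega
      · rcases hpw' with hpw' | hpw'
        · omega
        · omega
    all_goals omega

theorem caterTree_isLeaf_iff {N : ℕ} (h4 : 4 ≤ N) (hN : Even N) {w : Fin (2 * N - 2)} :
    IsLeaf (caterTree N) w ↔ (w : ℕ) < N := by
  constructor
  · intro h
    by_contra hw
    have := caterTree_neighborSet_inner h4 hN (not_lt.1 hw)
    rw [IsLeaf] at h
    omega
  · exact caterTree_neighborSet_leaf h4 hN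

variable {V : Type*}

/-- The caterpillar of cherries whose leaves are labelled by `q` from one end to the other. -/
def caterDecomposition {N : ℕ} (h4 : 4 ≤ N) (hN : Even N) (q : Fin N ≃ V) :
    PMDecomposition V (Fin (2 * N - 2)) where
  tree := caterTree N
  isTree := parentTree_isTree (by omega) (caterParent_bounds h4 hN)
  cubic w := by
    by_cases hw : (w : ℕ) < N
    · exact Or.inl ((caterTree_isLeaf_iff h4 hN).2 hw)
    · exact Or.inr (caterTree_neighborSet_inner h4 hN (not_lt.1 hw))
  δ := Equiv.trans
    { toFun := fun w => (⟨w.1, (caterTree_isLeaf_iff h4 hN).1 w.2⟩ : Fin N)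
      invFun := fun i : Fin N => ⟨⟨i, by omega⟩, (caterTree_isLeaf_iff h4 hN).2 i.2⟩
      left_inv := fun _ => rfl
      right_inv := fun _ => rfl } q

variable [Fintype V] [DecidableEq V] {G : SimpleGraph V}

/-- The set of the vertices `q i` with `i < k`. -/
def initialSet {N : ℕ} (q : Fin N ≃ V) (k : ℕ) : Finset V :=
  univ.filter fun v => (q.symm v : ℕ) < k

theorem caterDecomposition_shore {N : ℕ} (h4 : 4 ≤ N) (hN : Even N) (q : Fin N ≃ V) {k : ℕ}
    (hk : k + 1 < 2 * N - 2) {S : ℕ → Prop} (h0 : S k) (h1 : ¬ S (caterParent N k))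
    (hr : ¬ S (2 * N - 3)) (hS : ∀ x, x + 1 < 2 * N - 2 → x ≠ k → (S x ↔ S (caterParent N x))) :
    (caterDecomposition h4 hN q).shore ⟨k, by omega⟩
      ⟨caterParent N k, (caterParent_bounds h4 hN k hk).2⟩ = {v | S (q.symm v)} := by
  rw [PMDecomposition.shore_eq_preimage]
  have := treeSide_parentTree (caterParent_bounds h4 hN) hk h0 h1
    (by rwa [show 2 * N - 2 - 1 = 2 * N - 3 by omega]) hS
  change {v | _ ∈ treeSide (caterTree N) _ _} = _
  rw [this]
  rfl

theorem caterDecomposition_shore_spine {N : ℕ} (h4 : 4 ≤ N) (hN : Even N) (q : Fin N ≃ V) {j : ℕ}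
    (hj : 2 * j + 4 ≤ N) : (caterDecomposition h4 hN q).shore ⟨N + 2 * j, by omega⟩
      ⟨caterParent N (N + 2 * j), (caterParent_bounds h4 hN _ (by omega)).2⟩
        = initialSet q (2 * j + 2) := by
  obtain ⟨n, rfl⟩ := hN
  have hpar := caterParent_cases h4
  rw [caterDecomposition_shore h4 ⟨n, rfl⟩ q (k := n + n + 2 * j) (by omega)
    (S := fun x => x < 2 * j + 2 ∨ n + n ≤ x ∧ x ≤ n + n + 2 * j)]
  · ext v
    have := (q.symm v).2
    simp only [Set.mem_ofPred_eq, initialSet, coe_filter, mem_univ, true_and]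
    omega
  · omega
  · rcases hpar (n + n + 2 * j) with ⟨c, hc, hv1, hv2⟩ | ⟨c, hv1, hv2⟩ <;> omega
  · omega
  · intro x hx hxk
    rcases hpar x with ⟨c, hc, hv1, hv2⟩ | ⟨c, hv1, hv2⟩ <;> omega

theorem caterDecomposition_shore_leaf {N : ℕ} (h4 : 4 ≤ N) (hN : Even N) (q : Fin N ≃ V) {k : ℕ}
    (hk : k < N) : (caterDecomposition h4 hN q).shore ⟨k, by omega⟩
      ⟨caterParent N k, (caterParent_bounds h4 hN _ (by omega)).2⟩
        = (({q ⟨k, hk⟩} : Finset V) : Set V) := by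
  obtain ⟨n, rfl⟩ := hN
  have hpar := caterParent_cases h4
  rw [caterDecomposition_shore h4 ⟨n, rfl⟩ q (k := k) (by omega) (S := fun x => x = k)]
  · ext v
    rw [coe_singleton, Set.mem_singleton_iff, ← Equiv.symm_apply_eq, Fin.ext_iff,
      Set.mem_ofPred_eq]
  · rfl
  · rcases hpar k with ⟨c, hc, hv1, hv2⟩ | ⟨c, hv1, hv2⟩ <;> omega
  · omega
  · intro x hx hxk
    rcases hpar x with ⟨c, hc, hv1, hv2⟩ | ⟨c, hv1, hv2⟩ <;> omega

theorem caterDecomposition_shore_cherry {N : ℕ} (h4 : 4 ≤ N) (hN : Even N) (q : Fin N ≃ V) {j : ℕ}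
    (hj : 2 * j + 4 < N) : (caterDecomposition h4 hN q).shore ⟨N + 2 * j + 1, by omega⟩
      ⟨caterParent N (N + 2 * j + 1), (caterParent_bounds h4 hN _ (by omega)).2⟩
        = (({q ⟨2 * j + 2, by omega⟩, q ⟨2 * j + 3, by omega⟩} : Finset V) : Set V) := by
  obtain ⟨n, rfl⟩ := hN
  have hpar := caterParent_cases h4
  rw [caterDecomposition_shore h4 ⟨n, rfl⟩ q (k := n + n + 2 * j + 1) (by omega)
    (S := fun x => x = n + n + 2 * j + 1 ∨ x = 2 * j + 2 ∨ x = 2 * j + 3)]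
  · ext v
    have := (q.symm v).2
    rw [coe_pair, Set.mem_insert_iff, Set.mem_singleton_iff, ← Equiv.symm_apply_eq, Fin.ext_iff,
      ← Equiv.symm_apply_eq, Fin.ext_iff, Set.mem_ofPred_eq]
    simp only
    omega
  · omega
  · rcases hpar (n + n + 2 * j + 1) with ⟨c, hc, hv1, hv2⟩ | ⟨c, hv1, hv2⟩ <;> omega
  · omega
  · intro x hx hxk
    rcases hpar x with ⟨c, hc, hv1, hv2⟩ | ⟨c, hv1, hv2⟩ <;> omega

/-- Leaves and cherries have at most two vertices, hence porosity at most two; only the shores along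
the spine need a hypothesis. -/
theorem caterDecomposition_width_le {N : ℕ} (h4 : 4 ≤ N) (hN : Even N) (q : Fin N ≃ V)
    (hq : ∀ j, 2 * j + 4 ≤ N → ∀ f, IsMate G f → crossing f (initialSet q (2 * j + 2)) ≤ 2) :
    (caterDecomposition h4 hN q).width G ≤ 2 := by
  have key : ∀ (k : ℕ) (hk : k + 1 < 2 * N - 2) (S : Finset V),
      (caterDecomposition h4 hN q).shore ⟨k, by omega⟩
        ⟨caterParent N k, (caterParent_bounds h4 hN k hk).2⟩ = S →
      ∀ f, IsMate G f → crossing f S ≤ 2 := by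
    intro k hk S hS f hf
    have heven : N % 2 = 0 := Nat.even_iff.1 hN
    obtain h | h | h : k < N ∨ (∃ j, 2 * j + 4 ≤ N ∧ k = N + 2 * j) ∨
        (∃ j, 2 * j + 4 < N ∧ k = N + 2 * j + 1) := by
      by_cases h : k < N
      · exact Or.inl h
      · rcases Nat.mod_two_eq_zero_or_one (k - N) with h2 | h2
        · exact Or.inr (Or.inl ⟨(k - N) / 2, by omega, by omega⟩)
        · exact Or.inr (Or.inr ⟨(k - N) / 2, by omega, by omega⟩)
    · rw [caterDecomposition_shore_leaf h4 hN q h, coe_inj] at hS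
      refine (crossing_le_card f S).trans ?_
      rw [← hS, card_singleton]
      omega
    · obtain ⟨j, hj, rfl⟩ := h
      rw [caterDecomposition_shore_spine h4 hN q hj, coe_inj] at hS
      rw [← hS]
      exact hq j hj f hf
    · obtain ⟨j, hj, rfl⟩ := h
      rw [caterDecomposition_shore_cherry h4 hN q hj, coe_inj] at hS
      refine (crossing_le_card f S).trans ?_
      rw [← hS]
      exact card_le_two
  refine PMDecomposition.width_le _ fun t₁ t₂ S hS f hf => ?_
  rcases hS.1.2 with ⟨h1, h2⟩ | ⟨h1, h2⟩
  · refine key t₁ h1 S ?_ f hf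
    rw [← hS.2]
    congr 1
    exact Fin.ext h2
  · rw [← crossing_compl hf]
    refine key t₂ h1 Sᶜ ?_ f hf
    rw [← hS.compl.2]
    congr 1
    exact Fin.ext h2

end Caterpillar

/-! ### Labelling the caterpillar by enumerations of the colour classes -/

section LeafOrder

variable {V : Type*} [Fintype V] [DecidableEq V] {G : SimpleGraph V} {A B : Finset V}

/-- The order of the leaves of the caterpillar belonging to enumerations `a` and `b` of the two
colour classes with `n` vertices each. -/
def leafOrder (n : ℕ) (a b : ℕ → V) (i : ℕ) : V :=
  if i < 2 then b i else if 2 * n - 2 ≤ i then a (i - n)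
  else if i % 2 = 0 then a (i / 2 - 1) else b (i / 2 + 1)

/-- The cherries are labelled b₀b₁, a₀b₂, a₁b₃, …, aₙ₋₃bₙ₋₁, aₙ₋₂aₙ₋₁. So the leaves before position
2j + 2 are the first j vertices of `A` and the first j + 2 of `B`. -/
theorem leafOrder_left {n : ℕ} (a b : ℕ → V) {i : ℕ} (hi : i + 3 ≤ n) :
    leafOrder n a b (2 * i + 2) = a i := by
  rw [leafOrder, if_neg (by omega), if_neg (by omega), if_pos (by omega)]
  congr 1
  omega

theorem leafOrder_right {n : ℕ} (a b : ℕ → V) {l : ℕ} (hl : l < n) (h2 : 2 ≤ n) :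
    leafOrder n a b (if l < 2 then l else 2 * l - 1) = b l := by
  split_ifs with h
  · rw [leafOrder, if_pos h]
  · rw [leafOrder, if_neg (by omega), if_neg (by omega), if_neg (by omega)]
    congr 1
    omega

/-- Enumerations of the two colour classes. -/
structure EnumClasses (A B : Finset V) (n : ℕ) (a b : ℕ → V) : Prop where
  two_le : 2 ≤ n
  card_left : #A = n
  card_right : #B = n
  left_mem : ∀ i < n, a i ∈ A
  right_mem : ∀ i < n, b i ∈ B
  left_inj : ∀ i < n, ∀ j < n, a i = a j → i = j
  right_inj : ∀ i < n, ∀ j < n, b i = b j → i = j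

theorem EnumClasses.leafOrder_injOn {n : ℕ} {a b : ℕ → V} (h : EnumClasses A B n a b)
    (hAB : HasColourClasses G A B) {i j : ℕ} (hi : i < 2 * n) (hj : j < 2 * n)
    (he : leafOrder n a b i = leafOrder n a b j) : i = j := by
  have h2 := h.two_le
  have hne : ∀ i < n, ∀ j < n, a i ≠ b j := fun i hi j hj he =>
    hAB.mem_right_iff.1 (h.right_mem j hj) (he ▸ h.left_mem i hi)
  have hcase : ∀ i < 2 * n, (∃ k < n, leafOrder n a b i = b k ∧
        (i < 2 ∧ k = i ∨ 2 ≤ i ∧ i < 2 * n - 2 ∧ i % 2 = 1 ∧ k = i / 2 + 1)) ∨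
      ∃ k < n, leafOrder n a b i = a k ∧
        (2 * n - 2 ≤ i ∧ k = i - n ∨ 2 ≤ i ∧ i < 2 * n - 2 ∧ i % 2 = 0 ∧ k = i / 2 - 1) := by
    intro i hi
    unfold leafOrder
    split_ifs with h1 h3 h4
    · exact Or.inl ⟨i, by omega, rfl, by omega⟩
    · exact Or.inr ⟨_, by omega, rfl, by omega⟩
    · exact Or.inr ⟨_, by omega, rfl, by omega⟩
    · exact Or.inl ⟨_, by omega, rfl, by omega⟩
  rcases hcase i hi with ⟨k, hk, h3, h4⟩ | ⟨k, hk, h3, h4⟩ <;>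
    rcases hcase j hj with ⟨l, hl, h5, h6⟩ | ⟨l, hl, h5, h6⟩ <;> rw [h3, h5] at he
  · have := h.right_inj k hk l hl he
    omega
  · exact absurd he.symm (hne _ hl _ hk)
  · exact absurd he (hne _ hk _ hl)
  · have := h.left_inj k hk l hl he
    omega

/-- The order of the leaves as a bijection. -/
noncomputable def EnumClasses.equiv {n : ℕ} {a b : ℕ → V} (h : EnumClasses A B n a b)
    (hAB : HasColourClasses G A B) {N : ℕ} (hN : N = 2 * n) : Fin N ≃ V :=
  Equiv.ofBijective (fun i => leafOrder n a b i) <| by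
    rw [Fintype.bijective_iff_injective_and_card]
    refine ⟨fun i j he => Fin.ext (h.leafOrder_injOn hAB (by omega) (by omega) he), ?_⟩
    rw [Fintype.card_fin, ← hAB.card_add, h.card_left, h.card_right]
    omega

theorem EnumClasses.equiv_symm {n : ℕ} {a b : ℕ → V} (h : EnumClasses A B n a b)
    (hAB : HasColourClasses G A B) {N : ℕ} (hN : N = 2 * n) {i : ℕ} (hi : i < 2 * n) {v : V}
    (hv : leafOrder n a b i = v) : ((h.equiv hAB hN).symm v : ℕ) = i := by
  have : (h.equiv hAB hN) ⟨i, by omega⟩ = v := hv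
  rw [← this, Equiv.symm_apply_apply]

theorem card_initialSet {N : ℕ} (q : Fin N ≃ V) {k : ℕ} (hk : k ≤ N) : #(initialSet q k) = k := by
  have h2 : initialSet q k = univ.map ((Fin.castLEEmb hk).trans q.toEmbedding) := by
    ext v
    simp only [initialSet, mem_filter, mem_univ, true_and, mem_map]
    constructor
    · intro h
      exact ⟨⟨_, h⟩, by simp⟩
    · rintro ⟨i, rfl⟩
      simp
  rw [h2, card_map, card_univ, Fintype.card_fin]

theorem EnumClasses.initialSet_subset {n : ℕ} {a b : ℕ → V} (h : EnumClasses A B n a b)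
    (hAB : HasColourClasses G A B) {N : ℕ} (hN : N = 2 * n) {j : ℕ} (hj : j + 2 ≤ n) :
    (range j).image a ∪ (range (j + 2)).image b ⊆ initialSet (h.equiv hAB hN) (2 * j + 2) := by
  have h2 := h.two_le
  intro v hv
  rw [initialSet, mem_filter]
  refine ⟨mem_univ _, ?_⟩
  simp only [mem_union, mem_image, mem_range] at hv
  rcases hv with ⟨i, hi, rfl⟩ | ⟨l, hl, rfl⟩
  · rw [h.equiv_symm hAB hN (by omega) (leafOrder_left a b (by omega))]
    omega
  · rw [h.equiv_symm hAB hN (by split_ifs <;> omega) (leafOrder_right a b (by omega) h2)]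
    split_ifs <;> omega

theorem EnumClasses.card_image_left {n : ℕ} {a b : ℕ → V} (h : EnumClasses A B n a b) {j : ℕ}
    (hj : j ≤ n) : #((range j).image a) = j := by
  rw [card_image_of_injOn, card_range]
  intro x hx y hy hxy
  rw [coe_range, Set.mem_Iio] at hx hy
  exact h.left_inj x (by omega) y (by omega) hxy

theorem EnumClasses.card_image_right {n : ℕ} {a b : ℕ → V} (h : EnumClasses A B n a b) {j : ℕ}
    (hj : j ≤ n) : #((range j).image b) = j := by
  rw [card_image_of_injOn, card_range]
  intro x hx y hy hxy
  rw [coe_range, Set.mem_Iio] at hx hy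
  exact h.right_inj x (by omega) y (by omega) hxy

theorem EnumClasses.initialSet_eq {n : ℕ} {a b : ℕ → V} (h : EnumClasses A B n a b)
    (hAB : HasColourClasses G A B) {N : ℕ} (hN : N = 2 * n) {j : ℕ} (hj : j + 2 ≤ n) :
    initialSet (h.equiv hAB hN) (2 * j + 2) = (range j).image a ∪ (range (j + 2)).image b := by
  refine (eq_of_subset_of_card_le (h.initialSet_subset hAB hN hj) ?_).symm
  have hd : Disjoint ((range j).image a) ((range (j + 2)).image b) := by
    refine hAB.disjoint.mono ?_ ?_
    · intro v hv
      obtain ⟨i, hi, rfl⟩ := mem_image.1 hv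
      exact h.left_mem i (by rw [mem_range] at hi; omega)
    · intro v hv
      obtain ⟨i, hi, rfl⟩ := mem_image.1 hv
      exact h.right_mem i (by rw [mem_range] at hi; omega)
  rw [card_union_of_disjoint hd, h.card_image_left (by omega), h.card_image_right hj,
    card_initialSet _ (by omega)]
  omega

/-- Each initial segment on the spine contains all neighbours of its vertices of `A`, so its
crossing number is its surplus of `B`, which is at most two. The last two vertices of `A` lie in no
such segment, hence the bound on `i` in `hcl`. -/
theorem EnumClasses.width_le {n : ℕ} {a b : ℕ → V} (h : EnumClasses A B n a b)
    (hAB : HasColourClasses G A B) {N : ℕ} (hN : N = 2 * n) (h4 : 4 ≤ N) (he : Even N)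
    (hcl : ∀ i, i + 3 ≤ n → ∀ w, G.Adj (a i) w → ∃ l < i + 3, w = b l) :
    (caterDecomposition h4 he (h.equiv hAB hN)).width G ≤ 2 := by
  refine caterDecomposition_width_le h4 he _ fun j hj f hf => ?_
  have hS := h.initialSet_eq hAB hN (j := j) (by omega)
  have hcard := card_initialSet (h.equiv hAB hN) (k := 2 * j + 2) (by omega)
  rw [hS] at hcard ⊢
  have h1 := hAB.crossing_add_of_closed hf
    (S := (range j).image a ∪ (range (j + 2)).image b) ?_
  · have h2 := hAB.card_inter_add ((range j).image a ∪ (range (j + 2)).image b)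
    have h3 : j ≤ #(((range j).image a ∪ (range (j + 2)).image b) ∩ A) := by
      refine (h.card_image_left (j := j) (by omega)).symm.le.trans ?_
      refine card_le_card fun v hv => mem_inter.2 ⟨mem_union_left _ hv, ?_⟩
      obtain ⟨i, hi, rfl⟩ := mem_image.1 hv
      exact h.left_mem i (by rw [mem_range] at hi; omega)
    omega
  · intro v hv hvA w hvw
    rcases mem_union.1 hv with hv | hv
    · obtain ⟨i, hi, rfl⟩ := mem_image.1 hv
      rw [mem_range] at hi
      obtain ⟨l, hl, rfl⟩ := hcl i (by omega) w hvw
      exact mem_union_right _ (mem_image_of_mem _ (mem_range.2 (by omega)))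
    · obtain ⟨i, hi, rfl⟩ := mem_image.1 hv
      rw [mem_range] at hi
      exact absurd hvA (hAB.mem_right_iff.1 (h.right_mem i (by omega)))

end LeafOrder

/-! ### Correctness of the greedy procedure -/

section Greedy

variable {V : Type*} [Fintype V] [DecidableEq V] (G : SimpleGraph V) [DecidableRel G.Adj]

/-- The list `L` starts with a vertex of degree three, and each further vertex has at most one new
neighbour. -/
structure SlowList (L : List V) : Prop where
  ne_nil : L ≠ []
  card_nbhd_one : #(nbhd G (L.take 1).toFinset) = 3
  card_nbhd_le : ∀ i, #(nbhd G (L.take i).toFinset) ≤ i + 2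

variable {G}

theorem SlowList.singleton {a : V} (h : #(G.neighborFinset a) = 3) : SlowList G [a] where
  ne_nil := by simp
  card_nbhd_one := by simpa [nbhd_singleton] using h
  card_nbhd_le i := by
    cases i with
    | zero => simp [nbhd]
    | succ i => simp [nbhd_singleton, h]

theorem SlowList.append_singleton {L : List V} {a : V} (hL : SlowList G L)
    (h : #(G.neighborFinset a \ nbhd G L.toFinset) ≤ 1) : SlowList G (L ++ [a]) where
  ne_nil := by simp
  card_nbhd_one := by
    have := List.length_pos_iff.2 hL.ne_nil
    rw [List.take_append_of_le_length (by omega)]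
    exact hL.card_nbhd_one
  card_nbhd_le i := by
    rcases le_or_gt i L.length with hi | hi
    · rw [List.take_append_of_le_length hi]
      exact hL.card_nbhd_le i
    · rw [List.take_of_length_le (by simpa using hi), List.toFinset_append, union_comm]
      have h1 : ([a] : List V).toFinset ∪ L.toFinset = insert a L.toFinset := by
        ext; simp
      rw [h1, nbhd_insert, ← sdiff_union_self_eq_union]
      have h2 := hL.card_nbhd_le L.length
      rw [List.take_length] at h2
      have := card_union_le (G.neighborFinset a \ nbhd G L.toFinset) (nbhd G L.toFinset)
      omega

theorem greedyExtend_spec {P U L : List V} (hP : SlowList G P)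
    (h : greedyExtend G U.length P U = some L) : SlowList G L ∧ L.Perm (P ++ U) := by
  induction hk : U.length generalizing P U with
  | zero =>
    rw [hk, greedyExtend, Option.some_inj] at h
    rw [List.length_eq_zero_iff.1 hk, List.append_nil, ← h]
    exact ⟨hP, List.Perm.refl _⟩
  | succ k ih =>
    rw [hk, greedyExtend] at h
    split at h
    · simp at h
    · rename_i a' ha
      have hmem := List.mem_of_find?_eq_some ha
      have hprop := List.find?_some ha
      have hlen : (U.erase a').length = k := by rw [List.length_erase_of_mem hmem]; omega
      obtain ⟨h1, h2⟩ := ih (hP.append_singleton (by simpa using hprop)) (by rwa [hlen]) hlen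
      refine ⟨h1, h2.trans ?_⟩
      rw [List.append_assoc]
      exact List.Perm.append_left _ (List.perm_cons_erase hmem).symm

theorem greedyOrder_spec {l L : List V} (h : greedyOrder G l = some L) :
    SlowList G L ∧ L.Perm l := by
  obtain ⟨a, ha, h⟩ := List.exists_of_findSome?_eq_some h
  split_ifs at h with h3
  have hlen : (l.erase a).length = l.length - 1 := List.length_erase_of_mem ha
  rw [← hlen] at h
  obtain ⟨h1, h2⟩ := greedyExtend_spec (SlowList.singleton h3) h
  exact ⟨h1, h2.trans (List.perm_cons_erase ha).symm⟩

variable {A B : Finset V}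

theorem Elim.mem_start {a : V} {Q : Finset V} (h : Elim G A a Q) :
    a ∈ A ∧ #(G.neighborFinset a) = 3 := by
  induction h with
  | single h1 h2 => exact ⟨h1, h2⟩
  | insert _ _ _ _ ih => exact ih

/-- The first vertex of the witnessing order outside `P` works: its predecessors lie in `P`, and
enlarging the chosen set only reduces the number of new neighbours. This is why no choice of the
greedy procedure can lead to a dead end. -/
theorem Elim.exists_next {a : V} {Q P : Finset V} (h : Elim G A a Q) (ha : a ∈ P)
    (hQ : ¬ Q ⊆ P) : ∃ a' ∈ A \ P, #(G.neighborFinset a' \ nbhd G P) ≤ 1 := by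
  induction h with
  | single => exact absurd (singleton_subset_iff.2 ha) hQ
  | @insert Q a' _ hA _ h1 ih =>
    by_cases hQ' : Q ⊆ P
    · refine ⟨a', mem_sdiff.2 ⟨hA, fun h => hQ (insert_subset h hQ')⟩, ?_⟩
      exact (card_le_card (sdiff_subset_sdiff subset_rfl (nbhd_mono hQ'))).trans h1
    · exact ih hQ'

theorem Elim.greedyExtend_ne_none {a : V} (h : Elim G A a A) {P U : List V} (ha : a ∈ P)
    (hU : U.Nodup) (hPU : U.toFinset = A \ P.toFinset) : greedyExtend G U.length P U ≠ none := by
  induction hk : U.length generalizing P U with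
  | zero => rw [greedyExtend]; simp
  | succ k ih =>
    rw [greedyExtend]
    split
    · rename_i hnone
      have hsub : ¬ A ⊆ P.toFinset := by
        rw [← sdiff_eq_empty_iff_subset, ← hPU, List.toFinset_eq_empty_iff]
        rintro rfl
        simp at hk
      obtain ⟨a', h1, h2⟩ := h.exists_next (by simpa using ha) hsub
      rw [← hPU, List.mem_toFinset] at h1
      have := List.find?_eq_none.1 hnone a' h1
      simp [h2] at this
    · rename_i a' ha'
      have hmem := List.mem_of_find?_eq_some ha'
      refine ih (by simp [ha]) (hU.erase _) ?_ (by rw [List.length_erase_of_mem hmem]; omega)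
      ext v
      have h1 : v ∈ U ↔ v ∈ A \ P.toFinset := by rw [← hPU, List.mem_toFinset]
      rw [List.mem_toFinset, hU.mem_erase_iff, h1]
      simp only [mem_sdiff, List.mem_toFinset, List.mem_append, List.mem_singleton]
      tauto

theorem Elim.greedyOrder_ne_none {a : V} (h : Elim G A a A) {l : List V} (hl : l.Nodup)
    (hlA : l.toFinset = A) : greedyOrder G l ≠ none := by
  intro hnone
  obtain ⟨h1, h2⟩ := h.mem_start
  rw [← hlA, List.mem_toFinset] at h1
  have := List.findSome?_eq_none_iff.1 hnone a h1
  rw [if_pos h2, ← List.length_erase_of_mem h1] at this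
  refine h.greedyExtend_ne_none (by simp) (hl.erase a) ?_ this
  ext v
  rw [← hlA, List.mem_toFinset, hl.mem_erase_iff]
  simp [and_comm]

/-- The neighbours of the vertices in a list, in the order in which they are discovered; the list
`l` determines the order among the neighbours of a single vertex. -/
def discover (G : SimpleGraph V) [DecidableRel G.Adj] (l : List V) (L : List V) : List V :=
  L.foldl (fun D a => D ++ l.filter fun w => G.Adj a w ∧ w ∉ D) []

theorem discover_append_singleton (l L : List V) (a : V) : discover G l (L ++ [a]) =
    discover G l L ++ l.filter fun w => G.Adj a w ∧ w ∉ discover G l L := by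
  rw [discover, List.foldl_append]
  rfl

theorem mem_discover {l : List V} (hl : ∀ v, v ∈ l) (L : List V) (w : V) :
    w ∈ discover G l L ↔ w ∈ nbhd G L.toFinset := by
  induction L using List.reverseRecOn with
  | nil => simp [discover, nbhd]
  | append_singleton L a ih =>
    rw [mem_nbhd] at ih
    rw [discover_append_singleton, List.mem_append, List.mem_filter, mem_nbhd]
    simp only [List.mem_toFinset, List.mem_append, List.mem_singleton, hl, true_and,
      decide_eq_true_eq, ih]
    constructor
    · rintro (⟨v, hv, h⟩ | h)
      · exact ⟨v, Or.inl hv, h⟩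
      · exact ⟨a, Or.inr rfl, h.1⟩
    · rintro ⟨v, hv | rfl, h⟩
      · exact Or.inl ⟨v, hv, h⟩
      · by_cases h' : ∃ v ∈ L, G.Adj v w
        · exact Or.inl h'
        · exact Or.inr ⟨h, h'⟩

theorem nodup_discover {l : List V} (hl : l.Nodup) (L : List V) : (discover G l L).Nodup := by
  induction L using List.reverseRecOn with
  | nil => simp [discover]
  | append_singleton L a ih =>
    rw [discover_append_singleton, List.nodup_append']
    refine ⟨ih, hl.filter _, ?_⟩
    intro w hw hw'
    rw [List.mem_filter] at hw'
    simp [hw] at hw'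

theorem discover_take_prefix (l L : List V) (k : ℕ) :
    discover G l (L.take k) <+: discover G l L := by
  have key : ∀ L R : List V, discover G l L <+: discover G l (L ++ R) := by
    intro L R
    induction R using List.reverseRecOn with
    | nil => simp
    | append_singleton R a ih =>
      rw [← List.append_assoc, discover_append_singleton]
      exact ih.trans (List.prefix_append _ _)
  conv_rhs => rw [← List.take_append_drop k L]
  exact key _ _

theorem length_discover {l : List V} (hl : l.Nodup) (hl' : ∀ v, v ∈ l) (L : List V) :
    (discover G l L).length = #(nbhd G L.toFinset) := by
  rw [← List.toFinset_card_of_nodup (nodup_discover hl L)]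
  congr 1
  ext w
  rw [List.mem_toFinset, mem_discover hl']

/-- Enumerations of the colour classes given by an ordering of the first one. -/
theorem enumClasses_of_list {L l : List V} (hl : l.Nodup) (hl' : ∀ v, v ∈ l) (hLn : L.Nodup) (hLA : L.toFinset = A) {n : ℕ} (h2 : 2 ≤ n)
    (hn : #A = n) (hB : #B = n) (hnb : nbhd G A = B) {a b : ℕ → V}
    (ha : ∀ i (h : i < L.length), a i = L[i])
    (hb : ∀ i (h : i < (discover G l L).length), b i = (discover G l L)[i]) :
    EnumClasses A B n a b := by
  have hlen : L.length = n := by rw [← hn, ← hLA, List.toFinset_card_of_nodup hLn]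
  have hlenD : (discover G l L).length = n := by rw [length_discover hl hl', hLA, hnb, hB]
  have hmemA : ∀ v ∈ L, v ∈ A := fun v hv => by rwa [← hLA, List.mem_toFinset]
  have hmemB : ∀ v ∈ discover G l L, v ∈ B := fun v hv => by
    rwa [mem_discover hl', hLA, hnb] at hv
  refine ⟨h2, hn, hB, ?_, ?_, ?_, ?_⟩
  · intro i hi
    rw [ha i (by omega)]
    exact hmemA _ (List.getElem_mem _)
  · intro i hi
    rw [hb i (by omega)]
    exact hmemB _ (List.getElem_mem _)
  · intro i hi j hj h
    rw [ha i (by omega), ha j (by omega)] at h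
    exact (hLn.getElem_inj_iff).1 h
  · intro i hi j hj h
    rw [hb i (by omega), hb j (by omega)] at h
    exact ((nodup_discover hl L).getElem_inj_iff).1 h

/-- The neighbours of the first `i + 1` vertices form a prefix of the discovery order, of length at
most `i + 3`. This supplies the closure hypothesis of `EnumClasses.width_le`. -/
theorem SlowList.exists_eq_discover {L l : List V} (hL : SlowList G L) (hl : l.Nodup)
    (hl' : ∀ v, v ∈ l) {a b : ℕ → V} (ha : ∀ i (h : i < L.length), a i = L[i])
    (hb : ∀ i (h : i < (discover G l L).length), b i = (discover G l L)[i]) {i : ℕ}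
    (hi : i < L.length) {w : V} (hw : G.Adj (a i) w) : ∃ k < i + 3, w = b k := by
  have h1 : w ∈ discover G l (L.take (i + 1)) := by
    rw [mem_discover hl', mem_nbhd]
    refine ⟨a i, ?_, hw⟩
    rw [List.mem_toFinset, ha i hi, List.mem_take_iff_getElem]
    exact ⟨i, by omega, rfl⟩
  obtain ⟨k, hk, rfl⟩ := List.getElem_of_mem h1
  have h2 := hL.card_nbhd_le (i + 1)
  rw [← length_discover hl hl'] at h2
  have hpre := discover_take_prefix (G := G) l L (i + 1)
  refine ⟨k, by omega, ?_⟩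
  rw [hb k (hk.trans_le hpre.length_le)]
  exact hpre.getElem hk

theorem IsBrace.nbhd_left (hG : IsBrace G) (hAB : HasColourClasses G A B) : nbhd G A = B := by
  obtain ⟨f, hf⟩ := hG.exists_isMate
  refine subset_antisymm (hAB.nbhd_subset subset_rfl) fun w hw => ?_
  exact mem_nbhd.2 ⟨f w, hAB.symm.mem_right_of_adj (hf.1 w) hw, (hf.1 w).symm⟩

end Greedy

/-! ### Width of orderings and the equivalence for the ordering procedure -/

section Orderings

variable {V : Type*} [Fintype V] [DecidableEq V] {G : SimpleGraph V} [DecidableRel G.Adj]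
  {A B : Finset V}

theorem LinOrdering.exists_toList_eq {L : List V} (hL : L.Nodup) (hLA : L.toFinset = A) :
    ∃ ord : LinOrdering A, ord.toList = L := by
  have hlen : L.length = #A := by rw [← hLA, List.toFinset_card_of_nodup hL]
  have hmem : ∀ v, v ∈ A ↔ v ∈ L := fun v => by rw [← hLA, List.mem_toFinset]
  refine ⟨((Equiv.subtypeEquivRight hmem).trans (hL.getEquiv L).symm).trans (finCongr hlen), ?_⟩
  refine List.ext_getElem (by simp [toList, hlen]) fun i h1 h2 => ?_
  simp [toList]

theorem LinOrdering.getElem_toList (ord : LinOrdering A) (a : {a // a ∈ A})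
    (h : (ord a : ℕ) < ord.toList.length) : ord.toList[(ord a : ℕ)] = a := by
  simp [toList]

theorem LinOrdering.pred_eq (ord : LinOrdering A) (a : {a // a ∈ A}) :
    ord.pred a = (ord.toList.take (ord a + 1)).toFinset := by
  ext v
  simp only [pred, mem_map, mem_filter, mem_univ, true_and, Function.Embedding.subtype_apply,
    List.mem_toFinset, List.mem_take_iff_getElem]
  constructor
  · rintro ⟨x, hx, rfl⟩
    rw [Fin.le_def] at hx
    have := (ord x).2
    have := (ord a).2
    exact ⟨ord x, by simp [toList]; omega, ord.getElem_toList x _⟩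
  · rintro ⟨i, hi, rfl⟩
    simp only [toList, List.length_ofFn, lt_min_iff] at hi
    refine ⟨ord.symm ⟨i, hi.2⟩, ?_, by simp [toList]⟩
    rw [Equiv.apply_symm_apply, Fin.le_def]
    simp only
    omega

theorem LinOrdering.card_pred (ord : LinOrdering A) (a : {a // a ∈ A}) :
    #(ord.pred a) = (ord a : ℕ) + 1 := by
  rw [pred, card_map]
  have : (univ.filter fun a' => ord a' ≤ ord a) = (Iic (ord a)).map ord.symm.toEmbedding := by
    ext x
    simp
  rw [this, card_map, Fin.card_Iic]

/-- The upper bound is built into the list; it is attained at the first vertex, where the difference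
is 3 - 1. -/
theorem SlowList.width_eq_two {ord : LinOrdering A} (h : SlowList G ord.toList) :
    ord.width G = 2 := by
  have hpos : 0 < #A := by
    have := List.length_pos_iff.2 h.ne_nil
    simpa [LinOrdering.toList] using this
  have hterm : ∀ a, (#(ord.reach G a) : ℤ) - (#(ord.pred a) : ℤ) =
      (#(nbhd G (ord.toList.take (ord a + 1)).toFinset) : ℤ) - ((ord a : ℕ) + 1 : ℕ) := by
    intro a
    rw [ord.card_pred, LinOrdering.reach, ord.pred_eq]
  have : Nonempty {a // a ∈ A} := ⟨ord.symm ⟨0, hpos⟩⟩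
  refine le_antisymm (ciSup_le fun a => ?_) ?_
  · rw [hterm]
    have := h.card_nbhd_le (ord a + 1)
    omega
  · refine le_ciSup_of_le (Set.finite_range _).bddAbove (ord.symm ⟨0, hpos⟩) ?_
    rw [hterm, Equiv.apply_symm_apply]
    have := h.card_nbhd_one
    simp only [zero_add, this]
    norm_num

/-- The decomposition obtained from a complete list returned by the greedy procedure has width
two. -/
theorem IsBrace.pmw_eq_two_of_slowList (hG : IsBrace G) (hAB : HasColourClasses G A B)
    (h6 : 6 ≤ Fintype.card V) {L : List V} (hL : SlowList G L) (hLn : L.Nodup)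
    (hLA : L.toFinset = A) : pmw G = 2 := by
  have hcard := hAB.card_add
  have heq := hG.card_eq hAB
  obtain ⟨x⟩ : Nonempty V := Fintype.card_pos_iff.1 (by omega)
  have hlen : L.length = #A := by rw [← hLA, List.toFinset_card_of_nodup hLn]
  have ha : ∀ i (h : i < L.length), L.getD i x = L[i] := fun i h => by simp [h]
  have hb : ∀ i (h : i < (discover G univ.toList L).length),
      (discover G univ.toList L).getD i x = (discover G univ.toList L)[i] := fun i h => by simp [h]
  have hE := enumClasses_of_list (nodup_toList univ) (by simp) hLn hLA (by omega) rfl heq.symm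
    (hG.nbhd_left hAB) ha hb
  refine hG.pmw_eq_two hAB (by omega) (caterDecomposition (N := 2 * #A) (by omega)
    (even_two_mul _) (hE.equiv hAB rfl)) (hE.width_le hAB rfl _ _ fun i hi w hw => ?_)
  exact hL.exists_eq_discover (nodup_toList univ) (by simp) ha hb (by omega) hw

theorem IsBrace.greedyOrder_of_pmw_eq_two (hG : IsBrace G) (hAB : HasColourClasses G A B)
    (h6 : 6 ≤ Fintype.card V) {l : List V} (hl : l.Nodup) (hlA : l.toFinset = A) (h : pmw G = 2) :
    ∃ L, greedyOrder G l = some L := by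
  obtain ⟨m, D, hD⟩ := exists_width_eq_two h
  obtain ⟨a, ha⟩ := hG.exists_elim hAB h6 hD.le
  exact Option.ne_none_iff_exists'.1 (ha.greedyOrder_ne_none hl hlA)

theorem IsBrace.exists_ord_of_greedyOrder {l L : List V}
    (hl : l.Nodup) (hlA : l.toFinset = A) (h : greedyOrder G l = some L) :
    L.Nodup ∧ L.toFinset = A ∧ SlowList G L ∧
      ∃ ord : LinOrdering A, ord.toList = L ∧ ord.width G = 2 := by
  obtain ⟨h1, h2⟩ := greedyOrder_spec h
  have hLn : L.Nodup := h2.nodup_iff.2 hl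
  have hLA : L.toFinset = A := by rw [← hlA]; exact List.toFinset_eq_of_perm _ _ h2
  obtain ⟨ord, rfl⟩ := LinOrdering.exists_toList_eq hLn hLA
  exact ⟨hLn, hLA, h1, ord, rfl, h1.width_eq_two⟩

/-- Any list returned yields a caterpillar of width two, and a decomposition of width two prevents
failure. As returned lists always have width two, both equivalences follow. -/
theorem IsBrace.greedyOrder_iff (hG : IsBrace G) (hAB : HasColourClasses G A B)
    (h6 : 6 ≤ Fintype.card V) {l : List V} (hl : l.Nodup) (hlA : l.toFinset = A) :
    ((∃ ord : LinOrdering A, greedyOrder G l = some ord.toList ∧ ord.width G = 2) ↔ pmw G = 2) ∧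
      (greedyOrder G l = none ↔ pmw G ≠ 2) := by
  have h1 : ∀ L, greedyOrder G l = some L → pmw G = 2 := by
    intro L h
    obtain ⟨hLn, hLA, hL, -⟩ := exists_ord_of_greedyOrder hl hlA h
    exact hG.pmw_eq_two_of_slowList hAB h6 hL hLn hLA
  have h2 := hG.greedyOrder_of_pmw_eq_two hAB h6 hl hlA
  refine ⟨⟨fun ⟨ord, h, _⟩ => h1 _ h, fun h => ?_⟩, fun h h' => ?_, fun h => ?_⟩
  · obtain ⟨L, hL⟩ := h2 h
    obtain ⟨-, -, -, ord, rfl, hw⟩ := exists_ord_of_greedyOrder hl hlA hL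
    exact ⟨ord, hL, hw⟩
  · obtain ⟨L, hL⟩ := h2 h'
    rw [h] at hL
    simp at hL
  · by_contra hne
    obtain ⟨L, hL⟩ := Option.ne_none_iff_exists'.1 hne
    exact h (h1 L hL)

end Orderings

/-! ### Programs with bounded loops and their running time -/

namespace RAM

/-- Programs all of whose loops run through the numbers below the value of variable `6`. -/
inductive Prog where
  | skip
  | assign (x : ℕ) (e : Exp)
  | write (r : ℕ) (i e : Exp)
  | seq (c d : Prog)
  | ite (e : Exp) (c d : Prog)
  | each (x : ℕ) (c : Prog)

/-- Run `f` with the variable `x` set to `0, …, k - 1` in turn. -/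
def eachState (f : Store → Store) (x : ℕ) (s : Store) : ℕ → Store
  | 0 => s.setVar x 0
  | k + 1 => (f (eachState f x s k)).setVar x (k + 1)

namespace Prog

/-- The final store. -/
def den : Prog → Store → Store
  | skip, s => s
  | assign x e, s => s.setVar x (e.val s)
  | write r i e, s => s.setArr r (i.val s) (e.val s)
  | seq c d, s => d.den (c.den s)
  | ite e c d, s => if e.val s = 0 then d.den s else c.den s
  | each x c, s => eachState c.den x s (s.var 6)

def compile : Prog → Cmd
  | skip => .skip
  | assign x e => .assign x e
  | write r i e => .write r i e
  | seq c d => .seq c.compile d.compile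
  | ite e c d => .ite e c.compile d.compile
  | each x c => .seq (.assign x (.lit 0)) (.loop (.sub (.var 6) (.var x))
      (.seq c.compile (.assign x (.add (.var x) (.lit 1)))))

/-- The variables that may be changed. -/
def modVars : Prog → List ℕ
  | skip => []
  | assign x _ => [x]
  | write _ _ _ => []
  | seq c d => c.modVars ++ d.modVars
  | ite _ c d => c.modVars ++ d.modVars
  | each x c => x :: c.modVars

/-- The arrays that may be changed. -/
def modArrs : Prog → List ℕ
  | skip => []
  | assign _ _ => []
  | write r _ _ => [r]
  | seq c d => c.modArrs ++ d.modArrs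
  | ite _ c d => c.modArrs ++ d.modArrs
  | each _ c => c.modArrs

/-- Loop bounds and loop counters are not changed by loop bodies. -/
def wf : Prog → Bool
  | skip => true
  | assign _ _ => true
  | write _ _ _ => true
  | seq c d => c.wf && d.wf
  | ite _ c d => c.wf && d.wf
  | each x c => c.wf && !(x :: c.modVars).contains 6 && !c.modVars.contains x

/-- A bound for the number of steps in terms of the value of variable `6`. -/
noncomputable def costBound : Prog → Polynomial ℕ
  | skip => 1
  | assign _ e => Polynomial.C (e.cost + 1)
  | write _ i e => Polynomial.C (i.cost + e.cost + 1)
  | seq c d => c.costBound + d.costBound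
  | ite e c d => Polynomial.C (e.cost + 1) + c.costBound + d.costBound
  | each _ c => Polynomial.X * (c.costBound + Polynomial.C 8) + Polynomial.C 6

theorem den_var {p : Prog} {x : ℕ} (h : x ∉ p.modVars) (s : Store) :
    (p.den s).var x = s.var x := by
  induction p generalizing s with
  | skip => rfl
  | assign y e =>
    simp only [modVars, List.mem_singleton] at h
    simp [den, Store.setVar, h]
  | write => rfl
  | seq c d ihc ihd =>
    simp only [modVars, List.mem_append, not_or] at h
    rw [den, ihd h.2, ihc h.1]
  | ite e c d ihc ihd =>
    simp only [modVars, List.mem_append, not_or] at h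
    rw [den]
    split_ifs
    · exact ihd h.2 s
    · exact ihc h.1 s
  | each y c ih =>
    simp only [modVars, List.mem_cons, not_or] at h
    rw [den]
    generalize s.var 6 = k
    induction k with
    | zero => simp [eachState, Store.setVar, h.1]
    | succ k ihk => simpa [eachState, Store.setVar, h.1, ih h.2] using ihk

theorem den_arr {p : Prog} {r : ℕ} (h : r ∉ p.modArrs) (s : Store) :
    (p.den s).arr r = s.arr r := by
  induction p generalizing s with
  | skip => rfl
  | assign y e => rfl
  | write r' i e =>
    simp only [modArrs, List.mem_singleton] at h
    simp [den, Store.setArr, h]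
  | seq c d ihc ihd =>
    simp only [modArrs, List.mem_append, not_or] at h
    rw [den, ihd h.2, ihc h.1]
  | ite e c d ihc ihd =>
    simp only [modArrs, List.mem_append, not_or] at h
    rw [den]
    split_ifs
    · exact ihd h.2 s
    · exact ihc h.1 s
  | each y c ih =>
    simp only [modArrs] at h
    rw [den]
    generalize s.var 6 = k
    induction k with
    | zero => rfl
    | succ k ihk => simpa [eachState, Store.setVar, ih h] using ihk

theorem eachState_var {c : Prog} {x : ℕ} (s : Store) (k : ℕ) :
    (eachState c.den x s k).var x = k := by
  cases k <;> simp [eachState, Store.setVar]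

theorem eachState_var_of_ne {c : Prog} {x y : ℕ} (hxy : y ≠ x) (hy : y ∉ c.modVars) (s : Store)
    (k : ℕ) : (eachState c.den x s k).var y = s.var y := by
  induction k with
  | zero => simp [eachState, Store.setVar, hxy]
  | succ k ih => simpa [eachState, Store.setVar, hxy, den_var hy] using ih

/-- The compiled program runs in polynomial time. -/
theorem runs_compile {p : Prog} (hp : p.wf = true) (h6 : 6 ∉ p.modVars) (s : Store) :
    ∃ t, p.compile.Runs s (p.den s) t ∧ t ≤ p.costBound.eval (s.var 6) := by
  induction p generalizing s with
  | skip => exact ⟨1, .skip s, by simp [costBound]⟩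
  | assign x e => exact ⟨_, .assign x e s, by simp [costBound]⟩
  | write r i e => exact ⟨_, .write r i e s, by simp [costBound]⟩
  | seq c d ihc ihd =>
    simp only [wf, Bool.and_eq_true] at hp
    simp only [modVars, List.mem_append, not_or] at h6
    obtain ⟨t, h1, h2⟩ := ihc hp.1 h6.1 s
    obtain ⟨t', h3, h4⟩ := ihd hp.2 h6.2 (c.den s)
    rw [den_var h6.1] at h4
    exact ⟨_, .seq h1 h3, by simp only [costBound, Polynomial.eval_add]; omega⟩
  | ite e c d ihc ihd =>
    simp only [wf, Bool.and_eq_true] at hp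
    simp only [modVars, List.mem_append, not_or] at h6
    simp only [den]
    split_ifs with he
    · obtain ⟨t, h1, h2⟩ := ihd hp.2 h6.2 s
      exact ⟨_, .ite_neg he h1, by
        simp only [costBound, Polynomial.eval_add, Polynomial.eval_C]; omega⟩
    · obtain ⟨t, h1, h2⟩ := ihc hp.1 h6.1 s
      exact ⟨_, .ite_pos he h1, by
        simp only [costBound, Polynomial.eval_add, Polynomial.eval_C]; omega⟩
  | each x c ih =>
    simp only [wf, Bool.and_eq_true, Bool.not_eq_true', List.contains_eq_mem, decide_eq_false_iff_not]
      at hp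
    simp only [modVars, List.mem_cons, not_or] at h6 hp
    obtain ⟨⟨hc, -, -⟩, hx⟩ := hp
    -- Besides the body, each round costs 4 for the test and 4 for the increment. The failing test
    -- costs the final 4; with 2 for setting the counter to zero this gives the 6 in `costBound`.
    have key : ∀ d k, k + d = s.var 6 → ∃ t, (Cmd.loop (.sub (.var 6) (.var x))
        (.seq c.compile (.assign x (.add (.var x) (.lit 1))))).Runs (eachState c.den x s k)
          (eachState c.den x s (s.var 6)) t ∧ t ≤ d * (c.costBound.eval (s.var 6) + 8) + 4 := by
      intro d
      induction d with
      | zero =>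
        intro k hk
        obtain rfl : k = s.var 6 := by omega
        refine ⟨_, .loop_exit ?_, by simp [Exp.cost]⟩
        simp only [Exp.val, eachState_var, eachState_var_of_ne h6.1 h6.2]
        omega
      | succ d ihd =>
        intro k hk
        obtain ⟨t, h1, h2⟩ := ih hc h6.2 (eachState c.den x s k)
        rw [eachState_var_of_ne h6.1 h6.2] at h2
        obtain ⟨t', h3, h4⟩ := ihd (k + 1) (by omega)
        have h5 := Cmd.Runs.seq h1 (.assign x (.add (.var x) (.lit 1)) _)
        simp only [Exp.val, den_var hx, eachState_var] at h5
        refine ⟨_, .loop_step ?_ h5 h3, ?_⟩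
        · simp only [Exp.val, eachState_var, eachState_var_of_ne h6.1 h6.2]
          omega
        · simp only [Exp.cost]
          rw [Nat.succ_mul]
          omega
    obtain ⟨t, h1, h2⟩ := key (s.var 6) 0 (by omega)
    refine ⟨_, .seq (.assign x (.lit 0) s) h1, ?_⟩
    simp only [costBound, Polynomial.eval_add, Polynomial.eval_mul, Polynomial.eval_X,
      Polynomial.eval_C, Exp.cost]
    omega

/-- Invariants of loops. -/
theorem den_each {c : Prog} {x : ℕ} {s : Store} (I : ℕ → Store → Prop)
    (h0 : I 0 (s.setVar x 0))
    (hs : ∀ k < s.var 6, ∀ s', s'.var x = k → I k s' → I (k + 1) ((c.den s').setVar x (k + 1))) :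
    I (s.var 6) ((each x c).den s) := by
  rw [den]
  have : ∀ k ≤ s.var 6, I k (eachState c.den x s k) := by
    intro k
    induction k with
    | zero => exact fun _ => h0
    | succ k ih => exact fun hk => hs k hk _ (eachState_var s k) (ih (by omega))
  exact this _ le_rfl

end Prog

end RAM

/-! ### Stores that represent lists, and the rounds of the greedy extension -/

namespace RAM

theorem Store.var_setVar (s : Store) (x v y : ℕ) :
    (s.setVar x v).var y = if y = x then v else s.var y := by
  simp [Store.setVar, Function.update_apply]

theorem Store.arr_setVar (s : Store) (x v : ℕ) : (s.setVar x v).arr = s.arr := rfl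

theorem Store.var_setArr (s : Store) (r k v : ℕ) : (s.setArr r k v).var = s.var := rfl

theorem Store.arr_setArr (s : Store) (r k v r' : ℕ) :
    (s.setArr r k v).arr r' = if r' = r then Function.update (s.arr r) k v else s.arr r' := by
  simp [Store.setArr, Function.update_apply]

theorem Store.arr_setArr_apply (s : Store) (r k v r' k' : ℕ) :
    (s.setArr r k v).arr r' k' = if r' = r ∧ k' = k then v else s.arr r' k' := by
  rw [Store.arr_setArr]
  split_ifs with h1 h2 h2
  · rw [h2.2, Function.update_self]
  · rw [Function.update_of_ne (fun h => h2 ⟨h1, h⟩), h1]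
  · exact absurd h2.1 h1
  · rfl

section Lists

variable {N : ℕ}

/-- The first entries of the array `f` form the list `L`. -/
def Holds (f : ℕ → ℕ) (L : List (Fin N)) : Prop :=
  ∀ i (h : i < L.length), f i = (L[i] : ℕ)

theorem Holds.append_singleton {f : ℕ → ℕ} {L : List (Fin N)} (h : Holds f L) (v : Fin N) :
    Holds (Function.update f L.length v) (L ++ [v]) := by
  intro i hi
  rw [List.length_append, List.length_singleton] at hi
  rcases Nat.lt_succ_iff_lt_or_eq.1 hi with hi | rfl
  · rw [Function.update_of_ne hi.ne, List.getElem_append_left hi, h i hi]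
  · simp

theorem finRange_take_succ {k : ℕ} (hk : k < N) :
    (List.finRange N).take (k + 1) = (List.finRange N).take k ++ [⟨k, hk⟩] := by
  rw [List.take_succ_eq_append_getElem (by simpa using hk)]
  simp

theorem lt_of_mem_finRange_take {k : ℕ} {v : Fin N} (h : v ∈ (List.finRange N).take k) :
    (v : ℕ) < k := by
  obtain ⟨i, hi, rfl⟩ := List.mem_take_iff_getElem.1 h
  simpa using (lt_min_iff.1 hi).1

theorem card_filter_lt_succ (S : Finset (Fin N)) {k : ℕ} (hk : k < N) :
    #(S.filter fun v : Fin N => (v : ℕ) < k + 1) =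
      #(S.filter fun v : Fin N => (v : ℕ) < k) + if (⟨k, hk⟩ : Fin N) ∈ S then 1 else 0 := by
  split_ifs with h
  · rw [← card_insert_of_notMem (a := (⟨k, hk⟩ : Fin N)) (by simp)]
    congr 1
    ext v
    simp only [mem_filter, mem_insert, Fin.ext_iff]
    constructor
    · rintro ⟨h1, h2⟩
      rcases Nat.lt_succ_iff_lt_or_eq.1 h2 with h2 | h2
      · exact Or.inr ⟨h1, h2⟩
      · exact Or.inl h2
    · rintro (h1 | ⟨h1, h2⟩)
      · have : v = ⟨k, hk⟩ := Fin.ext h1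
        exact ⟨this ▸ h, by omega⟩
      · exact ⟨h1, by omega⟩
  · rw [add_zero]
    congr 1
    ext v
    simp only [mem_filter]
    refine and_congr_right fun hv => ⟨fun h2 => ?_, fun h2 => by omega⟩
    rcases Nat.lt_succ_iff_lt_or_eq.1 h2 with h2 | h2
    · exact h2
    · have : v = ⟨k, hk⟩ := Fin.ext h2
      exact absurd (this ▸ hv) h

end Lists

open Prog

section Spec

variable {N : ℕ} (G : SimpleGraph (Fin N)) [DecidableRel G.Adj] (A : Finset (Fin N))

/-- The store holds the graph, with the beginnings of the rows of the adjacency matrix in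
array `9`. -/
structure Env (s : Store) : Prop where
  bound : s.var 6 = N
  adj : ∀ i j : Fin N, s.arr 0 (s.arr 9 i + j) = if G.Adj i j then 1 else 0
  mem : ∀ i : Fin N, s.arr 1 i = if i ∈ A then 1 else 0

/-- The store holds the list `P` of vertices chosen so far and the neighbours discovered. -/
structure Rep (s : Store) (P : List (Fin N)) : Prop where
  len : s.var 24 = P.length
  list : Holds (s.arr 5) P
  used : ∀ v : Fin N, s.arr 6 v = if v ∈ P then 1 else 0
  reach : ∀ v : Fin N, s.arr 7 v = if v ∈ discover G (List.finRange N) P then 1 else 0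
  dlen : s.var 25 = (discover G (List.finRange N) P).length
  dlist : Holds (s.arr 8) (discover G (List.finRange N) P)

variable {G A} {s : Store} {P : List (Fin N)}

theorem Env.setVar (h : Env G A s) {x : ℕ} (hx : 6 ≠ x) (v : ℕ) : Env G A (s.setVar x v) where
  bound := by rw [Store.var_setVar, if_neg hx, h.bound]
  adj := h.adj
  mem := h.mem

theorem Env.den (h : Env G A s) {p : Prog} (h6 : 6 ∉ p.modVars) (h0 : 0 ∉ p.modArrs)
    (h1 : 1 ∉ p.modArrs) (h9 : 9 ∉ p.modArrs) : Env G A (p.den s) where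
  bound := by rw [den_var h6, h.bound]
  adj := by rw [den_arr h0, den_arr h9]; exact h.adj
  mem := by rw [den_arr h1]; exact h.mem

theorem Rep.of_eq (h : Rep G s P) {s' : Store} (h24 : s'.var 24 = s.var 24)
    (h25 : s'.var 25 = s.var 25) (h5 : s'.arr 5 = s.arr 5) (h6 : s'.arr 6 = s.arr 6)
    (h7 : s'.arr 7 = s.arr 7) (h8 : s'.arr 8 = s.arr 8) : Rep G s' P where
  len := by rw [h24, h.len]
  list := by rw [h5]; exact h.list
  used := by rw [h6]; exact h.used
  reach := by rw [h7]; exact h.reach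
  dlen := by rw [h25, h.dlen]
  dlist := by rw [h8]; exact h.dlist

theorem Rep.setVar (h : Rep G s P) {x : ℕ} (h24 : 24 ≠ x) (h25 : 25 ≠ x) (v : ℕ) :
    Rep G (s.setVar x v) P :=
  h.of_eq (by rw [Store.var_setVar, if_neg h24]) (by rw [Store.var_setVar, if_neg h25])
    rfl rfl rfl rfl

theorem Rep.den (h : Rep G s P) {p : Prog} (h24 : 24 ∉ p.modVars) (h25 : 25 ∉ p.modVars)
    (h5 : 5 ∉ p.modArrs) (h6 : 6 ∉ p.modArrs) (h7 : 7 ∉ p.modArrs) (h8 : 8 ∉ p.modArrs) :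
    Rep G (p.den s) P :=
  h.of_eq (den_var h24 s) (den_var h25 s) (den_arr h5 s) (den_arr h6 s) (den_arr h7 s)
    (den_arr h8 s)

/-- One if variable `11` is a neighbour of variable `27` that has not been discovered. -/
def newExp : Exp := .sub (.get 0 (.add (.get 9 (.var 27)) (.var 11))) (.get 7 (.var 11))

theorem newExp_val (hE : Env G A s) {v w : Fin N} (hv : s.var 27 = v) (hw : s.var 11 = w)
    {p : Prop} [Decidable p] (h7 : s.arr 7 w = if p then 1 else 0) :
    newExp.val s = if G.Adj v w ∧ ¬ p then 1 else 0 := by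
  simp only [newExp, Exp.val, hv, hw, hE.adj, h7]
  split_ifs <;> simp_all

/-- Count the new neighbours of variable `27`. -/
def countProg : Prog :=
  .seq (.assign 23 (.lit 0)) (.each 11 (.assign 23 (.add (.var 23) newExp)))

theorem countProg_spec (hE : Env G A s) {R : Finset (Fin N)}
    (hR : ∀ v : Fin N, s.arr 7 v = if v ∈ R then 1 else 0) {v : Fin N} (hv : s.var 27 = v) :
    (countProg.den s).var 23 = #(G.neighborFinset v \ R) := by
  have := den_each (c := .assign 23 (.add (.var 23) newExp)) (x := 11) (s := s.setVar 23 0)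
    (fun k s' => Env G A s' ∧ (∀ v : Fin N, s'.arr 7 v = if v ∈ R then 1 else 0) ∧
      s'.var 27 = v ∧ s'.var 23 = #((G.neighborFinset v \ R).filter fun w : Fin N => (w : ℕ) < k))
    ⟨(hE.setVar (by decide) _).setVar (by decide) _, hR, by simpa [Store.var_setVar] using hv,
      by simp [Store.var_setVar]⟩ ?_
  · simp only [Store.var_setVar, hE.bound] at this
    rw [countProg, den]
    change Store.var (Prog.den _ (s.setVar 23 0)) 23 = _
    rw [this.2.2.2]
    congr 1
    ext w
    simp
  · rintro k hk s' h11 ⟨h1, h2, h3, h4⟩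
    have hk' : k < N := by simpa [Store.var_setVar, hE.bound] using hk
    refine ⟨?_, h2, by simpa [den, Store.var_setVar] using h3, ?_⟩
    · exact (h1.den (p := .assign 23 (.add (.var 23) newExp)) (by decide) (by decide) (by decide)
        (by decide)).setVar (by decide) _
    · simp only [den, Store.var_setVar, Exp.val]
      rw [newExp_val h1 h3 (w := ⟨k, hk'⟩) h11 (h2 _), card_filter_lt_succ _ hk', ← h4]
      simp

/-- Append variable `27` to the list of chosen vertices. -/
def appendProg : Prog :=
  .seq (.write 5 (.var 24) (.var 27)) <|
  .seq (.write 6 (.var 27) (.lit 1)) <|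
  .seq (.assign 24 (.add (.var 24) (.lit 1))) <|
  .each 11 <| .ite newExp
    (.seq (.write 7 (.var 11) (.lit 1))
      (.seq (.write 8 (.var 25) (.var 11)) (.assign 25 (.add (.var 25) (.lit 1))))) .skip

theorem appendProg_spec (hE : Env G A s) (hP : Rep G s P) {v : Fin N} (hv : s.var 27 = v) :
    Rep G (appendProg.den s) (P ++ [v]) := by
  obtain ⟨c, hc⟩ : ∃ c : Prog, c = .ite newExp (.seq (.write 7 (.var 11) (.lit 1))
      (.seq (.write 8 (.var 25) (.var 11)) (.assign 25 (.add (.var 25) (.lit 1))))) .skip :=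
    ⟨_, rfl⟩
  obtain ⟨s₁, hs₁⟩ : ∃ s₁, s₁ = ((s.setArr 5 P.length v).setArr 6 v 1).setVar 24 (P.length + 1) :=
    ⟨_, rfl⟩
  have hden : appendProg.den s = (Prog.each 11 c).den s₁ := by
    rw [hs₁, hc]
    simp only [appendProg, den, Exp.val, Store.var_setArr, hv, hP.len]
  have hE₁ : Env G A s₁ := by
    rw [hs₁]
    exact ⟨by simpa [Store.var_setVar, Store.var_setArr] using hE.bound,
      by simpa [Store.arr_setVar, Store.arr_setArr] using hE.adj,
      by simpa [Store.arr_setVar, Store.arr_setArr] using hE.mem⟩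
  obtain ⟨D, hD⟩ : ∃ D, D = discover G (List.finRange N) P := ⟨_, rfl⟩
  -- `F k` is the discovery list once the vertices below `k` have been examined as neighbours of
  -- `v`; it is the invariant of the loop.
  obtain ⟨F, hF⟩ : ∃ F : ℕ → List (Fin N), ∀ k, F k =
      D ++ ((List.finRange N).take k).filter fun w => G.Adj v w ∧ w ∉ D := ⟨_, fun _ => rfl⟩
  have hF0 : F 0 = D := by simp [hF]
  have hFN : F N = discover G (List.finRange N) (P ++ [v]) := by
    rw [hF, discover_append_singleton, List.take_of_length_le (by simp), hD]
  have hFk : ∀ {k : ℕ} (hk : k < N), F (k + 1) =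
      F k ++ if G.Adj v ⟨k, hk⟩ ∧ ¬ ⟨k, hk⟩ ∈ F k then [⟨k, hk⟩] else [] := by
    intro k hk
    -- The program tests novelty against the current list, the definition of `discover` against the
    -- list before the round. They agree on `k`, as only smaller vertices were added in this round.
    have hmem : (⟨k, hk⟩ : Fin N) ∈ F k ↔ ⟨k, hk⟩ ∈ D := by
      rw [hF, List.mem_append, List.mem_filter]
      refine ⟨fun h => h.resolve_right fun h => ?_, Or.inl⟩
      exact lt_irrefl _ (lt_of_mem_finRange_take h.1)
    rw [hF (k + 1), hF k, finRange_take_succ hk, List.filter_append, ← List.append_assoc, ← hF k]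
    simp only [hmem]
    congr 1
    simp [List.filter_cons]
  have hv24 : s₁.var 24 = P.length + 1 := by rw [hs₁]; simp [Store.var_setVar]
  have h5 : s₁.arr 5 = Function.update (s.arr 5) P.length v := by
    rw [hs₁]; simp [Store.arr_setVar, Store.arr_setArr]
  have h6 : s₁.arr 6 = Function.update (s.arr 6) v 1 := by
    rw [hs₁]; simp [Store.arr_setVar, Store.arr_setArr]
  have := den_each (c := c) (x := 11) (s := s₁)
    (fun k s' => Env G A s' ∧ s'.var 27 = v ∧ s'.var 25 = (F k).length ∧ Holds (s'.arr 8) (F k) ∧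
      ∀ w : Fin N, s'.arr 7 w = if w ∈ F k then 1 else 0)
    ⟨hE₁.setVar (by decide) _, by rw [hs₁]; simpa [Store.var_setVar, Store.var_setArr] using hv,
      ?_, ?_, ?_⟩ ?_
  · rw [hE₁.bound, hFN] at this
    obtain ⟨-, -, h1, h2, h3⟩ := this
    rw [hden]
    refine ⟨?_, ?_, ?_, h3, h1, h2⟩
    · rw [den_var (by rw [hc]; decide), hv24, List.length_append, List.length_singleton]
    · rw [den_arr (by rw [hc]; decide), h5]
      exact hP.list.append_singleton v
    · intro w
      rw [den_arr (by rw [hc]; decide), h6, Function.update_apply]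
      by_cases hwv : w = v
      · simp [hwv]
      · rw [if_neg (fun h => hwv (Fin.ext h)), hP.used]
        simp [hwv]
  · rw [hF0, hD, ← hP.dlen, hs₁]
    simp [Store.var_setVar, Store.var_setArr]
  · rw [hF0, hD]
    have : (s₁.setVar 11 0).arr 8 = s.arr 8 := by
      rw [hs₁]; simp [Store.arr_setVar, Store.arr_setArr]
    rw [this]
    exact hP.dlist
  · rw [hF0, hD]
    have : (s₁.setVar 11 0).arr 7 = s.arr 7 := by
      rw [hs₁]; simp [Store.arr_setVar, Store.arr_setArr]
    rw [this]
    exact hP.reach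
  · rintro k hk s' h11 ⟨h1, h2, h3, h4, h5⟩
    rw [hE₁.bound] at hk
    refine ⟨(h1.den (by rw [hc]; decide) (by rw [hc]; decide) (by rw [hc]; decide)
      (by rw [hc]; decide)).setVar (by decide) _, ?_, ?_⟩
    · rw [Store.var_setVar, if_neg (by decide), den_var (by rw [hc]; decide), h2]
    · have hval := newExp_val h1 h2 (w := ⟨k, hk⟩) h11 (h5 _)
      rw [hFk hk, hc, den, hval]
      by_cases hnew : G.Adj v ⟨k, hk⟩ ∧ ¬ ⟨k, hk⟩ ∈ F k
      · simp only [if_pos hnew, if_neg one_ne_zero]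
        simp only [den, Exp.val, Store.var_setVar, Store.var_setArr, Store.arr_setVar,
          Store.arr_setArr, h11, h3]
        refine ⟨by simp, ?_, ?_⟩
        · simpa using h4.append_singleton ⟨k, hk⟩
        · intro w
          have := h5 w
          by_cases hw : w = ⟨k, hk⟩
          · simp [hw]
          · have hw' : (w : ℕ) ≠ k := fun h => hw (Fin.ext h)
            simp [hw, hw', this]
      · simp only [if_neg hnew, if_pos, List.append_nil, den, Store.var_setVar, Store.arr_setVar]
        exact ⟨by simpa using h3, h4, h5⟩

/-- Forget the list of chosen vertices. -/
def resetProg : Prog :=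
  .seq (.assign 24 (.lit 0)) <| .seq (.assign 25 (.lit 0)) <|
  .each 11 <| .seq (.write 6 (.var 11) (.lit 0)) (.write 7 (.var 11) (.lit 0))

theorem resetProg_spec (hE : Env G A s) : Rep G (resetProg.den s) [] := by
  have := den_each (c := .seq (.write 6 (.var 11) (.lit 0)) (.write 7 (.var 11) (.lit 0)))
    (x := 11) (s := (s.setVar 24 0).setVar 25 0)
    (fun k s' => ∀ v < k, s'.arr 6 v = 0 ∧ s'.arr 7 v = 0) (by simp) ?_
  · have hb : ((s.setVar 24 0).setVar 25 0).var 6 = N := by simp [Store.var_setVar, hE.bound]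
    rw [hb] at this
    have hden : resetProg.den s = (Prog.each 11 (.seq (.write 6 (.var 11) (.lit 0))
      (.write 7 (.var 11) (.lit 0)))).den ((s.setVar 24 0).setVar 25 0) := rfl
    rw [hden]
    refine ⟨?_, ?_, ?_, ?_, ?_, ?_⟩
    · rw [den_var (by decide)]; simp [Store.var_setVar]
    · intro i hi; simp at hi
    · intro v; simpa using (this v v.2).1
    · intro v; simpa [discover] using (this v v.2).2
    · rw [den_var (by decide)]; simp [Store.var_setVar, discover]
    · intro i hi; simp [discover] at hi
  · intro k _ s' h11 h v hv
    simp only [den, Exp.val, Store.arr_setVar, Store.arr_setArr, Store.var_setArr, h11]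
    have := h v
    by_cases hvk : v = k
    · simp [hvk]
    · simpa [hvk] using this (by omega)

/-- Append the first vertex with at most one new neighbour. -/
def stepProg : Prog :=
  .seq (.assign 26 (.lit 0)) <| .each 13 <| .ite (.var 26) .skip <|
    .ite (.sub (.get 1 (.var 13)) (.get 6 (.var 13)))
      (.seq (.assign 27 (.var 13)) <| .seq countProg <|
        .ite (.sub (.var 23) (.lit 1)) .skip (.seq appendProg (.assign 26 (.lit 1)))) .skip

variable (G A) in
/-- The first vertex that the greedy procedure can add to `P`. -/
def nextVertex (P : List (Fin N)) (l : List (Fin N)) : Option (Fin N) :=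
  l.find? fun a => a ∈ A ∧ a ∉ P ∧ #(G.neighborFinset a \ nbhd G P.toFinset) ≤ 1

variable (G A) in
/-- One round of the greedy procedure. -/
def stepList (P : List (Fin N)) : List (Fin N) :=
  P ++ (nextVertex G A P (List.finRange N)).toList

theorem stepProg_spec (hE : Env G A s) (hP : Rep G s P) :
    Rep G (stepProg.den s) (stepList G A P) := by
  obtain ⟨c, hc⟩ : ∃ c : Prog, c = .ite (.var 26) .skip (
    .ite (.sub (.get 1 (.var 13)) (.get 6 (.var 13)))
      (.seq (.assign 27 (.var 13)) <| .seq countProg <|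
        .ite (.sub (.var 23) (.lit 1)) .skip (.seq appendProg (.assign 26 (.lit 1)))) .skip) :=
    ⟨_, rfl⟩
  have hden : stepProg.den s = (Prog.each 13 c).den (s.setVar 26 0) := by rw [hc]; rfl
  have hE₁ := hE.setVar (x := 26) (by decide) 0
  have := den_each (c := c) (x := 13) (s := s.setVar 26 0)
    -- Variable `26` is 0 or 1 and records whether a vertex has already been appended; after that
    -- the rest of the loop is idle.
    (fun k s' => Env G A s' ∧ Rep G s' (P ++ (nextVertex G A P ((List.finRange N).take k)).toList) ∧
      s'.var 26 = (nextVertex G A P ((List.finRange N).take k)).toList.length)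
    ⟨hE₁.setVar (by decide) _, ?_, ?_⟩ ?_
  · rw [hE₁.bound, List.take_of_length_le (by simp)] at this
    rw [hden]
    exact this.2.1
  · simpa [nextVertex] using (hP.setVar (by decide) (by decide) 0).setVar (by decide) (by decide) 0
  · simp [nextVertex, Store.var_setVar]
  · rintro k hk s' h13 ⟨h1, h2, h3⟩
    rw [hE₁.bound] at hk
    have hE' : Env G A ((c.den s').setVar 13 (k + 1)) :=
      (h1.den (by rw [hc]; decide) (by rw [hc]; decide) (by rw [hc]; decide)
        (by rw [hc]; decide)).setVar (by decide) _
    have hnext : nextVertex G A P ((List.finRange N).take (k + 1)) =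
        (nextVertex G A P ((List.finRange N).take k)).or (nextVertex G A P [⟨k, hk⟩]) := by
      rw [nextVertex, finRange_take_succ hk, List.find?_append]
      rfl
    refine ⟨hE', ?_⟩
    cases hn : nextVertex G A P ((List.finRange N).take k) with
    | some a =>
      rw [hn] at h2 h3 hnext
      have : c.den s' = s' := by
        rw [hc, den, if_neg (by rw [Exp.val, h3]; simp), den]
      rw [hnext, this]
      exact ⟨h2.setVar (by decide) (by decide) _, by simpa [Store.var_setVar] using h3⟩
    | none =>
      rw [hn] at h2 h3 hnext
      simp only [Option.toList_none, List.append_nil, List.length_nil] at h2 h3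
      have h4 : (Exp.sub (.get 1 (.var 13)) (.get 6 (.var 13))).val s' =
          if (⟨k, hk⟩ : Fin N) ∈ A ∧ ⟨k, hk⟩ ∉ P then 1 else 0 := by
        have e1 := h1.mem ⟨k, hk⟩
        have e2 := h2.used ⟨k, hk⟩
        simp only [Exp.val, h13, e1, e2]
        split_ifs <;> simp_all
      have hstep : (c.den s') = if (⟨k, hk⟩ : Fin N) ∈ A ∧ ⟨k, hk⟩ ∉ P then
          (if (countProg.den (s'.setVar 27 k)).var 23 ≤ 1 then
            (appendProg.den (countProg.den (s'.setVar 27 k))).setVar 26 1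
          else countProg.den (s'.setVar 27 k)) else s' := by
        rw [hc, den, if_pos (by rw [Exp.val, h3]), den, h4]
        by_cases hk1 : (⟨k, hk⟩ : Fin N) ∈ A ∧ ⟨k, hk⟩ ∉ P
        · rw [if_pos hk1, if_pos hk1, if_neg one_ne_zero]
          simp only [den, Exp.val, h13, Nat.sub_eq_zero_iff_le]
        · rw [if_neg hk1, if_neg hk1, if_pos rfl, den]
      have h5 : Env G A (s'.setVar 27 k) := h1.setVar (by decide) _
      have h6 : Rep G (s'.setVar 27 k) P := h2.setVar (by decide) (by decide) _
      have h7 := countProg_spec h5 (R := nbhd G P.toFinset) (v := ⟨k, hk⟩)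
        (fun v => by rw [h6.reach]; simp only [mem_discover (List.mem_finRange)])
        (by simp [Store.var_setVar])
      have h8 : Env G A (countProg.den (s'.setVar 27 k)) :=
        h5.den (by decide) (by decide) (by decide) (by decide)
      have h9 : Rep G (countProg.den (s'.setVar 27 k)) P :=
        h6.den (by decide) (by decide) (by decide) (by decide) (by decide) (by decide)
      have h10 : (countProg.den (s'.setVar 27 k)).var 27 = (⟨k, hk⟩ : Fin N) := by
        rw [den_var (by decide)]; simp [Store.var_setVar]
      have h11 : (countProg.den (s'.setVar 27 k)).var 26 = 0 := by
        rw [den_var (by decide)]; simpa [Store.var_setVar] using h3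
      have hnext' : nextVertex G A P [⟨k, hk⟩] = if (⟨k, hk⟩ : Fin N) ∈ A ∧ ⟨k, hk⟩ ∉ P ∧
          #(G.neighborFinset ⟨k, hk⟩ \ nbhd G P.toFinset) ≤ 1 then some ⟨k, hk⟩ else none := by
        have key : ∀ (p : Fin N → Bool) x, [x].find? p = if p x then some x else none := by
          intro p x
          rw [List.find?_cons]
          cases p x <;> rfl
        simp only [nextVertex, key, decide_eq_true_eq]
      rw [hnext, hnext', Option.none_or, hstep, h7]
      by_cases hk1 : (⟨k, hk⟩ : Fin N) ∈ A ∧ ⟨k, hk⟩ ∉ P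
      · by_cases hk2 : #(G.neighborFinset ⟨k, hk⟩ \ nbhd G P.toFinset) ≤ 1
        · rw [if_pos hk1, if_pos hk2, if_pos ⟨hk1.1, hk1.2, hk2⟩]
          refine ⟨?_, by simp [Store.var_setVar]⟩
          exact ((appendProg_spec h8 h9 h10).setVar (by decide) (by decide) _).setVar (by decide)
            (by decide) _
        · rw [if_pos hk1, if_neg hk2, if_neg (fun h => hk2 h.2.2)]
          refine ⟨?_, by simpa [Store.var_setVar] using h11⟩
          simpa using h9.setVar (x := 13) (by decide) (by decide) _
      · rw [if_neg hk1, if_neg (fun h => hk1 ⟨h.1, h.2.1⟩)]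
        refine ⟨?_, by simpa [Store.var_setVar] using h3⟩
        simpa using h2.setVar (x := 13) (by decide) (by decide) _

/-- Extend the list of chosen vertices as far as possible. -/
def extendProg : Prog := .each 12 stepProg

theorem extendProg_spec (hE : Env G A s) (hP : Rep G s P) :
    Rep G (extendProg.den s) ((stepList G A)^[N] P) := by
  have := den_each (c := stepProg) (x := 12) (s := s)
    (fun k s' => Env G A s' ∧ Rep G s' ((stepList G A)^[k] P))
    ⟨hE.setVar (by decide) _, hP.setVar (by decide) (by decide) _⟩ ?_
  · rw [hE.bound] at this
    exact this.2
  · rintro k - s' - ⟨h1, h2⟩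
    rw [Function.iterate_succ_apply']
    exact ⟨(h1.den (by decide) (by decide) (by decide) (by decide)).setVar (by decide) _,
      (stepProg_spec h1 h2).setVar (by decide) (by decide) _⟩

/-- A round that finds no vertex leaves the list fixed, so surplus rounds are harmless and a fixed
number of them replaces the test for termination. Failure is then recognised by the list being too
short. -/
theorem stepList_iterate (hP : P.Nodup) (hPA : P.toFinset ⊆ A) {k M : ℕ}
    (hk : P.length + k = #A) (hM : k ≤ M) :
    greedyExtend G k P ((List.finRange N).filter fun v => v ∈ A ∧ v ∉ P) =
      if ((stepList G A)^[M] P).length = #A then some ((stepList G A)^[M] P) else none := by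
  have hfix : ∀ P : List (Fin N), nextVertex G A P (List.finRange N) = none →
      ∀ M, (stepList G A)^[M] P = P := by
    intro P h M
    exact Function.iterate_fixed (by rw [stepList, h]; simp) M
  induction k generalizing P M with
  | zero =>
    have hPA' : P.toFinset = A := eq_of_subset_of_card_le hPA
      (by rw [List.toFinset_card_of_nodup hP]; omega)
    rw [hfix P _ M, if_pos (by omega), greedyExtend]
    rw [nextVertex, List.find?_eq_none]
    intro v _
    rw [← hPA']
    simp
    tauto
  | succ k ih =>
    obtain ⟨M, rfl⟩ : ∃ M', M = M' + 1 := ⟨M - 1, by omega⟩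
    have hfind : ((List.finRange N).filter fun v => v ∈ A ∧ v ∉ P).find?
        (fun a' => #(G.neighborFinset a' \ nbhd G P.toFinset) ≤ 1) =
        nextVertex G A P (List.finRange N) := by
      rw [List.find?_filter, nextVertex]
      congr 1
      ext v
      simp [and_assoc]
    rw [greedyExtend, hfind]
    cases hn : nextVertex G A P (List.finRange N) with
    | none => rw [hfix P hn, if_neg (by omega)]
    | some a =>
      have ha := List.find?_some hn
      simp only [decide_eq_true_eq] at ha
      have hstep : stepList G A P = P ++ [a] := by rw [stepList, hn]; rfl
      simp only
      rw [Function.iterate_succ_apply, hstep]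
      rw [← ih (P := P ++ [a]) (M := M) ?_ ?_ ?_ (by omega)]
      · congr 1
        rw [((List.nodup_finRange N).filter _).erase_eq_filter, List.filter_filter]
        congr 1
        ext v
        rw [Bool.eq_iff_iff]
        simp
        tauto
      · rw [List.nodup_append']
        exact ⟨hP, List.nodup_singleton a, by simpa using ha.2.1⟩
      · intro v hv
        rw [List.mem_toFinset, List.mem_append, List.mem_singleton] at hv
        rcases hv with hv | rfl
        · exact hPA (List.mem_toFinset.2 hv)
        · exact ha.1
      · simp
        omega

end Spec

end RAM

/-! ### The program for the ordering procedure -/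

namespace RAM

open Prog

section Greedy

variable {N : ℕ} {G : SimpleGraph (Fin N)} [DecidableRel G.Adj] {A : Finset (Fin N)}
  {s : Store}

/-- The greedy ordering procedure. -/
def greedyProg : Prog :=
  .seq (.assign 22 (.lit 0)) <| .each 10 <| .ite (.var 22) .skip <|
    .ite (.get 1 (.var 10))
      (.seq resetProg <| .seq (.assign 27 (.var 10)) <| .seq countProg <|
        .ite (.add (.sub (.var 23) (.lit 3)) (.sub (.lit 3) (.var 23))) .skip <|
          .seq appendProg <| .seq extendProg <|
            .ite (.sub (.var 21) (.var 24)) .skip (.assign 22 (.lit 1))) .skip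

variable (G A) in
/-- The outcome of the greedy procedure when started with the vertex `a`. -/
def greedyFrom (a : Fin N) : Option (List (Fin N)) :=
  if a ∈ A ∧ #(G.neighborFinset a) = 3 then
    if ((stepList G A)^[N] [a]).length = #A then some ((stepList G A)^[N] [a]) else none
  else none

theorem findSome?_filter {α β : Type*} (l : List α) (p : α → Bool) (f : α → Option β) :
    (l.filter p).findSome? f = l.findSome? fun a => if p a then f a else none := by
  induction l with
  | nil => rfl
  | cons a l ih =>
    rw [List.filter_cons, List.findSome?_cons]
    by_cases h : p a
    · simp only [h, if_true, List.findSome?_cons, ih]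
    · rw [if_neg h, if_neg h, ih]

theorem greedyOrder_eq : greedyOrder G ((List.finRange N).filter (· ∈ A)) =
    (List.finRange N).findSome? (greedyFrom G A) := by
  have hnd : ((List.finRange N).filter (· ∈ A)).Nodup := (List.nodup_finRange N).filter _
  have hlen : ((List.finRange N).filter (· ∈ A)).length = #A := by
    rw [← List.toFinset_card_of_nodup hnd]
    congr 1
    ext
    simp
  have hAN : #A ≤ N := by simpa using card_le_univ A
  rw [greedyOrder, findSome?_filter, hlen]
  congr 1
  ext1 a
  by_cases ha : a ∈ A
  swap
  · rw [if_neg (by simpa using ha), greedyFrom, if_neg (fun h => ha h.1)]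
  rw [if_pos (by simpa using ha), greedyFrom]
  by_cases h3 : #(G.neighborFinset a) = 3
  swap
  · rw [if_neg h3, if_neg (fun h => h3 h.2)]
  rw [if_pos h3, if_pos ⟨ha, h3⟩, ← stepList_iterate (List.nodup_singleton a) (by simpa using ha)
    (k := #A - 1) (by rw [List.length_singleton]; have := card_pos.2 ⟨a, ha⟩; omega) (by omega)]
  congr 1
  rw [hnd.erase_eq_filter, List.filter_filter]
  congr 1
  ext v
  rw [Bool.eq_iff_iff]
  simp
  tauto

/-- The program can only test that the list is at least as long as the class; this bound turns the
test into equality. -/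
theorem length_iterate_stepList_le (a : Fin N) (ha : a ∈ A) (M : ℕ) :
    ((stepList G A)^[M] [a]).length ≤ #A := by
  have key : ((stepList G A)^[M] [a]).Nodup ∧ ((stepList G A)^[M] [a]).toFinset ⊆ A := by
    induction M with
    | zero => simpa using ha
    | succ M ih =>
      rw [Function.iterate_succ_apply', stepList]
      cases hn : nextVertex G A ((stepList G A)^[M] [a]) (List.finRange N) with
      | none => simpa using ih
      | some b =>
        have hb := List.find?_some hn
        simp only [decide_eq_true_eq] at hb
        constructor
        · rw [Option.toList_some, List.nodup_append']
          exact ⟨ih.1, List.nodup_singleton b, by simpa using hb.2.1⟩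
        · intro v hv
          rw [Option.toList_some, List.mem_toFinset, List.mem_append, List.mem_singleton] at hv
          rcases hv with hv | rfl
          · exact ih.2 (List.mem_toFinset.2 hv)
          · exact hb.1
  rw [← List.toFinset_card_of_nodup key.1]
  exact card_le_card key.2

theorem greedyProg_spec (hE : Env G A s) (hA : s.var 21 = #A) :
    ((greedyProg.den s).var 22 = 0 ∧ greedyOrder G ((List.finRange N).filter (· ∈ A)) = none) ∨
    ∃ L, (greedyProg.den s).var 22 = 1 ∧ Rep G (greedyProg.den s) L ∧
      greedyOrder G ((List.finRange N).filter (· ∈ A)) = some L := by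
  obtain ⟨d, hd⟩ : ∃ d : Prog, d = .seq appendProg (.seq extendProg
      (.ite (.sub (.var 21) (.var 24)) .skip (.assign 22 (.lit 1)))) := ⟨_, rfl⟩
  obtain ⟨c, hc⟩ : ∃ c : Prog, c = .ite (.var 22) .skip (
    .ite (.get 1 (.var 10))
      (.seq resetProg <| .seq (.assign 27 (.var 10)) <| .seq countProg <|
        .ite (.add (.sub (.var 23) (.lit 3)) (.sub (.lit 3) (.var 23))) .skip d) .skip) :=
    ⟨_, rfl⟩
  have hden : greedyProg.den s = (Prog.each 10 c).den (s.setVar 22 0) := by rw [hc, hd]; rfl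
  have hE₁ := hE.setVar (x := 22) (by decide) 0
  rw [greedyOrder_eq]
  have := den_each (c := c) (x := 10) (s := s.setVar 22 0)
    (fun k s' => Env G A s' ∧ s'.var 21 = #A ∧
      ((s'.var 22 = 0 ∧ ((List.finRange N).take k).findSome? (greedyFrom G A) = none) ∨
      ∃ L, s'.var 22 = 1 ∧ Rep G s' L ∧
        ((List.finRange N).take k).findSome? (greedyFrom G A) = some L))
    ⟨hE₁.setVar (by decide) _, by simpa [Store.var_setVar] using hA, ?_⟩ ?_
  · rw [hE₁.bound, List.take_of_length_le (by simp)] at this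
    rw [hden]
    exact this.2.2
  · left
    simp [Store.var_setVar]
  · rintro k hk s' h10 ⟨h1, h2, h3⟩
    rw [hE₁.bound] at hk
    refine ⟨(h1.den (by rw [hc, hd]; decide) (by rw [hc, hd]; decide) (by rw [hc, hd]; decide)
      (by rw [hc, hd]; decide)).setVar (by decide) _, ?_, ?_⟩
    · rw [Store.var_setVar, if_neg (by decide), den_var (by rw [hc, hd]; decide), h2]
    rw [finRange_take_succ hk, List.findSome?_append, List.findSome?_singleton]
    simp only [Store.var_setVar, if_neg (show ¬ (22 : ℕ) = 10 by decide)]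
    suffices h : ((c.den s').var 22 = 0 ∧ (((List.finRange N).take k).findSome? (greedyFrom G A)).or
          (greedyFrom G A ⟨k, hk⟩) = none) ∨
        ∃ L, (c.den s').var 22 = 1 ∧ Rep G (c.den s') L ∧
          (((List.finRange N).take k).findSome? (greedyFrom G A)).or
            (greedyFrom G A ⟨k, hk⟩) = some L by
      rcases h with h | ⟨L, h, h', h''⟩
      · exact Or.inl h
      · exact Or.inr ⟨L, h, h'.setVar (by decide) (by decide) _, h''⟩
    rcases h3 with ⟨h3, h4⟩ | ⟨L, h3, h4, h5⟩
    swap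
    · right
      have : c.den s' = s' := by rw [hc, den, if_neg (by rw [Exp.val, h3]; decide), den]
      rw [this, h5]
      exact ⟨L, h3, h4, rfl⟩
    rw [h4, Option.none_or]
    by_cases hkA : (⟨k, hk⟩ : Fin N) ∈ A
    swap
    · left
      have h5 := h1.mem ⟨k, hk⟩
      rw [if_neg hkA] at h5
      have : c.den s' = s' := by
        rw [hc, den, if_pos (by rw [Exp.val, h3]), den, if_pos (by rw [Exp.val, Exp.val, h10, h5]),
          den]
      rw [this, greedyFrom, if_neg (fun h => hkA h.1)]
      exact ⟨h3, rfl⟩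
    obtain ⟨s₁, hs₁⟩ : ∃ s₁, s₁ = countProg.den ((resetProg.den s').setVar 27 k) := ⟨_, rfl⟩
    have hstep : c.den s' = if s₁.var 23 = 3 then d.den s₁ else s₁ := by
      have h5 := h1.mem ⟨k, hk⟩
      rw [if_pos hkA] at h5
      have h6 : (resetProg.den s').var 10 = k := by rw [den_var (by decide), h10]
      rw [hc, den, if_pos (by rw [Exp.val, h3]), den,
        if_neg (by rw [Exp.val, Exp.val, h10, h5]; decide)]
      simp only [den, Exp.val, h6, ← hs₁]
      -- Equality with 3 is tested by the sum of the two truncated differences being zero.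
      by_cases h7 : s₁.var 23 = 3
      · rw [if_pos h7, if_pos (by omega)]
      · rw [if_neg h7, if_neg (by omega)]
    have hE₂ : Env G A (resetProg.den s') := h1.den (by decide) (by decide) (by decide) (by decide)
    have hR₂ : Rep G (resetProg.den s') [] := resetProg_spec h1
    have hE₃ := hE₂.setVar (x := 27) (by decide) k
    have hR₃ := hR₂.setVar (x := 27) (by decide) (by decide) k
    have hE₄ : Env G A s₁ := by rw [hs₁]; exact hE₃.den (by decide) (by decide) (by decide) (by decide)
    have hR₄ : Rep G s₁ [] := by
      rw [hs₁]
      exact hR₃.den (by decide) (by decide) (by decide) (by decide) (by decide) (by decide)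
    -- After the reset nothing has been discovered, so the count of new neighbours is the degree.
    have h23 : s₁.var 23 = #(G.neighborFinset ⟨k, hk⟩) := by
      rw [hs₁, countProg_spec hE₃ (R := ∅) (v := ⟨k, hk⟩)
        (fun v => by rw [hR₃.reach]; simp [discover]) (by simp [Store.var_setVar]), sdiff_empty]
    have h27 : s₁.var 27 = (⟨k, hk⟩ : Fin N) := by
      rw [hs₁, den_var (by decide)]; simp [Store.var_setVar]
    have h22 : s₁.var 22 = 0 := by
      rw [hs₁, den_var (by decide), Store.var_setVar, if_neg (by decide), den_var (by decide), h3]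
    have h21 : s₁.var 21 = #A := by
      rw [hs₁, den_var (by decide), Store.var_setVar, if_neg (by decide), den_var (by decide), h2]
    rw [hstep, h23]
    by_cases hdeg : #(G.neighborFinset ⟨k, hk⟩) = 3
    swap
    · left
      rw [if_neg hdeg, greedyFrom, if_neg (fun h => hdeg h.2)]
      exact ⟨h22, rfl⟩
    rw [if_pos hdeg, greedyFrom, if_pos ⟨hkA, hdeg⟩]
    obtain ⟨s₂, hs₂⟩ : ∃ s₂, s₂ = extendProg.den (appendProg.den s₁) := ⟨_, rfl⟩
    have hd' : d.den s₁ = if s₂.var 21 ≤ s₂.var 24 then s₂.setVar 22 1 else s₂ := by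
      rw [hd]
      simp only [den, Exp.val, ← hs₂, Nat.sub_eq_zero_iff_le]
    have hE₅ : Env G A (appendProg.den s₁) :=
      hE₄.den (by decide) (by decide) (by decide) (by decide)
    have hR₅ := appendProg_spec hE₄ hR₄ h27
    have hR₆ := extendProg_spec hE₅ hR₅
    rw [← hs₂, List.nil_append] at hR₆
    have h21' : s₂.var 21 = #A := by rw [hs₂, den_var (by decide), den_var (by decide), h21]
    have h22' : s₂.var 22 = 0 := by rw [hs₂, den_var (by decide), den_var (by decide), h22]
    have hle := length_iterate_stepList_le (G := G) _ hkA N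
    rw [hd', h21', hR₆.len]
    by_cases hfull : ((stepList G A)^[N] [⟨k, hk⟩]).length = #A
    · right
      rw [if_pos hfull, if_pos hfull.ge]
      exact ⟨_, by simp [Store.var_setVar], hR₆.setVar (by decide) (by decide) _, rfl⟩
    · left
      rw [if_neg hfull, if_neg (by omega)]
      exact ⟨h22', rfl⟩

end Greedy

/-! ### Preparation of the input -/

section Setup

variable {N : ℕ} {G : SimpleGraph (Fin N)} [DecidableRel G.Adj] {A : Finset (Fin N)}

/-- Compute the beginnings of the rows of the adjacency matrix and the size of the colour class. -/
def setupProg : Prog :=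
  .seq (.assign 20 (.lit 0)) <|
  .seq (.each 11 (.seq (.write 9 (.var 11) (.var 20)) (.assign 20 (.add (.var 20) (.var 6))))) <|
  .seq (.assign 21 (.lit 0)) <|
  .each 11 (.assign 21 (.add (.var 21) (.get 1 (.var 11))))

theorem inputStore_adj (i j : Fin N) :
    (inputStore G A).arr 0 (i * N + j) = if G.Adj i j then 1 else 0 := by
  have h : (∃ i' j' : Fin N, (i : ℕ) * N + j = i' * N + j' ∧ G.Adj i' j') ↔ G.Adj i j := by
    constructor
    · rintro ⟨i', j', h1, h2⟩
      have hN : 0 < N := i.pos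
      have e1 : (i : ℕ) = i' := by
        have := congrArg (· / N) h1
        simpa [Nat.add_div_of_dvd_right, Nat.mul_comm _ N, Nat.mul_add_div hN,
          Nat.div_eq_of_lt j.2, Nat.div_eq_of_lt j'.2] using this
      have e2 : (j : ℕ) = j' := by rw [e1] at h1; omega
      rwa [Fin.ext e1, Fin.ext e2]
    · exact fun h => ⟨i, j, rfl, h⟩
  simp only [inputStore, if_true, h]

theorem inputStore_mem (i : Fin N) :
    (inputStore G A).arr 1 i = if i ∈ A then 1 else 0 := by
  have h : (∃ i' ∈ A, (i : ℕ) = i') ↔ i ∈ A :=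
    ⟨fun ⟨i', h1, h2⟩ => Fin.ext h2 ▸ h1, fun h => ⟨i, h, rfl⟩⟩
  simp only [inputStore, one_ne_zero, if_false, if_true, h]

/-- The machine has no multiplication, so the beginnings `i * N` of the rows are tabulated by
repeated addition. -/
theorem setupProg_spec : Env G A (setupProg.den ((inputStore G A).setVar 6 N)) ∧
    (setupProg.den ((inputStore G A).setVar 6 N)).var 21 = #A := by
  obtain ⟨s₀, hs₀⟩ : ∃ s₀, s₀ = (inputStore G A).setVar 6 N := ⟨_, rfl⟩
  obtain ⟨c, hc⟩ : ∃ c : Prog, c = .seq (.write 9 (.var 11) (.var 20))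
    (.assign 20 (.add (.var 20) (.var 6))) := ⟨_, rfl⟩
  obtain ⟨s₁, hs₁⟩ : ∃ s₁, s₁ = (Prog.each 11 c).den (s₀.setVar 20 0) := ⟨_, rfl⟩
  obtain ⟨d, hd⟩ : ∃ d : Prog, d = .assign 21 (.add (.var 21) (.get 1 (.var 11))) := ⟨_, rfl⟩
  have hden : setupProg.den s₀ = (Prog.each 11 d).den (s₁.setVar 21 0) := by
    rw [hs₁, hc, hd]; rfl
  have hadj : ∀ i j : Fin N, s₀.arr 0 (i * N + j) = if G.Adj i j then 1 else 0 := by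
    rw [hs₀]; exact inputStore_adj (A := A)
  have hmem : ∀ i : Fin N, s₀.arr 1 i = if i ∈ A then 1 else 0 := by
    rw [hs₀]; exact inputStore_mem (G := G)
  have h6 : s₀.var 6 = N := by rw [hs₀]; simp [Store.var_setVar]
  have h61 : (s₀.setVar 20 0).var 6 = N := by rw [Store.var_setVar, if_neg (by decide), h6]
  have h9 := den_each (c := c) (x := 11) (s := s₀.setVar 20 0)
    (fun k s' => s'.var 6 = N ∧ s'.var 20 = k * N ∧ ∀ i < k, s'.arr 9 i = i * N)
    ⟨by simpa [Store.var_setVar] using h6, by simp [Store.var_setVar], by simp⟩ (by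
      rintro k - s' h11 ⟨h1, h2, h3⟩
      rw [hc]
      simp only [den, Exp.val, Store.var_setVar, Store.var_setArr, Store.arr_setVar,
        Store.arr_setArr, h11, h1, h2]
      refine ⟨by simp, by simp [Nat.succ_mul], fun i hi => ?_⟩
      by_cases hik : i = k
      · simp [hik]
      · simpa [hik] using h3 i (by omega))
  rw [← hs₁, h61] at h9
  have hE : Env G A s₁ := by
    refine ⟨h9.1, fun i j => ?_, fun i => ?_⟩
    · rw [h9.2.2 i i.2, hs₁, den_arr (by rw [hc]; decide)]
      exact hadj i j
    · rw [hs₁, den_arr (by rw [hc]; decide)]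
      exact hmem i
  have hE' := hE.setVar (x := 21) (by decide) 0
  have h21 := den_each (c := d) (x := 11) (s := s₁.setVar 21 0)
    (fun k s' => Env G A s' ∧ s'.var 21 = #(A.filter fun v : Fin N => (v : ℕ) < k))
    ⟨hE'.setVar (by decide) _, by simp [Store.var_setVar]⟩ (by
      rintro k hk s' h11 ⟨h1, h2⟩
      rw [hE'.bound] at hk
      refine ⟨(h1.den (by rw [hd]; decide) (by rw [hd]; decide) (by rw [hd]; decide)
        (by rw [hd]; decide)).setVar (by decide) _, ?_⟩
      have h3 := h1.mem ⟨k, hk⟩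
      rw [hd, card_filter_lt_succ _ hk, ← h2, ← h3]
      simp [den, Store.var_setVar, Exp.val, h11])
  rw [hE'.bound] at h21
  rw [← hs₀, hden]
  refine ⟨h21.1, ?_⟩
  rw [h21.2]
  congr 1
  ext v
  simp

end Setup

/-! ### Output of the decomposition and the complete program -/

section Output

variable {N : ℕ} {s : Store}

/-- Write the tree of the caterpillar. -/
def treeProg : Prog :=
  .seq (.assign 1 (.sub (.add (.var 6) (.var 6)) (.lit 2))) <|
  .seq (.assign 2 (.sub (.add (.var 6) (.var 6)) (.lit 3))) <|
  .seq (.each 11 (.seq (.write 2 (.var 11) (.var 11))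
    (.write 2 (.add (.var 6) (.var 11)) (.add (.var 6) (.var 11))))) <|
  .seq (.each 11 (.seq
    (.write 3 (.add (.var 11) (.var 11))
      (.add (.var 6) (.sub (.add (.var 11) (.var 11)) (.lit 1))))
    (.write 3 (.add (.add (.var 11) (.var 11)) (.lit 1))
      (.add (.var 6) (.sub (.add (.var 11) (.var 11)) (.lit 1)))))) <|
  .seq (.each 11 (.seq
    (.write 3 (.add (.var 6) (.add (.var 11) (.var 11)))
      (.add (.add (.var 6) (.add (.var 11) (.var 11))) (.lit 2)))
    (.write 3 (.add (.add (.var 6) (.add (.var 11) (.var 11))) (.lit 1))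
      (.add (.add (.var 6) (.add (.var 11) (.var 11))) (.lit 2))))) <|
  .write 3 (.sub (.add (.var 6) (.var 6)) (.lit 4)) (.sub (.add (.var 6) (.var 6)) (.lit 3))

/-- The store holds the tree of the caterpillar. -/
structure HoldsTree (N : ℕ) (s : Store) : Prop where
  nodes : s.var 1 = 2 * N - 2
  edges : s.var 2 = 2 * N - 3
  fst : ∀ k < 2 * N - 3, s.arr 2 k = k
  snd : ∀ k < 2 * N - 3, s.arr 3 k = caterParent N k

theorem treeProg_spec (h4 : 4 ≤ N) (he : Even N) (h6 : s.var 6 = N) :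
    HoldsTree N (treeProg.den s) := by
  obtain ⟨c₁, hc₁⟩ : ∃ c : Prog, c = .seq (.write 2 (.var 11) (.var 11))
    (.write 2 (.add (.var 6) (.var 11)) (.add (.var 6) (.var 11))) := ⟨_, rfl⟩
  obtain ⟨c₂, hc₂⟩ : ∃ c : Prog, c = .seq
    (.write 3 (.add (.var 11) (.var 11))
      (.add (.var 6) (.sub (.add (.var 11) (.var 11)) (.lit 1))))
    (.write 3 (.add (.add (.var 11) (.var 11)) (.lit 1))
      (.add (.var 6) (.sub (.add (.var 11) (.var 11)) (.lit 1)))) := ⟨_, rfl⟩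
  obtain ⟨c₃, hc₃⟩ : ∃ c : Prog, c = .seq
    (.write 3 (.add (.var 6) (.add (.var 11) (.var 11)))
      (.add (.add (.var 6) (.add (.var 11) (.var 11))) (.lit 2)))
    (.write 3 (.add (.add (.var 6) (.add (.var 11) (.var 11))) (.lit 1))
      (.add (.add (.var 6) (.add (.var 11) (.var 11))) (.lit 2))) := ⟨_, rfl⟩
  obtain ⟨s₁, hs₁⟩ : ∃ s₁, s₁ = (s.setVar 1 (2 * N - 2)).setVar 2 (2 * N - 3) := ⟨_, rfl⟩
  obtain ⟨s₂, hs₂⟩ : ∃ s₂, s₂ = (Prog.each 11 c₁).den s₁ := ⟨_, rfl⟩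
  obtain ⟨s₃, hs₃⟩ : ∃ s₃, s₃ = (Prog.each 11 c₂).den s₂ := ⟨_, rfl⟩
  obtain ⟨s₄, hs₄⟩ : ∃ s₄, s₄ = (Prog.each 11 c₃).den s₃ := ⟨_, rfl⟩
  have h61 : s₁.var 6 = N := by rw [hs₁]; simpa [Store.var_setVar] using h6
  have h62 : s₂.var 6 = N := by rw [hs₂, den_var (by rw [hc₁]; decide), h61]
  have h63 : s₃.var 6 = N := by rw [hs₃, den_var (by rw [hc₂]; decide), h62]
  have h64 : s₄.var 6 = N := by rw [hs₄, den_var (by rw [hc₃]; decide), h63]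
  -- The loops ignore the minimum in `caterParent` and write beyond the `2 * N - 3` edges. Entries
  -- of the second loop from `N` on are overwritten by the third; the last write corrects the only
  -- relevant entry at which the minimum matters.
  have hden : treeProg.den s = s₄.setArr 3 (2 * N - 4) (2 * N - 3) := by
    have : treeProg.den s = (Prog.write 3 (.sub (.add (.var 6) (.var 6)) (.lit 4))
        (.sub (.add (.var 6) (.var 6)) (.lit 3))).den s₄ := by
      rw [hs₄, hs₃, hs₂, hs₁, hc₁, hc₂, hc₃]
      simp only [treeProg, den, Exp.val, Store.var_setVar, h6, two_mul]
      rfl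
    rw [this]
    simp only [den, Exp.val, h64, two_mul]
  have h1 := den_each (c := c₁) (x := 11) (s := s₁)
    (fun k s' => s'.var 6 = N ∧ ∀ i, (i < k ∨ N ≤ i ∧ i < N + k) → s'.arr 2 i = i)
    ⟨by simpa [Store.var_setVar] using h61, by omega⟩ (by
      rintro k hk s' h11 ⟨h1, h2⟩
      rw [h61] at hk
      rw [hc₁]
      simp only [den, Exp.val, Store.var_setVar, Store.var_setArr, Store.arr_setVar,
        Store.arr_setArr_apply, h11, h1, true_and]
      refine ⟨rfl, fun i hi => ?_⟩
      have := h2 i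
      split_ifs <;> omega)
  have h2 := den_each (c := c₂) (x := 11) (s := s₂)
    (fun k s' => s'.var 6 = N ∧ ∀ i < 2 * k, s'.arr 3 i = N + (2 * (i / 2) - 1))
    ⟨by simpa [Store.var_setVar] using h62, by simp⟩ (by
      rintro k hk s' h11 ⟨h1, h2⟩
      rw [hc₂]
      simp only [den, Exp.val, Store.var_setVar, Store.var_setArr, Store.arr_setVar,
        Store.arr_setArr_apply, h11, h1, true_and]
      refine ⟨rfl, fun i hi => ?_⟩
      have := h2 i
      split_ifs <;> omega)
  have h3 := den_each (c := c₃) (x := 11) (s := s₃)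
    (fun k s' => s'.var 6 = N ∧ (∀ i < N, s'.arr 3 i = s₃.arr 3 i) ∧
      ∀ i, N ≤ i → i < N + 2 * k → s'.arr 3 i = N + 2 * ((i - N) / 2) + 2)
    ⟨by simpa [Store.var_setVar] using h63, by simp [Store.arr_setVar], by omega⟩ (by
      rintro k hk s' h11 ⟨h1, h2, h3⟩
      rw [hc₃]
      simp only [den, Exp.val, Store.var_setVar, Store.var_setArr, Store.arr_setVar,
        Store.arr_setArr_apply, h11, h1, true_and]
      refine ⟨rfl, fun i hi => ?_, fun i hi hi' => ?_⟩
      · rw [if_neg (by omega), if_neg (by omega), h2 i hi]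
      · have := h3 i hi
        split_ifs <;> omega)
  rw [h61, ← hs₂] at h1
  rw [h62, ← hs₃] at h2
  rw [h63, ← hs₄] at h3
  rw [hden]
  refine ⟨?_, ?_, fun k hk => ?_, fun k hk => ?_⟩
  · rw [Store.var_setArr, hs₄, den_var (by rw [hc₃]; decide), hs₃, den_var (by rw [hc₂]; decide),
      hs₂, den_var (by rw [hc₁]; decide), hs₁]
    simp [Store.var_setVar]
  · rw [Store.var_setArr, hs₄, den_var (by rw [hc₃]; decide), hs₃, den_var (by rw [hc₂]; decide),
      hs₂, den_var (by rw [hc₁]; decide), hs₁]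
    simp [Store.var_setVar]
  · rw [Store.arr_setArr_apply, if_neg (by simp), hs₄, den_arr (by rw [hc₃]; decide), hs₃,
      den_arr (by rw [hc₂]; decide)]
    exact h1.2 k (by omega)
  · obtain ⟨n, rfl⟩ := he
    rw [Store.arr_setArr_apply, caterParent]
    by_cases hkN : k < n + n
    · have e1 := h3.2.1 k hkN
      have e2 := h2.2 k (by omega)
      rw [if_neg (by omega), if_pos hkN]
      omega
    · have e1 := h3.2.2 k (by omega) (by omega)
      rw [if_neg hkN]
      split_ifs <;> omega

/-- Write the order of the leaves. -/
def leafProg : Prog :=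
  .seq (.each 11 (.seq
    (.write 4 (.add (.var 11) (.var 11)) (.get 5 (.sub (.var 11) (.lit 1))))
    (.write 4 (.add (.add (.var 11) (.var 11)) (.lit 1)) (.get 8 (.add (.var 11) (.lit 1)))))) <|
  .seq (.write 4 (.sub (.var 6) (.lit 2)) (.get 5 (.sub (.var 21) (.lit 2)))) <|
  .seq (.write 4 (.sub (.var 6) (.lit 1)) (.get 5 (.sub (.var 21) (.lit 1)))) <|
  .seq (.write 4 (.lit 0) (.get 8 (.lit 0))) <|
  .write 4 (.lit 1) (.get 8 (.lit 1))

theorem leafProg_spec {n : ℕ} (h2 : 2 ≤ n) (hN : N = 2 * n) (h6 : s.var 6 = N)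
    (h21 : s.var 21 = n) {i : ℕ} (hi : i < N) :
    (leafProg.den s).arr 4 i = leafOrder n (s.arr 5) (s.arr 8) i := by
  obtain ⟨c, hc⟩ : ∃ c : Prog, c = .seq
    (.write 4 (.add (.var 11) (.var 11)) (.get 5 (.sub (.var 11) (.lit 1))))
    (.write 4 (.add (.add (.var 11) (.var 11)) (.lit 1)) (.get 8 (.add (.var 11) (.lit 1)))) :=
    ⟨_, rfl⟩
  obtain ⟨s₁, hs₁⟩ : ∃ s₁, s₁ = (Prog.each 11 c).den s := ⟨_, rfl⟩
  have h61 : s₁.var 6 = N := by rw [hs₁, den_var (by rw [hc]; decide), h6]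
  have h211 : s₁.var 21 = n := by rw [hs₁, den_var (by rw [hc]; decide), h21]
  have h5 : s₁.arr 5 = s.arr 5 := by rw [hs₁, den_arr (by rw [hc]; decide)]
  have h8 : s₁.arr 8 = s.arr 8 := by rw [hs₁, den_arr (by rw [hc]; decide)]
  -- The loop applies the pattern of the middle cherries everywhere; the four writes afterwards set
  -- the first and the last cherry.
  have hden : leafProg.den s = (((s₁.setArr 4 (N - 2) (s.arr 5 (n - 2))).setArr 4 (N - 1)
      (s.arr 5 (n - 1))).setArr 4 0 (s.arr 8 0)).setArr 4 1 (s.arr 8 1) := by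
    have : leafProg.den s = (Prog.seq
        (.write 4 (.sub (.var 6) (.lit 2)) (.get 5 (.sub (.var 21) (.lit 2)))) <|
        .seq (.write 4 (.sub (.var 6) (.lit 1)) (.get 5 (.sub (.var 21) (.lit 1)))) <|
        .seq (.write 4 (.lit 0) (.get 8 (.lit 0))) <|
        .write 4 (.lit 1) (.get 8 (.lit 1))).den s₁ := by rw [hs₁, hc]; rfl
    rw [this, ← h5, ← h8]
    simp [den, Exp.val, Store.var_setArr, h61, h211, Store.arr_setArr_apply]
  have h1 := den_each (c := c) (x := 11) (s := s)
    (fun k s' => s'.arr 5 = s.arr 5 ∧ s'.arr 8 = s.arr 8 ∧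
      ∀ i < 2 * k, s'.arr 4 i = if i % 2 = 0 then s.arr 5 (i / 2 - 1) else s.arr 8 (i / 2 + 1))
    ⟨rfl, rfl, by simp⟩ (by
      rintro k hk s' h11 ⟨h1, h2, h3⟩
      rw [hc]
      refine ⟨by simpa [den, Store.arr_setVar, Store.arr_setArr] using h1,
        by simpa [den, Store.arr_setVar, Store.arr_setArr] using h2, fun i hi => ?_⟩
      simp only [den, Exp.val, Store.var_setArr, Store.arr_setVar,
        Store.arr_setArr_apply, h11, h1, h2, true_and]
      by_cases hi0 : i = k + k
      · have e1 : i / 2 = k := by omega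
        rw [if_neg (by omega), if_pos hi0, if_pos (by omega), e1]
      · by_cases hi1 : i = k + k + 1
        · have e1 : i / 2 = k := by omega
          rw [if_pos hi1, if_neg (show ¬ i % 2 = 0 by omega), if_neg (by simp), e1]
        · rw [if_neg (by omega), if_neg (by omega), h3 i (by omega)])
  rw [h6, ← hs₁] at h1
  have h3 := h1.2.2 i (by omega)
  rw [hden]
  simp only [Store.arr_setArr_apply, true_and, h3, leafOrder]
  by_cases e0 : i < 2
  · rw [if_pos e0]
    obtain rfl | rfl : i = 0 ∨ i = 1 := by omega
    · simp
    · simp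
  · rw [if_neg (by omega), if_neg (by omega), if_neg e0]
    by_cases e1 : i = N - 1
    · rw [if_pos e1, if_pos (by omega)]
      congr 1
      omega
    · by_cases e2 : i = N - 2
      · rw [if_neg e1, if_pos e2, if_pos (by omega)]
        congr 1
        omega
      · rw [if_neg e1, if_neg e2, if_neg (show ¬ 2 * n - 2 ≤ i by omega)]

/-- Number the leaves by themselves. -/
def idProg : Prog := .each 11 (.write 4 (.var 11) (.var 11))

theorem idProg_spec (h6 : s.var 6 = N) {i : ℕ} (hi : i < N) : (idProg.den s).arr 4 i = i := by
  have h1 := den_each (c := .write 4 (.var 11) (.var 11)) (x := 11) (s := s)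
    (fun k s' => ∀ i < k, s'.arr 4 i = i) (by simp) (by
      rintro k - s' h11 h1 i hi
      simp only [den, Exp.val, Store.arr_setVar, Store.arr_setArr_apply, h11, true_and]
      have := h1 i
      split_ifs <;> omega)
  rw [h6] at h1
  exact h1 i hi

/-- The whole algorithm, for the size of the graph in variable `6`. -/
def mainProg : Prog :=
  .seq setupProg <|
  .ite (.sub (.var 6) (.lit 5))
    (.seq greedyProg <| .ite (.var 22)
      (.seq treeProg <| .seq leafProg <| .assign 0 (.lit 1)) (.assign 0 (.lit 0)))
    (.ite (.sub (.var 6) (.lit 3))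
      (.seq treeProg <| .seq idProg <| .assign 0 (.lit 1)) (.assign 0 (.lit 0)))

/-- The whole algorithm. -/
def program : Cmd := .seq (.assign 6 (.var 0)) mainProg.compile

theorem HoldsTree.den (h : HoldsTree N s) {p : Prog} (h1 : 1 ∉ p.modVars) (h2 : 2 ∉ p.modVars)
    (h2' : 2 ∉ p.modArrs) (h3 : 3 ∉ p.modArrs) : HoldsTree N (p.den s) where
  nodes := by rw [den_var h1, h.nodes]
  edges := by rw [den_var h2, h.edges]
  fst := by rw [den_arr h2']; exact h.fst
  snd := by rw [den_arr h3]; exact h.snd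

theorem HoldsTree.holdsDecomposition {h4 : 4 ≤ N} {he : Even N} {q : Fin N ≃ Fin N}
    (h : HoldsTree N s) (hq : ∀ i : Fin N, s.arr 4 i = q i) :
    s.HoldsDecomposition (caterDecomposition h4 he q) := by
  have hb := caterParent_bounds h4 he
  refine ⟨h.nodes, fun k hk => ?_, fun u v => ?_, fun w => ?_⟩
  · rw [h.edges] at hk
    rw [h.fst k hk, h.snd k hk]
    have := hb k (by omega)
    omega
  · rw [h.edges]
    change (u ≠ v ∧ (_ ∨ _)) ↔ _
    constructor
    · rintro ⟨-, ⟨h1, h2⟩ | ⟨h1, h2⟩⟩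
      · exact ⟨u, by omega, Or.inl ⟨h.fst u (by omega), by rw [h.snd u (by omega), h2]⟩⟩
      · exact ⟨v, by omega, Or.inr ⟨h.fst v (by omega), by rw [h.snd v (by omega), h2]⟩⟩
    · rintro ⟨k, hk, h1⟩
      rw [h.fst k hk, h.snd k hk] at h1
      have := hb k (by omega)
      refine ⟨fun h2 => ?_, ?_⟩
      · rw [h2] at h1
        omega
      · rcases h1 with ⟨rfl, h2⟩ | ⟨rfl, h2⟩
        · exact Or.inl ⟨by omega, h2⟩
        · exact Or.inr ⟨by omega, h2⟩
  · exact hq ⟨w.1, (caterTree_isLeaf_iff h4 he).1 w.2⟩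

theorem program_runs {G : SimpleGraph (Fin N)} [DecidableRel G.Adj] {A : Finset (Fin N)} :
    ∃ t, program.Runs (inputStore G A) (mainProg.den ((inputStore G A).setVar 6 N)) t ∧
      t ≤ (mainProg.costBound + 2).eval N := by
  obtain ⟨t, h1, h2⟩ := runs_compile (p := mainProg) (by decide) (by decide)
    ((inputStore G A).setVar 6 N)
  -- Copying `N` into variable `6` takes two steps. The copy is needed since variable `0` later
  -- receives the answer.
  refine ⟨2 + t, .seq (.assign 6 (.var 0) _) h1, ?_⟩
  rw [Store.var_setVar, if_pos rfl] at h2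
  have h3 : ((2 : Polynomial ℕ)).eval N = 2 := by
    rw [show (2 : Polynomial ℕ) = Polynomial.C 2 by simp, Polynomial.eval_C]
  rw [Polynomial.eval_add, h3]
  omega

end Output

end RAM

/-! ### Initial segments of the ordering as shores -/

section Shores

variable {V : Type*} [Fintype V] [DecidableEq V] {G : SimpleGraph V} [DecidableRel G.Adj]
  {A B : Finset V}

/-- The initial segments of a width two ordering together with their neighbours are shores. -/
theorem EnumClasses.exists_shore_eq {n : ℕ} {a b : ℕ → V} (h : EnumClasses A B n a b)
    (hG : IsBrace G) (hAB : HasColourClasses G A B) {N : ℕ} (hN : N = 2 * n) (h4 : 4 ≤ N)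
    (he : Even N) (hcl : ∀ i, i + 3 ≤ n → ∀ w, G.Adj (a i) w → ∃ l < i + 3, w = b l)
    (ord : LinOrdering A) (hord : ∀ i (h : i < ord.toList.length), a i = ord.toList[i])
    (x : {x // x ∈ A}) (hx : (ord x : ℕ) + 4 ≤ #A) :
    ∃ t₁ t₂, (caterDecomposition h4 he (h.equiv hAB hN)).tree.Adj t₁ t₂ ∧
      (caterDecomposition h4 he (h.equiv hAB hN)).shore t₁ t₂ =
        (↑(ord.pred x ∪ ord.reach G x) : Set V) := by
  have hn := h.card_left
  obtain ⟨j, hj⟩ : ∃ j, j = (ord x : ℕ) + 1 := ⟨_, rfl⟩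
  refine ⟨_, _, parentTree_adj_parent (caterParent_bounds h4 he) (k := N + 2 * j) (by omega), ?_⟩
  rw [caterDecomposition_shore_spine h4 he _ (by omega), h.initialSet_eq hAB hN (by omega)]
  have hlen : ord.toList.length = n := by simp [LinOrdering.toList, hn]
  have hpred : ord.pred x = (range j).image a := by
    rw [ord.pred_eq, ← hj]
    ext v
    simp only [List.mem_toFinset, List.mem_take_iff_getElem, mem_image, mem_range]
    constructor
    · rintro ⟨i, hi, rfl⟩
      exact ⟨i, by omega, hord i (by omega)⟩
    · rintro ⟨i, hi, rfl⟩
      exact ⟨i, by omega, (hord i (by omega)).symm⟩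
  have hsub : (range j).image a ⊆ A := by
    intro v hv
    obtain ⟨i, hi, rfl⟩ := mem_image.1 hv
    exact h.left_mem i (by rw [mem_range] at hi; omega)
  have hreach : ord.reach G x = (range (j + 2)).image b := by
    rw [LinOrdering.reach, hpred]
    -- Closure bounds the reach by the first `j + 2` vertices of `B`, and expansion shows that it
    -- has at least that many.
    refine eq_of_subset_of_card_le ?_ ?_
    · intro w hw
      obtain ⟨v, hv, hvw⟩ := mem_nbhd.1 hw
      obtain ⟨i, hi, rfl⟩ := mem_image.1 hv
      rw [mem_range] at hi
      obtain ⟨l, hl, rfl⟩ := hcl i (by omega) w hvw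
      exact mem_image_of_mem _ (mem_range.2 (by omega))
    · rw [h.card_image_right (by omega)]
      have hc := h.card_image_left (j := j) (by omega)
      have := hG.card_add_two_le_card_nbhd hAB hsub (card_pos.1 (by omega)) (by omega)
      omega
  rw [hpred, hreach]

/-- The arrays of the machine are known only below the size of the colour classes, and `leafOrder`
reads nothing beyond. -/
theorem leafOrder_val {N : ℕ} {n : ℕ} {f g : ℕ → ℕ} {a b : ℕ → Fin N}
    (hf : ∀ i < n, f i = a i) (hg : ∀ i < n, g i = b i) (h2 : 2 ≤ n) {i : ℕ} (hi : i < 2 * n) :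
    leafOrder n f g i = leafOrder n a b i := by
  unfold leafOrder
  split_ifs
  · exact hg _ (by omega)
  · exact hf _ (by omega)
  · exact hf _ (by omega)
  · exact hg _ (by omega)

/-- With four leaves the only shore on the spine has two vertices, so any labelling has porosity at
most two. -/
theorem IsBrace.exists_width_of_card_eq_four {N : ℕ} {G : SimpleGraph (Fin N)}
    {A B : Finset (Fin N)} (hG : IsBrace G) (hAB : HasColourClasses G A B) (h4 : 4 ≤ N)
    (he : Even N) (h5 : N < 5) : (caterDecomposition h4 he (Equiv.refl (Fin N))).width G = 2 := by
  refine le_antisymm ?_ (hG.two_le_width hAB (by simpa using h4) _)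
  refine caterDecomposition_width_le h4 he _ fun j hj f _ => ?_
  refine (crossing_le_card f _).trans ?_
  rw [card_initialSet _ (by omega)]
  omega

end Shores

/-! ### Correctness of the complete program -/

namespace RAM

open Prog

section Main

variable {N : ℕ} {G : SimpleGraph (Fin N)} [DecidableRel G.Adj] {A B : Finset (Fin N)}

theorem mainProg_of_card_lt_four {s : Store} (h : (setupProg.den s).var 6 = N) (hN : N < 4) :
    (mainProg.den s).var 0 = 0 := by
  rw [mainProg]
  simp only [den, Exp.val, h]
  rw [if_pos (by omega), if_pos (by omega), Store.var_setVar, if_pos rfl]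

theorem mainProg_of_card_eq_four {s : Store} (h : (setupProg.den s).var 6 = N) (h4 : 4 ≤ N)
    (h5 : N < 5) : mainProg.den s = (idProg.den (treeProg.den (setupProg.den s))).setVar 0 1 := by
  rw [mainProg]
  simp only [den, Exp.val, h]
  rw [if_pos (by omega), if_neg (by omega)]

theorem mainProg_of_six_le {s : Store} (h : (setupProg.den s).var 6 = N) (h6 : 6 ≤ N) :
    mainProg.den s = if (greedyProg.den (setupProg.den s)).var 22 = 0 then
      (greedyProg.den (setupProg.den s)).setVar 0 0 else
      (leafProg.den (treeProg.den (greedyProg.den (setupProg.den s)))).setVar 0 1 := by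
  rw [mainProg]
  simp only [den, Exp.val, h]
  rw [if_neg (by omega)]
  by_cases h0 : (greedyProg.den (setupProg.den s)).var 22 = 0
  · rw [if_pos h0]
    exact if_pos h0
  · rw [if_neg h0]
    exact if_neg h0

/-- Below four vertices the width is never two, and with four it always is. Otherwise the number of
vertices, being even, is at least six, and the outcome is that of the greedy procedure; arrays `5`
and `8` then hold the two enumerations that label the caterpillar. -/
theorem mainProg_spec (hG : IsBrace G) (hAB : HasColourClasses G A B) {s : Store}
    (hs : s = mainProg.den ((inputStore G A).setVar 6 N)) :
    (pmw G ≠ 2 → s.var 0 = 0) ∧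
    (pmw G = 2 → s.var 0 = 1 ∧
      ∃ (m : ℕ) (D : PMDecomposition (Fin N) (Fin m)),
        s.HoldsDecomposition D ∧ D.width G = 2 ∧
        (6 ≤ N → ∃ ord : LinOrdering A,
          greedyOrder G ((List.finRange N).filter (· ∈ A)) = some ord.toList ∧
          ord.width G = 2 ∧ s.HoldsOrdering ord ∧
          ∀ a : {a // a ∈ A}, (ord a : ℕ) + 4 ≤ #A →
            ∃ t₁ t₂, D.tree.Adj t₁ t₂ ∧
              D.shore t₁ t₂ = (↑(ord.pred a ∪ ord.reach G a) : Set (Fin N)))) := by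
  obtain ⟨hE, h21⟩ := setupProg_spec (G := G) (A := A)
  have hcard := hAB.card_add
  have heq := hG.card_eq hAB
  rw [Fintype.card_fin] at hcard
  have heven : Even N := ⟨#A, by omega⟩
  by_cases h4 : N < 4
  · have hne : pmw G ≠ 2 := pmw_ne_two_of_card_le_three (by rw [Fintype.card_fin]; omega)
    exact ⟨fun _ => hs ▸ mainProg_of_card_lt_four hE.bound h4, fun h => absurd h hne⟩
  rw [not_lt] at h4
  by_cases h5 : N < 5
  · have hw := hG.exists_width_of_card_eq_four hAB h4 heven h5
    have hpmw : pmw G = 2 := hG.pmw_eq_two hAB (by simpa using h4) _ hw.le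
    rw [mainProg_of_card_eq_four hE.bound h4 h5] at hs
    have hT := treeProg_spec h4 heven hE.bound
    have hT' := (hT.den (p := idProg) (by decide) (by decide) (by decide) (by decide)).den
      (p := .assign 0 (.lit 1)) (by decide) (by decide) (by decide) (by decide)
    refine ⟨fun h => absurd hpmw h, fun _ => ⟨by rw [hs, Store.var_setVar, if_pos rfl], _, _,
      ?_, hw, fun h => by omega⟩⟩
    rw [hs]
    refine hT'.holdsDecomposition fun i => ?_
    refine idProg_spec (N := N) ?_ i.2
    rw [den_var (by decide), hE.bound]
  have h6 : 6 ≤ N := by omega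
  have hmem : ((List.finRange N).filter (· ∈ A)).toFinset = A := by ext; simp
  have hnd : ((List.finRange N).filter (· ∈ A)).Nodup := (List.nodup_finRange N).filter _
  have hiff := hG.greedyOrder_iff hAB (by simpa using h6) hnd hmem
  rw [mainProg_of_six_le hE.bound h6] at hs
  rcases greedyProg_spec hE h21 with ⟨h0, hnone⟩ | ⟨L, h1, hR, hsome⟩
  · rw [if_pos h0] at hs
    exact ⟨fun _ => by rw [hs, Store.var_setVar, if_pos rfl],
      fun h => absurd h (hiff.2.1 hnone)⟩
  rw [if_neg (by rw [h1]; decide)] at hs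
  have hpmw : pmw G = 2 := by
    by_contra h
    rw [hiff.2.2 h] at hsome
    simp at hsome
  refine ⟨fun h => absurd hpmw h, fun _ => ⟨by rw [hs, Store.var_setVar, if_pos rfl], ?_⟩⟩
  obtain ⟨hLn, hLA, hL, ord, rfl, hw⟩ := IsBrace.exists_ord_of_greedyOrder hnd hmem hsome
  obtain ⟨s₁, hs₁⟩ : ∃ s₁, s₁ = greedyProg.den (setupProg.den ((inputStore G A).setVar 6 N)) :=
    ⟨_, rfl⟩
  rw [← hs₁] at hs hR
  have hb₁ : s₁.var 6 = N := by rw [hs₁, den_var (by decide), hE.bound]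
  have h21₁ : s₁.var 21 = #A := by rw [hs₁, den_var (by decide), h21]
  have hT := (((treeProg_spec h4 heven hb₁).den (p := leafProg) (by decide) (by decide) (by decide)
    (by decide)).den (p := .assign 0 (.lit 1)) (by decide) (by decide) (by decide) (by decide))
  obtain ⟨x⟩ : Nonempty (Fin N) := ⟨⟨0, by omega⟩⟩
  have ha : ∀ i (h : i < ord.toList.length), ord.toList.getD i x = ord.toList[i] :=
    fun i h => by simp [h]
  have hb : ∀ i (h : i < (discover G (List.finRange N) ord.toList).length),
      (discover G (List.finRange N) ord.toList).getD i x =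
        (discover G (List.finRange N) ord.toList)[i] := fun i h => by simp [h]
  have hlen : ord.toList.length = #A := by simp [LinOrdering.toList]
  have hlenD : (discover G (List.finRange N) ord.toList).length = #A := by
    rw [length_discover (List.nodup_finRange N) List.mem_finRange, hLA, hG.nbhd_left hAB, heq]
  have hEn := enumClasses_of_list (List.nodup_finRange N) List.mem_finRange hLn hLA (by omega) rfl
    heq.symm (hG.nbhd_left hAB) ha hb
  have hcl : ∀ i, i + 3 ≤ #A → ∀ w, G.Adj (ord.toList.getD i x) w →
      ∃ l < i + 3, w = (discover G (List.finRange N) ord.toList).getD l x := fun i hi w hw =>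
    hL.exists_eq_discover (List.nodup_finRange N) List.mem_finRange ha hb (by omega) hw
  have hN : N = 2 * #A := by omega
  refine ⟨_, caterDecomposition h4 heven (hEn.equiv hAB hN), ?_,
    le_antisymm (hEn.width_le hAB hN h4 heven hcl)
      (hG.two_le_width hAB (by simpa using h4) _), fun _ => ⟨ord, hsome, hw, fun i => ?_,
    fun a ha' => hEn.exists_shore_eq hG hAB hN h4 heven hcl ord ha a ha'⟩⟩
  · rw [hs]
    refine hT.holdsDecomposition fun i => ?_
    have hleaf := leafProg_spec (s := treeProg.den s₁) (n := #A) (by omega) hN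
      (by rw [den_var (by decide), hb₁]) (by rw [den_var (by decide), h21₁]) i.2
    have h5 : (treeProg.den s₁).arr 5 = s₁.arr 5 := den_arr (by decide) _
    have h8 : (treeProg.den s₁).arr 8 = s₁.arr 8 := den_arr (by decide) _
    rw [h5, h8] at hleaf
    change (leafProg.den (treeProg.den s₁)).arr 4 i = _
    rw [hleaf]
    refine leafOrder_val (fun i hi => ?_) (fun i hi => ?_) (by omega) (by omega)
    · rw [hR.list i (by omega), ha i (by omega)]
    · rw [hR.dlist i (by omega), hb i (by omega)]
  · rw [hs, Store.arr_setVar, den_arr (by decide), den_arr (by decide), hR.list i (by omega)]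
    simp [LinOrdering.toList]

end Main

end RAM

theorem mainTheorem3 :
    (∀ (V : Type*) [Fintype V] [DecidableEq V] (G : SimpleGraph V) [DecidableRel G.Adj]
      (A B : Finset V), IsBrace G → HasColourClasses G A B → 6 ≤ Fintype.card V →
      ∀ l : List V, l.Nodup → l.toFinset = A →
        ((∃ ord : LinOrdering A, greedyOrder G l = some ord.toList ∧ ord.width G = 2) ↔
          pmw G = 2) ∧
        (greedyOrder G l = none ↔ pmw G ≠ 2)) ∧
    ∃ (prog : RAM.Cmd) (p : Polynomial ℕ),
      ∀ (N : ℕ) (G : SimpleGraph (Fin N)) [DecidableRel G.Adj] (A B : Finset (Fin N)),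
        IsBrace G → HasColourClasses G A B →
        ∃ (s : RAM.Store) (t : ℕ), prog.Runs (RAM.inputStore G A) s t ∧ t ≤ p.eval N ∧
          (pmw G ≠ 2 → s.var 0 = 0) ∧
          (pmw G = 2 → s.var 0 = 1 ∧
            ∃ (m : ℕ) (D : PMDecomposition (Fin N) (Fin m)),
              s.HoldsDecomposition D ∧ D.width G = 2 ∧
              (6 ≤ N → ∃ ord : LinOrdering A,
                greedyOrder G ((List.finRange N).filter (· ∈ A)) = some ord.toList ∧
                ord.width G = 2 ∧ s.HoldsOrdering ord ∧
                ∀ a : {a // a ∈ A}, (ord a : ℕ) + 4 ≤ #A →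
                  ∃ t₁ t₂, D.tree.Adj t₁ t₂ ∧
                    D.shore t₁ t₂ = (↑(ord.pred a ∪ ord.reach G a) : Set (Fin N)))) := by
  constructor
  · intro V _ _ G _ A B hG hAB h6 l hl hlA
    exact hG.greedyOrder_iff hAB h6 hl hlA
  · refine ⟨RAM.program, RAM.Prog.costBound RAM.mainProg + 2, fun N G _ A B hG hAB => ?_⟩
    obtain ⟨t, h1, h2⟩ := RAM.program_runs (G := G) (A := A)
    exact ⟨_, t, h1, h2, RAM.mainProg_spec hG hAB rfl⟩
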